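/- Let $\tilde M$ be a complex manifold of dimension $n+k$, with complex structure $\mathcal J$ on its tangent spaces, and let $M\subset\tilde M$ be a generic CR submanifold of type $(n,k)$: a smooth embedded real submanifold of real dimension $2n+k$ with $T_xM+\mathcal J T_xM=T_x\tilde M$ for every $x\in M$. Put $H_xM=T_xM\cap \mathcal J T_xM$. Let $H^0M=\{\xi\in T^*M : \xi|_{H_xM}=0,\ x=\pi(\xi)\}$ be the characteristic bundle, with $\pi:T^*M\to M$ the projection, and let $\dot H^0M$ be the open subset of its nonzero covectors. For $\xi\in H^0_xM$ the Levi form $\mathcal L_\xi$ is the Hermitian form on $H_xM$ with $\mathcal L_\xi(X)=d\tilde\xi(X,\mathcal JX)=\xi([\mathcal J\tilde X,\tilde X])$ for $X\in H_xM$, where $\tilde\xi$ is any smooth local section of $H^0M$ extending $\xi$ and $\tilde X$ any smooth local section of $HM$ extending $X$; $\operatorname{rank}\mathcal L_\xi$ is its (complex) rank. Let $\vartheta$ be the tautological one-form on $H^0M$, $\vartheta(X)=\xi(\pi_*X)$ for $X\in T_\xi H^0M$, and set $$N_\xi H^0M=\{X\in T_\xi H^0M:\vartheta(X)=0\},\qquad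 H_\xi H^0M=\{X\in N_\xi H^0M: d\vartheta(X,Y)=0\ \ \forall\, Y\in T_\xi H^0M\}.$$ A point $\xi_0\in\dot H^0M$ is called regular if there are an open neighborhood $U$ of $\xi_0$ in $\dot H^0M$ and a smooth submanifold $V$ of $U$ with $\xi_0\in V$, $T_\xi V\subset H_\xi H^0M$ for all $\xi\in V$, and $T_{\xi_0}V=H_{\xi_0}H^0M$. Corollary 4.4. Let $\xi_0\in\dot H^0M$ satisfy $$\operatorname{rank}\mathcal L_{\xi_0}=\limsup_{\xi\to\xi_0,\ \xi\in\dot H^0M}\operatorname{rank}\mathcal L_\xi .$$ Then $\xi_0$ is regular, and there is an open neighborhood $U$ of $\xi_0$ in $\dot H^0M$ such that every $\xi\in U$ is regular and satisfies $\operatorname{rank}\mathcal L_\xi=\operatorname{rank}\mathcal L_{\xi_0}$. -/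

import Mathlib

open Set Filter Topology Bundle Manifold
open scoped ContDiff

noncomputable section

namespace CRGeom

/-! ### One-forms, tangent vectors and submanifolds on a real manifold -/

section General

variable {G H P : Type*} [NormedAddCommGroup G] [NormedSpace ℝ G] [TopologicalSpace H]
  (I : ModelWithCorners ℝ G H) [TopologicalSpace P] [ChartedSpace H P]

/-- The expression of a one-form `α` on the boundaryless manifold `P` in the preferred chart at
`p`: the pull-back of `α` by the inverse of that chart, a one-form on (an open subset of) the
model space. -/
def oneFormInChart (α : ∀ q : P, TangentSpace I q →L[ℝ] ℝ) (p : P) : G → (G →L[ℝ] ℝ) :=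
  fun y => (α ((extChartAt I p).symm y)).comp (mfderiv 𝓘(ℝ, G) I (extChartAt I p).symm y)

/-- The exterior derivative at `p` of a one-form `α` on the boundaryless manifold `P`,
`dα(X, Y) = ∂_X α(Y) - ∂_Y α(X)`, computed in the preferred chart at `p`. (The tangent space at
`p` is identified by Mathlib with the model space through the same chart.) -/
def extDerivOneForm (α : ∀ q : P, TangentSpace I q →L[ℝ] ℝ) (p : P) :
    G →L[ℝ] G →L[ℝ] ℝ :=
  fderiv ℝ (oneFormInChart I α p) (extChartAt I p p) -
    (fderiv ℝ (oneFormInChart I α p) (extChartAt I p p)).flip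

/-- The vectors tangent at `p` to a subset `S` of a manifold: the velocities at `p` of the curves
through `p` that stay in `S`. If `S` is a submanifold, this is its tangent space. -/
def tangentVectors (S : Set P) (p : P) : Set (TangentSpace I p) :=
  {X | ∃ γ : ℝ → P, γ 0 = p ∧ (∀ᶠ t in 𝓝 0, γ t ∈ S) ∧
    HasMFDerivAt 𝓘(ℝ, ℝ) I γ 0 (ContinuousLinearMap.toSpanSingleton ℝ (X : G))}

/-- `S` is an embedded smooth submanifold of the manifold `P`: near each of its points it is the
zero set of a smooth submersion to some `ℝ^c`. -/
def IsSmoothSubmanifold (S : Set P) : Prop :=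
  ∀ p ∈ S, ∃ (c : ℕ) (U : Set P) (g : P → EuclideanSpace ℝ (Fin c)), IsOpen U ∧ p ∈ U ∧
    ContMDiffOn I 𝓘(ℝ, EuclideanSpace ℝ (Fin c)) ∞ g U ∧
    (∀ q ∈ U, Function.Surjective (mfderiv I 𝓘(ℝ, EuclideanSpace ℝ (Fin c)) g q)) ∧
    S ∩ U = {q ∈ U | g q = 0}

end General

/-- The model space `ℝ^m` of real manifolds of dimension `m`. -/
abbrev RModel (m : ℕ) : Type := EuclideanSpace ℝ (Fin m)

/-- The model space `ℂ^m` of complex manifolds of complex dimension `m`. -/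
abbrev CModel (m : ℕ) : Type := EuclideanSpace ℂ (Fin m)

/-- The cotangent bundle `T*M` of a real manifold `M` modelled on `F`. -/
abbrev Cotangent (F M : Type*) [NormedAddCommGroup F] [NormedSpace ℝ F] [TopologicalSpace M]
    [ChartedSpace F M] : Type _ :=
  TotalSpace (F →L[ℝ] ℝ) (fun x : M => TangentSpace 𝓘(ℝ, F) x →L[ℝ] ℝ)

/-- The model `F × F*` of the manifold `T*M`, for a manifold `M` modelled on `F`. -/
abbrev cotangentModel (F : Type*) [NormedAddCommGroup F] [NormedSpace ℝ F] :
    ModelWithCorners ℝ (F × (F →L[ℝ] ℝ)) (ModelProd F (F →L[ℝ] ℝ)) :=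
  𝓘(ℝ, F).prod 𝓘(ℝ, F →L[ℝ] ℝ)

/-! ### Generic CR submanifolds of a complex manifold -/

section CR

theorem smul_eq_re_im {E : Type*} [NormedAddCommGroup E] [NormedSpace ℂ E] (c : ℂ) (a : E) :
    c • a = c.re • a + c.im • (Complex.I • a) := by
  conv_lhs => rw [← Complex.re_add_im c]
  rw [add_smul, mul_smul, Complex.coe_smul, Complex.coe_smul]

theorem I_smul_smul {E : Type*} [NormedAddCommGroup E] [NormedSpace ℂ E] (c : ℂ) (a : E) :
    Complex.I • (c • a) = c.re • (Complex.I • a) - c.im • a := by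
  rw [smul_comm, smul_eq_re_im, smul_smul Complex.I Complex.I,
    Complex.I_mul_I, neg_one_smul, smul_neg, sub_eq_add_neg]

variable (F E : Type*) {M Z : Type*} [NormedAddCommGroup F] [NormedSpace ℝ F]
  [NormedAddCommGroup E] [NormedSpace ℂ E]
  [TopologicalSpace M] [ChartedSpace F M] [TopologicalSpace Z] [ChartedSpace E Z]

/-- The real differential `T_x M → T_{f x} Z` of a map from a real manifold to a complex manifold.
The tangent spaces `T_x M` and `T_{f x} Z` are identified by Mathlib with the model spaces `F`
and `E` through charts; the chart of `Z` is holomorphic, so the complex structure of `T_{f x} Z`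
is multiplication by `Complex.I` on `E`. -/
def realDiff (f : M → Z) (x : M) : F →L[ℝ] E :=
  mfderiv 𝓘(ℝ, F) 𝓘(ℝ, E) f x

/-- `f` embeds the real manifold `M` as a generic CR submanifold of the complex manifold `Z`: it
is a smooth embedding, and `T M + i T M = T Z` at each point of `M`. When `dim_ℝ M = 2n + k` and
`dim_ℂ Z = n + k`, the CR structure induced on `M` is of type `(n, k)`. -/
structure IsGenericCREmbedding (f : M → Z) : Prop where
  isSmoothEmbedding : IsSmoothEmbedding 𝓘(ℝ, F) 𝓘(ℝ, E) ∞ f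
  generic : ∀ (x : M) (u : E), ∃ v w : F,
    u = realDiff F E f x v + Complex.I • realDiff F E f x w

/-- The image `T_x M ∩ i T_x M` in `T_{f x} Z` of the holomorphic tangent space `H_x M`, as a
complex vector space. -/
def holTangent (f : M → Z) (x : M) : Submodule ℂ E where
  carrier := {u | u ∈ range (realDiff F E f x) ∧ Complex.I • u ∈ range (realDiff F E f x)}
  zero_mem' := ⟨⟨0, by simp⟩, ⟨0, by simp⟩⟩
  add_mem' := by
    rintro a b ⟨⟨v, hv⟩, ⟨w, hw⟩⟩ ⟨⟨v', hv'⟩, ⟨w', hw'⟩⟩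
    exact ⟨⟨v + v', by rw [map_add, hv, hv']⟩, ⟨w + w', by rw [map_add, hw, hw', smul_add]⟩⟩
  smul_mem' := by
    rintro c a ⟨⟨v, hv⟩, ⟨w, hw⟩⟩
    refine ⟨⟨c.re • v + c.im • w, ?_⟩, ⟨c.re • w - c.im • v, ?_⟩⟩
    · rw [map_add, map_smul, map_smul, hv, hw, smul_eq_re_im c a]
    · rw [map_sub, map_smul, map_smul, hv, hw, I_smul_smul]

/-- The characteristic bundle `H⁰M ⊆ T*M`: the real covectors that vanish on `H M`. -/
def charBundle (f : M → Z) : Set (Cotangent F M) :=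
  {ξ | ∀ v : TangentSpace 𝓘(ℝ, F) ξ.proj,
    realDiff F E f ξ.proj v ∈ holTangent F E f ξ.proj → ξ.snd v = 0}

/-- The set of nonzero characteristic covectors. -/
def charBundleDot (f : M → Z) : Set (Cotangent F M) :=
  {ξ | ξ ∈ charBundle F E f ∧ ξ.snd ≠ 0}

/-! ### The Levi form -/

/-- `σ` is, near the base point of `ξ`, a smooth section of `H⁰M` extending `ξ`. -/
def IsCharExtension [IsManifold 𝓘(ℝ, F) ∞ M] (f : M → Z) (ξ : Cotangent F M)
    (σ : ∀ y : M, TangentSpace 𝓘(ℝ, F) y →L[ℝ] ℝ) : Prop :=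
  σ ξ.proj = ξ.snd ∧ ∃ U : Set M, IsOpen U ∧ ξ.proj ∈ U ∧
    ContMDiffOn 𝓘(ℝ, F) (cotangentModel F) ∞
      (fun y => (⟨y, σ y⟩ : Cotangent F M)) U ∧
    ∀ y ∈ U, (⟨y, σ y⟩ : Cotangent F M) ∈ charBundle F E f

/-- A smooth local section of `H⁰M` extending `ξ`. The Levi form does not depend on it. -/
def charExtension [IsManifold 𝓘(ℝ, F) ∞ M] (f : M → Z) (ξ : Cotangent F M) :
    ∀ y : M, TangentSpace 𝓘(ℝ, F) y →L[ℝ] ℝ :=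
  Classical.epsilon (IsCharExtension F E f ξ)

/-- The bilinear form `(X, Y) ↦ dξ̃(X, Y)` at `x`, for a one-form `ξ̃ = σ` extending `ξ`; the
vectors `X`, `Y` tangent to `M` are given through their images in `T_{f x} Z`. -/
def dExt (f : M → Z) (σ : ∀ y : M, TangentSpace 𝓘(ℝ, F) y →L[ℝ] ℝ) (x : M) (u v : E) : ℝ :=
  extDerivOneForm 𝓘(ℝ, F) σ x ((realDiff F E f x).toLinearMap.leftInverse u)
    ((realDiff F E f x).toLinearMap.leftInverse v)

/-- The Levi form at the characteristic covector `ξ`, as a Hermitian form on `H_x M`: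
`L_ξ(X, Y) = dξ̃(Y, JX) + i dξ̃(Y, X)`, so that `L_ξ(X, X) = dξ̃(X, JX) = ξ([J X̃, X̃])`.
It is recorded as the `ℂ`-linear map `X ↦ L_ξ(X, ·)`. -/
def leviForm [IsManifold 𝓘(ℝ, F) ∞ M] (f : M → Z) (ξ : Cotangent F M) :
    holTangent F E f ξ.proj →ₗ[ℂ] (holTangent F E f ξ.proj → ℂ) where
  toFun X := fun Y =>
    (dExt F E f (charExtension F E f ξ) ξ.proj (Y : E) (Complex.I • (X : E)) : ℂ) +
      Complex.I * (dExt F E f (charExtension F E f ξ) ξ.proj (Y : E) (X : E) : ℂ)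
  map_add' X X' := by
    funext Y
    simp only [dExt, Submodule.coe_add, smul_add, map_add, Complex.ofReal_add, Pi.add_apply]
    ring
  map_smul' c X := by
    funext Y
    simp only [dExt, Submodule.coe_smul, I_smul_smul]
    rw [smul_eq_re_im c (X : E)]
    simp only [map_add, map_sub, map_smul, smul_eq_mul, Complex.ofReal_add, Complex.ofReal_sub,
      Complex.ofReal_mul, Pi.smul_apply, RingHom.id_apply]
    apply Complex.ext <;> simp

/-- The rank of the Hermitian form `L_ξ`. -/
def leviRank [IsManifold 𝓘(ℝ, F) ∞ M] (f : M → Z) (ξ : Cotangent F M) : ℕ :=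
  Module.finrank ℂ (LinearMap.range (leviForm F E f ξ))

/-! ### The distribution `H H⁰M` and regular points -/

/-- The tautological one-form `ϑ(X) = ξ(π_* X)` on `T*M`. -/
def tautological (F M : Type*) [NormedAddCommGroup F] [NormedSpace ℝ F] [TopologicalSpace M]
    [ChartedSpace F M] [IsManifold 𝓘(ℝ, F) ∞ M] (ξ : Cotangent F M) :
    TangentSpace (cotangentModel F) ξ →L[ℝ] ℝ :=
  ξ.snd.comp (mfderiv (cotangentModel F) 𝓘(ℝ, F)
    (fun η : Cotangent F M => η.proj) ξ)

/-- `N_ξ H⁰M`: the vectors tangent to `H⁰M` at `ξ` on which `ϑ` vanishes. -/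
def nullSpace [IsManifold 𝓘(ℝ, F) ∞ M] (f : M → Z) (ξ : Cotangent F M) :
    Set (TangentSpace (cotangentModel F) ξ) :=
  {X | X ∈ tangentVectors (cotangentModel F) (charBundle F E f) ξ ∧ tautological F M ξ X = 0}

/-- `H_ξ H⁰M`: the vectors `X` of `N_ξ H⁰M` with `dϑ(X, Y) = 0` for all `Y` tangent to `H⁰M`
at `ξ`. (The exterior derivative of the restriction of `ϑ` to `H⁰M` is the restriction
of `dϑ`.) -/
def charDistribution [IsManifold 𝓘(ℝ, F) ∞ M] (f : M → Z) (ξ : Cotangent F M) :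
    Set (TangentSpace (cotangentModel F) ξ) :=
  {X | X ∈ nullSpace F E f ξ ∧ ∀ Y ∈ tangentVectors (cotangentModel F) (charBundle F E f) ξ,
    extDerivOneForm (cotangentModel F) (tautological F M) ξ X Y = 0}

/-- A nonzero characteristic covector `ξ₀` is regular if some open neighbourhood `U = O ∩ Ḣ⁰M` of
it contains a smooth submanifold `V` through `ξ₀` with `T_ξ V ⊆ H_ξ H⁰M` for all `ξ ∈ V`, and
`T_{ξ₀} V = H_{ξ₀} H⁰M`. -/
def IsRegularPoint [IsManifold 𝓘(ℝ, F) ∞ M] (f : M → Z) (ξ₀ : Cotangent F M) : Prop :=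
  ξ₀ ∈ charBundleDot F E f ∧ ∃ O V : Set (Cotangent F M), IsOpen O ∧ ξ₀ ∈ V ∧
    V ⊆ O ∩ charBundleDot F E f ∧
    IsSmoothSubmanifold (cotangentModel F) V ∧
    (∀ ξ ∈ V, tangentVectors (cotangentModel F) V ξ ⊆ charDistribution F E f ξ) ∧
    tangentVectors (cotangentModel F) V ξ₀ = charDistribution F E f ξ₀

end CR

end CRGeom

end

/-! The distribution `H H⁰M` is the kernel of a closed two-form, and its dimension is determined by
the Levi rank. Near a point the characteristic bundle is trivialised by a vector-valued one-form `S`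
on `M` with kernel `HM`: characteristic covectors are `c ∘ S(x)`, and in the coordinates `(x, c)`
the tautological form is `c ∘ S`. Its exterior derivative sends `(v, γ)`, `(w, δ)` to `γ(S w) - δ(S
v) + c(dS(v, w))`. For `(v, γ)` in the kernel, varying `δ` forces `S v = 0`, so the condition `ϑ =
0` is automatic; taking `w` in `HM` makes `v` a null vector of `c ∘ dS` on `HM`; and `γ` is then
determined, since `S` is onto (`finrank_flatKer_coframeForm`). As `dS` is of type (1,1) on `HM`,
these null vectors are exactly the kernel of the Levi form (`IsCoframe.leviForm_eq_zero_iff`). Hence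
the kernel of `dϑ` on `H⁰M` has dimension `2n - 2 rank`
(`IsCoframe.leviRank_add_finrank_coframeNull`).

The dimension of a kernel can only drop nearby, so the Levi rank is lower semicontinuous. The limsup
hypothesis is the opposite inequality, so the rank, and with it the dimension of `H H⁰M`, is
constant near `ξ₀`. The kernel of a closed two-form of constant rank is involutive, and the
Frobenius theorem yields through each nearby `ξ` a leaf that is tangent to the distribution and
fills it at `ξ` (`exists_submersion_of_finrank_flatKer_const`). This leaf is the required `V`.

For the Frobenius theorem, the distribution is written as a graph over its value at the base point,
which turns it into a total differential equation `Dy = A(x, y)`. This is solved along rays by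
Picard-Lindelöf; integrability makes the time-one value have derivative `A`
(`norm_sub_sub_le_of_rays`), and smoothness follows by bootstrapping. -/

noncomputable section

set_option synthInstance.maxHeartbeats 200000

namespace CRGeom

/-! ### The Frobenius theorem -/

section Frobenius

open Metric

variable {K C : Type*} [NormedAddCommGroup K] [NormedSpace ℝ K]
  [NormedAddCommGroup C] [NormedSpace ℝ C]

/-- The Picard-Lindelöf theorem, with the information that the solution stays in the ball. -/
theorem exists_solution_mem_closedBall [CompleteSpace C] {f : ℝ → C → C} {tmin tmax : ℝ}
    {t₀ : Icc tmin tmax} {x₀ : C} {a L K : NNReal} (hf : IsPicardLindelof f t₀ x₀ a 0 L K) :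
    ∃ α : ℝ → C, α t₀ = x₀ ∧ (∀ t, α t ∈ closedBall x₀ a) ∧
      ∀ t ∈ Icc tmin tmax, HasDerivWithinAt α (f t (α t)) (Icc tmin tmax) t := by
  have hx : x₀ ∈ closedBall x₀ ((0 : NNReal) : ℝ) := mem_closedBall_self le_rfl
  obtain ⟨α, hα⟩ := ODE.FunSpace.exists_isFixedPt_next hf hx
  -- `compProj` projects the time onto the interval first, so the ball bound holds for every real
  -- time.
  refine ⟨α.compProj, by rw [ODE.FunSpace.compProj_val, ← hα, ODE.FunSpace.next_apply₀],
    fun t => α.compProj_mem_closedBall hf.mul_max_le, fun t ht ↦ ?_⟩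
  apply ODE.hasDerivWithinAt_picard_Icc t₀.2 hf.continuousOn_uncurry
    α.continuous_compProj.continuousOn (fun _ ht' ↦ α.compProj_mem_closedBall hf.mul_max_le)
    x₀ ht |>.congr_of_mem _ ht
  intro t' ht'
  nth_rw 1 [← hα]
  rw [ODE.FunSpace.compProj_of_mem ht', ODE.FunSpace.next_apply]

/-- Grönwall with zero initial value. The inhomogeneous term is scaled by `B` so that the quotient
in the Grönwall bound collapses to `ε`. -/
theorem norm_le_mul_exp_of_norm_deriv_le {f f' : ℝ → C} {B ε : ℝ} (hB : 0 < B) (hε : 0 ≤ ε)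
    (hf : ∀ t ∈ Icc (0 : ℝ) 1, HasDerivWithinAt f (f' t) (Icc 0 1) t) (h0 : f 0 = 0)
    (bound : ∀ t ∈ Icc (0 : ℝ) 1, ‖f' t‖ ≤ B * ‖f t‖ + B * ε) :
    ∀ t ∈ Icc (0 : ℝ) 1, ‖f t‖ ≤ ε * Real.exp B := by
  intro t ht
  have h := norm_le_gronwallBound_of_norm_deriv_right_le (f := f) (f' := f') (δ := 0) (K := B)
    (ε := B * ε) (a := 0) (b := 1) (fun s hs => (hf s hs).continuousWithinAt)
    (fun s hs => (hf s (Ico_subset_Icc_self hs)).mono_of_mem_nhdsWithin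
      (Icc_mem_nhdsGE_of_mem hs))
    (by simp [h0]) (fun s hs => bound s (Ico_subset_Icc_self hs)) t ht
  rw [gronwallBound_of_K_ne_0 hB.ne'] at h
  have h1 : B * ε / B = ε := by field_simp
  simp only [sub_zero, zero_mul, zero_add, h1] at h
  refine h.trans (mul_le_mul_of_nonneg_left ?_ hε)
  have : Real.exp (B * t) ≤ Real.exp B := Real.exp_le_exp.2 (by nlinarith [ht.1, ht.2])
  linarith

/-- The solution at time one of the ordinary differential equation along rays attached to an
integrable total differential equation depends differentiably on the ray. -/
theorem norm_sub_sub_le_of_rays {A : K × C → (K →L[ℝ] C)} {D : Set (K × C)} (hD : Convex ℝ D)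
    {B : ℝ} (hB : 0 < B) (hA : ∀ p ∈ D, ‖A p‖ ≤ B) (hdA : ∀ p ∈ D, DifferentiableAt ℝ A p)
    (hA' : ∀ p ∈ D, ‖fderiv ℝ A p‖ ≤ B)
    (hA'' : ∀ p ∈ D, ∀ q ∈ D, ‖fderiv ℝ A q - fderiv ℝ A p‖ ≤ B * ‖q - p‖)
    (hint : ∀ p ∈ D, ∀ a b, fderiv ℝ A p (a, A p a) b = fderiv ℝ A p (b, A p b) a)
    {x h : K} (hx : ‖x‖ ≤ 1) {z w : ℝ → C} (hz0 : z 0 = 0) (hw0 : w 0 = 0)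
    (hzD : ∀ t ∈ Icc (0 : ℝ) 1, (t • x, z t) ∈ D)
    (hwD : ∀ t ∈ Icc (0 : ℝ) 1, (t • (x + h), w t) ∈ D)
    (hz : ∀ t ∈ Icc (0 : ℝ) 1, HasDerivWithinAt z (A (t • x, z t) x) (Icc 0 1) t)
    (hw : ∀ t ∈ Icc (0 : ℝ) 1, HasDerivWithinAt w (A (t • (x + h), w t) (x + h)) (Icc 0 1) t) :
    ‖w 1 - z 1 - A (x, z 1) h‖ ≤
      ((2 * Real.exp B) ^ 2 + 2 * Real.exp B) * Real.exp B * ‖h‖ ^ 2 := by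
  -- `M * ‖h‖` bounds the distance of the two solutions: their right-hand sides differ by at most `B
  -- * ‖g‖ + B * (2 * ‖h‖)`.
  set M := 2 * Real.exp B with hM
  have hM1 : 1 ≤ M := by
    have := Real.one_le_exp hB.le
    linarith
  have hlip : ∀ p ∈ D, ∀ q ∈ D, ‖A q - A p‖ ≤ B * ‖q - p‖ := fun p hp q hq =>
    hD.norm_image_sub_le_of_norm_fderiv_le hdA hA' hp hq
  have htaylor : ∀ p ∈ D, ∀ q ∈ D, ‖A q - A p - fderiv ℝ A p (q - p)‖ ≤ B * ‖q - p‖ ^ 2 := by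
    intro p hp q hq
    have hs : segment ℝ p q ⊆ D := hD.segment_subset hp hq
    have := (convex_segment p q).norm_image_sub_le_of_norm_hasFDerivWithin_le' (f := A)
      (f' := fderiv ℝ A) (φ := fderiv ℝ A p) (C := B * ‖q - p‖)
      (fun y hy => (hdA y (hs hy)).hasFDerivAt.hasFDerivWithinAt)
      (fun y hy => (hA'' p hp y (hs hy)).trans (by
        gcongr
        exact norm_sub_le_of_mem_segment hy))
      (left_mem_segment ℝ p q) (right_mem_segment ℝ p q)
    rwa [mul_assoc, ← sq] at this
  set g : ℝ → C := fun t => w t - z t with hg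
  have hpq : ∀ t ∈ Icc (0 : ℝ) 1, ∀ c, ‖g t‖ ≤ c → ‖h‖ ≤ c →
      ‖((t • (x + h), w t) : K × C) - (t • x, z t)‖ ≤ c := by
    intro t ht c h1 h2
    rw [Prod.mk_sub_mk, Prod.norm_mk, smul_add, add_sub_cancel_left, norm_smul]
    refine max_le ?_ h1
    rw [Real.norm_of_nonneg ht.1]
    nlinarith [norm_nonneg h, ht.2]
  have hg' : ∀ t ∈ Icc (0 : ℝ) 1, HasDerivWithinAt g
      (A (t • (x + h), w t) (x + h) - A (t • x, z t) x) (Icc 0 1) t :=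
    fun t ht => (hw t ht).sub (hz t ht)
  have hgM : ∀ t ∈ Icc (0 : ℝ) 1, ‖g t‖ ≤ M * ‖h‖ := by
    have := norm_le_mul_exp_of_norm_deriv_le (ε := 2 * ‖h‖) hB (by positivity) hg'
      (by simp [hg, hz0, hw0]) ?_
    · intro t ht
      refine (this t ht).trans (le_of_eq ?_)
      rw [hM]; ring
    · intro t ht
      have e1 : A (t • (x + h), w t) (x + h) - A (t • x, z t) x =
          (A (t • (x + h), w t) - A (t • x, z t)) x + A (t • (x + h), w t) h := by
        simp [map_add]; abel
      rw [e1]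
      have n1 := (A (t • (x + h), w t) - A (t • x, z t)).le_of_opNorm_le
        (hlip _ (hzD t ht) _ (hwD t ht)) x
      have n2 := (A (t • (x + h), w t)).le_of_opNorm_le (hA _ (hwD t ht)) h
      have n3 := hpq t ht (‖g t‖ + ‖h‖) (by linarith [norm_nonneg h])
        (by linarith [norm_nonneg (g t)])
      have n4 := norm_add_le ((A (t • (x + h), w t) - A (t • x, z t)) x) (A (t • (x + h), w t) h)
      have n5 : B * ‖((t • (x + h), w t) : K × C) - (t • x, z t)‖ * ‖x‖ ≤
          B * (‖g t‖ + ‖h‖) * 1 := by gcongr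
      linarith
  -- The deviation of `w - z` from its expected linearisation `t • A h`; at time one it is the
  -- quantity to be estimated.
  set e : ℝ → C := fun t => g t - t • A (t • x, z t) h with he
  have hpath : ∀ t ∈ Icc (0 : ℝ) 1, HasDerivWithinAt (fun t => ((t • x, z t) : K × C))
      (x, A (t • x, z t) x) (Icc 0 1) t := by
    intro t ht
    have := ((hasDerivAt_id t).smul_const x).hasDerivWithinAt (s := Icc 0 1)
    simpa using this.prodMk (hz t ht)
  have he' : ∀ t ∈ Icc (0 : ℝ) 1, HasDerivWithinAt e
      (A (t • (x + h), w t) (x + h) - A (t • x, z t) x -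
        (t • fderiv ℝ A (t • x, z t) (x, A (t • x, z t) x) h + A (t • x, z t) h)) (Icc 0 1) t := by
    intro t ht
    have h1 := (hdA _ (hzD t ht)).hasFDerivAt.comp_hasDerivWithinAt t (hpath t ht)
    have h2 := h1.clm_apply (hasDerivWithinAt_const t (Icc 0 1) h)
    have h3 := (hasDerivWithinAt_id t (Icc 0 1)).smul h2
    have h4 := (hg' t ht).sub h3
    simp only [id_eq, map_zero, add_zero, one_smul] at h4
    exact h4
  have := norm_le_mul_exp_of_norm_deriv_le (ε := (M ^ 2 + M) * ‖h‖ ^ 2) hB (by positivity) he'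
    (by simp [he, hg, hz0, hw0]) ?_ 1 (by simp)
  · simp only [he, one_smul, hg] at this
    refine this.trans (le_of_eq (by ring))
  · intro t ht
    set p : K × C := (t • x, z t) with hp
    set q : K × C := (t • (x + h), w t) with hq
    have hp' := hzD t ht
    have hq' := hwD t ht
    have hqp : q - p = t • (h, A p h) + (0, e t) := by
      simp only [hp, hq, he, hg, Prod.mk_sub_mk, Prod.smul_mk, Prod.mk_add_mk, smul_add]
      simp
    -- Integrability exchanges `x` and `h` in the second-order term, which then cancels against the
    -- derivative of `t • A h`. What is left is a Taylor remainder, a Lipschitz difference applied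
    -- to `h`, and a term linear in `e`; the first two are at most `B * M ^ 2 * ‖h‖ ^ 2` and `B * M
    -- * ‖h‖ ^ 2`, whence the value of `ε`.
    have e1 : A q (x + h) - A p x - (t • fderiv ℝ A p (x, A p x) h + A p h) =
        (A q - A p - fderiv ℝ A p (q - p)) x + (A q - A p) h + fderiv ℝ A p (0, e t) x := by
      have e2 : fderiv ℝ A p (q - p) x =
          t • fderiv ℝ A p (x, A p x) h + fderiv ℝ A p (0, e t) x := by
        rw [hqp, (fderiv ℝ A p).map_add, (fderiv ℝ A p).map_smul, hint p hp' x h]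
        rfl
      simp only [sub_apply, e2, map_add]
      abel
    have hd := hpq t ht (M * ‖h‖) (hgM t ht) (by nlinarith [norm_nonneg h])
    have n1 := (A q - A p - fderiv ℝ A p (q - p)).le_of_opNorm_le (htaylor p hp' q hq') x
    have n2 := (A q - A p).le_of_opNorm_le (hlip p hp' q hq') h
    have n3 := (fderiv ℝ A p (0, e t)).le_of_opNorm_le
      ((fderiv ℝ A p).le_of_opNorm_le (hA' p hp') (0, e t)) x
    have n4 : ‖((0 : K), e t)‖ = ‖e t‖ := by simp [Prod.norm_mk]
    rw [n4] at n3
    have m1 : B * ‖q - p‖ ^ 2 * ‖x‖ ≤ B * (M * ‖h‖) ^ 2 * 1 := by gcongr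
    have m2 : B * ‖q - p‖ * ‖h‖ ≤ B * (M * ‖h‖) * ‖h‖ := by gcongr
    have m3 : B * ‖e t‖ * ‖x‖ ≤ B * ‖e t‖ * 1 := by gcongr
    rw [e1]
    refine (norm_add₃_le ..).trans ?_
    nlinarith

theorem eventually_norm_lt_add_one {X V : Type*} [TopologicalSpace X] [NormedAddCommGroup V]
    {f : X → V} {x : X} (h : ContinuousAt f x) : ∀ᶠ p in 𝓝 x, ‖f p‖ < ‖f x‖ + 1 :=
  h.norm.eventually_lt_const (by simp)

set_option synthInstance.maxHeartbeats 200000 in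
/-- An integrable total differential equation `Dy = A(x, y)` with smooth coefficients has a smooth
solution near the origin. -/
theorem exists_hasFDerivAt_of_integrable [CompleteSpace C] {A : K × C → (K →L[ℝ] C)}
    {U : Set (K × C)} (hU : IsOpen U) (h0 : (0 : K × C) ∈ U) (hA : ContDiffOn ℝ ∞ A U)
    (hint : ∀ p ∈ U, ∀ a b, fderiv ℝ A p (a, A p a) b = fderiv ℝ A p (b, A p b) a) :
    ∃ (y : K → C) (r : ℝ), 0 < r ∧ y 0 = 0 ∧ ContDiffOn ℝ ∞ y (ball 0 r) ∧
      ∀ x ∈ ball (0 : K) r, (x, y x) ∈ U ∧ HasFDerivAt y (A (x, y x)) x := by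
  have hA0 : ContDiffAt ℝ ∞ A 0 := hA.contDiffAt (hU.mem_nhds h0)
  have hA1 : ContDiffAt ℝ 1 (fderiv ℝ A) 0 := hA0.fderiv_right (m := 1) (by norm_cast)
  obtain ⟨c2, s2, hs2, hl2⟩ := hA1.exists_lipschitzOnWith
  -- One constant bounding `A`, its derivative and the Lipschitz constant of that derivative; the
  -- added ones make the bounds hold on a neighbourhood.
  set B : ℝ := max (max (‖A 0‖ + 1) (‖fderiv ℝ A 0‖ + 1)) c2 with hB
  have hBpos : 0 < B := by
    have : ‖A 0‖ + 1 ≤ B := (le_max_left _ _).trans (le_max_left _ _)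
    linarith [norm_nonneg (A 0)]
  have e1 : ∀ᶠ p in 𝓝 (0 : K × C), ‖A p‖ < ‖A 0‖ + 1 :=
    eventually_norm_lt_add_one hA0.continuousAt
  have e2 : ∀ᶠ p in 𝓝 (0 : K × C), ‖fderiv ℝ A p‖ < ‖fderiv ℝ A 0‖ + 1 :=
    eventually_norm_lt_add_one hA1.continuousAt
  obtain ⟨R, hR, hRD⟩ := nhds_basis_closedBall.mem_iff.1
    (inter_mem (inter_mem (hU.mem_nhds h0) hs2) (inter_mem e1 e2))
  set D : Set (K × C) := closedBall 0 R with hDdef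
  have hDU : D ⊆ U := fun p hp => (hRD hp).1.1
  have hDA : ∀ p ∈ D, ‖A p‖ ≤ B := fun p hp =>
    (le_of_lt (hRD hp).2.1).trans ((le_max_left _ _).trans (le_max_left _ _))
  have hDA' : ∀ p ∈ D, ‖fderiv ℝ A p‖ ≤ B := fun p hp =>
    (le_of_lt (hRD hp).2.2).trans ((le_max_right _ _).trans (le_max_left _ _))
  have hDd : ∀ p ∈ D, DifferentiableAt ℝ A p := fun p hp =>
    (hA.contDiffAt (hU.mem_nhds (hDU hp))).differentiableAt (by simp)
  have hDA'' : ∀ p ∈ D, ∀ q ∈ D, ‖fderiv ℝ A q - fderiv ℝ A p‖ ≤ B * ‖q - p‖ := by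
    intro p hp q hq
    refine (hl2.norm_sub_le (hRD hq).1.2 (hRD hp).1.2).trans ?_
    gcongr
    exact le_max_right _ _
  have hD : Convex ℝ D := convex_closedBall _ _
  have hlip : ∀ p ∈ D, ∀ q ∈ D, ‖A q - A p‖ ≤ B * ‖q - p‖ := fun p hp q hq =>
    hD.norm_image_sub_le_of_norm_fderiv_le hDd hDA' hp hq
  -- `r ≤ 1` serves the ray estimate and the Lipschitz bound, `r ≤ R` keeps `t • x` in the domain,
  -- and `B * r ≤ R` limits the speed so that solutions stay in the ball of radius `R` up to time
  -- one.
  obtain ⟨r, hr, hr1, hrR, hrB⟩ : ∃ r : ℝ, 0 < r ∧ r ≤ 1 ∧ r ≤ R ∧ B * r ≤ R := by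
    refine ⟨min 1 (min R (R / B)), by positivity, min_le_left _ _,
      (min_le_right _ _).trans (min_le_left _ _), ?_⟩
    have : min 1 (min R (R / B)) ≤ R / B := (min_le_right _ _).trans (min_le_right _ _)
    calc B * min 1 (min R (R / B)) ≤ B * (R / B) := by gcongr
      _ = R := by field_simp
  have hmem : ∀ x ∈ ball (0 : K) r, ∀ t ∈ Icc (0 : ℝ) 1, ∀ c ∈ closedBall (0 : C) R,
      (t • x, c) ∈ D := by
    intro x hx t ht c hc
    rw [mem_ball_zero_iff] at hx
    rw [mem_closedBall_zero_iff] at hc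
    rw [hDdef, mem_closedBall_zero_iff, Prod.norm_mk, norm_smul, Real.norm_of_nonneg ht.1]
    refine max_le ?_ hc
    nlinarith [norm_nonneg x, ht.2]
  -- Restricted to the ray through `x`, the equation is an ordinary one; the candidate solution is
  -- the value `z x 1`. Outside the ball `z x` is irrelevant.
  have hex : ∀ x : K, ∃ z : ℝ → C, x ∈ ball (0 : K) r → z 0 = 0 ∧
      (∀ t, z t ∈ closedBall (0 : C) R) ∧
      ∀ t ∈ Icc (0 : ℝ) 1, HasDerivWithinAt z (A (t • x, z t) x) (Icc 0 1) t := by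
    intro x
    by_cases hx : x ∈ ball (0 : K) r
    swap
    · exact ⟨0, fun h => absurd h hx⟩
    have hx' := hx
    rw [mem_ball_zero_iff] at hx'
    have hPL : IsPicardLindelof (fun t c => A (t • x, c) x) (tmin := 0) (tmax := 1)
        ⟨0, by simp⟩ (0 : C) ⟨R, hR.le⟩ 0 ⟨R, hR.le⟩ ⟨B, hBpos.le⟩ := by
      refine ⟨fun t ht => LipschitzOnWith.of_dist_le_mul fun c hc d hd => ?_,
        fun c hc => ?_, fun t ht c hc => ?_, by simp⟩
      · rw [dist_eq_norm, dist_eq_norm, ← sub_apply]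
        refine ((A (t • x, c) - A (t • x, d)).le_of_opNorm_le
          (hlip _ (hmem x hx t ht d hd) _ (hmem x hx t ht c hc)) x).trans ?_
        have : ‖((t • x, c) : K × C) - (t • x, d)‖ = ‖c - d‖ := by simp [Prod.norm_mk]
        rw [this]
        change _ ≤ B * ‖c - d‖
        have h0 : 0 ≤ B * ‖c - d‖ := by positivity
        nlinarith
      · have hcont : ContinuousOn (fun t : ℝ => A (t • x, c)) (Icc 0 1) :=
          hA.continuousOn.comp (by fun_prop) fun t ht => hDU (hmem x hx t ht c hc)
        exact hcont.clm_apply continuousOn_const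
      · refine ((A (t • x, c)).le_of_opNorm_le (hDA _ (hmem x hx t ht c hc)) x).trans ?_
        change _ ≤ R
        nlinarith
    obtain ⟨z, hz0, hzb, hz⟩ := exists_solution_mem_closedBall hPL
    exact ⟨z, fun _ => ⟨hz0, hzb, hz⟩⟩
  choose z hz using hex
  have hzD : ∀ x ∈ ball (0 : K) r, (x, z x 1) ∈ D := by
    intro x hx
    simpa using hmem x hx 1 (by simp) _ ((hz x hx).2.1 1)
  have hder : ∀ x ∈ ball (0 : K) r, HasFDerivAt (fun x => z x 1) (A (x, z x 1)) x := by
    intro x hx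
    have hO : (fun x' => z x' 1 - z x 1 - A (x, z x 1) (x' - x)) =O[𝓝 x]
        fun x' => ‖x' - x‖ ^ 2 := by
      refine Asymptotics.IsBigO.of_bound
        (((2 * Real.exp B) ^ 2 + 2 * Real.exp B) * Real.exp B) ?_
      filter_upwards [isOpen_ball.mem_nhds hx] with x' hx'
      rw [norm_pow, norm_norm]
      have e : x' = x + (x' - x) := by abel
      have hx1 : ‖x‖ ≤ 1 := by
        rw [mem_ball_zero_iff] at hx
        linarith
      refine norm_sub_sub_le_of_rays hD hBpos hDA hDd hDA' hDA''
        (fun p hp => hint p (hDU hp)) hx1 (hz x hx).1 (hz x' hx').1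
        (fun t ht => hmem x hx t ht _ ((hz x hx).2.1 t)) (fun t ht => ?_) (hz x hx).2.2
        (fun t ht => ?_)
      · rw [← e]
        exact hmem x' hx' t ht _ ((hz x' hx').2.1 t)
      · rw [← e]
        exact (hz x' hx').2.2 t ht
    have h1 := hO.hasFDerivAt (𝕜 := ℝ) (by norm_num)
    have h2 := (h1.add (((A (x, z x 1)).hasFDerivAt (x := x)).sub_const
      (A (x, z x 1) x))).add_const (z x 1)
    rw [zero_add] at h2
    refine h2.congr_of_eventuallyEq (Eventually.of_forall fun x' => ?_)
    simp
  refine ⟨fun x => z x 1, r, hr, ?_, ?_, fun x hx => ⟨hDU (hzD x hx), hder x hx⟩⟩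
  · have hx0 : (0 : K) ∈ ball (0 : K) r := mem_ball_self hr
    -- On the ray of `x = 0` the right-hand side vanishes, so the solution stays at zero.
    have := norm_le_mul_exp_of_norm_deriv_le (ε := 0) (f := z 0) (f' := 0) hBpos le_rfl
      (fun t ht => by simpa using (hz 0 hx0).2.2 t ht) (hz 0 hx0).1
      (fun t ht => by simp; positivity) 1 (by simp)
    simpa using this
  · rw [contDiffOn_infty]
    intro n
    -- Bootstrapping: if `y` is of class `C^n`, so is its derivative `A (x, y x)`, and `y` is of
    -- class `C^(n+1)`.
    induction n with
    | zero =>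
      refine (contDiffOn_zero (𝕜 := ℝ)).2 fun x hx => ?_
      have := (hder x hx).continuousAt
      exact this.continuousWithinAt
    | succ n ih =>
      have : ((n + 1 : ℕ) : WithTop ℕ∞) = (n : WithTop ℕ∞) + 1 := by norm_cast
      rw [this, contDiffOn_succ_iff_fderiv_of_isOpen isOpen_ball]
      refine ⟨fun x hx => (hder x hx).differentiableAt.differentiableWithinAt, by simp, ?_⟩
      have hc : ContDiffOn ℝ n (fun x => A (x, z x 1)) (ball 0 r) :=
        (hA.of_le (by exact_mod_cast le_top)).comp (contDiffOn_id.prodMk ih)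
          fun x hx => hDU (hzD x hx)
      exact hc.congr fun x hx => (hder x hx).fderiv

end Frobenius

/-! ### Integrability of the kernel of an exact two-form of constant rank -/

section ClosedTwoForm

open Metric

variable {A : Type*} [NormedAddCommGroup A] [NormedSpace ℝ A]

/-- The exterior derivative of a one-form on a normed space. -/
def flatExtDeriv (β : A → (A →L[ℝ] ℝ)) (a : A) : A →L[ℝ] A →L[ℝ] ℝ :=
  fderiv ℝ β a - (fderiv ℝ β a).flip

theorem flatExtDeriv_apply (β : A → (A →L[ℝ] ℝ)) (a u v : A) :
    flatExtDeriv β a u v = fderiv ℝ β a u v - fderiv ℝ β a v u := rfl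

theorem flatExtDeriv_swap (β : A → (A →L[ℝ] ℝ)) (a u v : A) :
    flatExtDeriv β a u v = -flatExtDeriv β a v u := by
  simp [flatExtDeriv_apply]

/-- The space of vectors contracted to zero by the exterior derivative of a one-form. -/
def flatKer (β : A → (A →L[ℝ] ℝ)) (a : A) : Submodule ℝ A :=
  LinearMap.ker (flatExtDeriv β a : A →ₗ[ℝ] (A →L[ℝ] ℝ))

theorem mem_flatKer {β : A → (A →L[ℝ] ℝ)} {a u : A} :
    u ∈ flatKer β a ↔ flatExtDeriv β a u = 0 := LinearMap.mem_ker

theorem ContDiffOn.clm_left {V W X : Type*} [NormedAddCommGroup V] [NormedSpace ℝ V]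
    [NormedAddCommGroup W] [NormedSpace ℝ W] [NormedAddCommGroup X] [NormedSpace ℝ X]
    (L : V →L[ℝ] W) {f : X → V} {s : Set X} {m : WithTop ℕ∞} (hf : ContDiffOn ℝ m f s) :
    ContDiffOn ℝ m (fun x => L (f x)) s :=
  L.contDiff.comp_contDiffOn hf

theorem DifferentiableAt.fderiv_clm_left {V W X : Type*} [NormedAddCommGroup V] [NormedSpace ℝ V]
    [NormedAddCommGroup W] [NormedSpace ℝ W] [NormedAddCommGroup X] [NormedSpace ℝ X]
    (L : V →L[ℝ] W) {f : X → V} {x : X} (hf : DifferentiableAt ℝ f x) (u : X) :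
    fderiv ℝ (fun x => L (f x)) x u = L (fderiv ℝ f x u) := by
  have h : HasFDerivAt (fun x => L (f x)) (L.comp (fderiv ℝ f x)) x :=
    L.hasFDerivAt.comp x hf.hasFDerivAt
  rw [h.fderiv]
  rfl

/-- The antisymmetrization of a bilinear form, as a continuous linear map. -/
def antisymm (A : Type*) [NormedAddCommGroup A] [NormedSpace ℝ A] :
    (A →L[ℝ] A →L[ℝ] ℝ) →L[ℝ] (A →L[ℝ] A →L[ℝ] ℝ) where
  toFun T := T - T.flip
  map_add' S T := by
    ext u v
    simp only [_root_.sub_apply, _root_.add_apply, ContinuousLinearMap.flip_apply]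
    ring
  map_smul' c T := by
    ext u v
    simp only [_root_.sub_apply, _root_.smul_apply, ContinuousLinearMap.flip_apply,
      RingHom.id_apply, smul_eq_mul]
    ring
  cont := continuous_id.sub (ContinuousLinearMap.flipₗᵢ ℝ A A ℝ).continuous

theorem antisymm_apply (T : A →L[ℝ] A →L[ℝ] ℝ) (u v : A) :
    antisymm A T u v = T u v - T v u := rfl

theorem flatExtDeriv_eq (β : A → (A →L[ℝ] ℝ)) :
    flatExtDeriv β = fun a => antisymm A (fderiv ℝ β a) := rfl

theorem contDiffOn_flatExtDeriv {β : A → (A →L[ℝ] ℝ)} {Ω : Set A} (hΩ : IsOpen Ω)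
    (hβ : ContDiffOn ℝ ∞ β Ω) : ContDiffOn ℝ ∞ (flatExtDeriv β) Ω := by
  have h1 : ContDiffOn ℝ ∞ (fderiv ℝ β) Ω := hβ.fderiv_of_isOpen hΩ (by simp)
  exact ContDiffOn.clm_left (V := A →L[ℝ] A →L[ℝ] ℝ) (W := A →L[ℝ] A →L[ℝ] ℝ) (antisymm A) h1

theorem fderiv_flatExtDeriv_apply {β : A → (A →L[ℝ] ℝ)} {a : A} (hβ : ContDiffAt ℝ ∞ β a)
    (u v w : A) : fderiv ℝ (flatExtDeriv β) a u v w =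
      fderiv ℝ (fderiv ℝ β) a u v w - fderiv ℝ (fderiv ℝ β) a u w v := by
  have h1 : DifferentiableAt ℝ (fderiv ℝ β) a :=
    (hβ.fderiv_right (m := 1) (by norm_cast)).differentiableAt (by simp)
  have h2 := DifferentiableAt.fderiv_clm_left (V := A →L[ℝ] A →L[ℝ] ℝ)
    (W := A →L[ℝ] A →L[ℝ] ℝ) (antisymm A) h1 u
  rw [flatExtDeriv_eq, h2, antisymm_apply]

/-- `d(dβ) = 0`, in a form adapted to the kernel of `dβ`. -/
theorem fderiv_flatExtDeriv_comm_of_mem_flatKer {β : A → (A →L[ℝ] ℝ)} {a : A}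
    (hβ : ContDiffAt ℝ ∞ β a) {x y : A} (hy : y ∈ flatKer β a)
    (hx : ∀ z, ∃ x', fderiv ℝ (flatExtDeriv β) a z x + flatExtDeriv β a x' = 0) :
    fderiv ℝ (flatExtDeriv β) a x y = fderiv ℝ (flatExtDeriv β) a y x := by
  have hs : IsSymmSndFDerivAt ℝ β a := hβ.isSymmSndFDerivAt (by
    rw [minSmoothness_of_isRCLikeNormedField]
    exact WithTop.coe_le_coe.2 le_top)
  -- With `ω = dβ`, closedness is the vanishing of the cyclic sum of `Dω(x)(y, z)`. The hypothesis
  -- `hx` says that `x` extends to first order to a section of the kernel, so `Dω(z)(x, y) = -ω(x',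
  -- y)`, which is zero since `y` is in the kernel. The two remaining terms give the symmetry.
  ext z
  obtain ⟨x', hx'⟩ := hx z
  have h1 : fderiv ℝ (flatExtDeriv β) a z x y = 0 := by
    have h2 := DFunLike.congr_fun hx' y
    have h3 : flatExtDeriv β a x' y = 0 := by
      rw [flatExtDeriv_swap, mem_flatKer.1 hy]
      simp
    simpa [h3] using h2
  rw [fderiv_flatExtDeriv_apply hβ] at h1
  rw [fderiv_flatExtDeriv_apply hβ, fderiv_flatExtDeriv_apply hβ]
  have e1 := DFunLike.congr_fun (hs.eq x y) z
  have e2 := DFunLike.congr_fun (hs.eq x z) y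
  have e3 := DFunLike.congr_fun (hs.eq y z) x
  rw [e1, e2, e3]
  linarith

/-- The kernel of a bundle map of constant rank, under an integrability condition, is tangent to
the fibre of a submersion, whose tangent space at the given point it fills. -/
theorem exists_submersion_of_finrank_ker_const [FiniteDimensional ℝ A] {V : Type*}
    [NormedAddCommGroup V] [NormedSpace ℝ V] [FiniteDimensional ℝ V]
    {η : A → (A →L[ℝ] V)} {Ω : Set A} (hΩ : IsOpen Ω) (hηs : ContDiffOn ℝ ∞ η Ω) {a₀ : A}
    (ha₀ : a₀ ∈ Ω) {d : ℕ}
    (hd : ∀ a ∈ Ω, Module.finrank ℝ (LinearMap.ker (η a : A →ₗ[ℝ] V)) = d)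
    (hcl : ∀ a ∈ Ω, ∀ x y, η a x = 0 → η a y = 0 →
      (∀ z, ∃ x', fderiv ℝ η a z x + η a x' = 0) → fderiv ℝ η a x y = fderiv ℝ η a y x) :
    ∃ (C : Submodule ℝ A) (O : Set A) (g : A → C), IsOpen O ∧ a₀ ∈ O ∧ O ⊆ Ω ∧
      ContDiffOn ℝ ∞ g O ∧ (∀ a ∈ O, Function.Surjective (fderiv ℝ g a)) ∧ g a₀ = 0 ∧
      (∀ a ∈ O, g a = 0 → ∀ u, fderiv ℝ g a u = 0 → η a u = 0) ∧
      ∀ u, η a₀ u = 0 → ∃ γ : ℝ → A, γ 0 = a₀ ∧ HasDerivAt γ u 0 ∧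
        ∀ᶠ t in 𝓝 0, g (γ t) = 0 := by
  set K := LinearMap.ker (η a₀ : A →ₗ[ℝ] V) with hK
  obtain ⟨C, hC⟩ := K.exists_isCompl
  let Φ : (K × C) ≃L[ℝ] A := (K.prodEquivOfIsCompl C hC).toContinuousLinearEquiv
  have hΦ : ∀ k c, Φ (k, c) = (k : A) + c := fun k c => by
    simp [Φ]
  have hinj : LinearMap.ker ((η a₀ : A →ₗ[ℝ] V).comp C.subtype) = ⊥ := by
    rw [LinearMap.ker_eq_bot']
    intro c hc
    have h1 : (c : A) ∈ K := by
      rw [hK, LinearMap.mem_ker]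
      exact hc
    have := (Submodule.disjoint_def.1 hC.disjoint) _ h1 c.2
    exact_mod_cast this
  -- `P` inverts `η a₀` on the complement `C`, so that `L` below, the part of `P ∘ η` on `C`, is the
  -- identity at the base point and invertible nearby.
  obtain ⟨P', hP'⟩ := LinearMap.exists_leftInverse_of_injective _ hinj
  let P : V →L[ℝ] C := LinearMap.toContinuousLinearMap P'
  have hP : ∀ c : C, P (η a₀ c) = c := fun c => LinearMap.congr_fun hP' c
  let q : K × C → A := fun p => a₀ + Φ p
  have hq : ContDiff ℝ ∞ q := contDiff_const.add Φ.contDiff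
  have hqd : ∀ p, HasFDerivAt q (Φ : K × C →L[ℝ] A) p := fun p =>
    (Φ.hasFDerivAt).const_add a₀
  let B : K × C → (A →L[ℝ] V) := fun p => η (q p)
  let L : K × C → (C →L[ℝ] C) := fun p => P.comp ((B p).comp C.subtypeL)
  let N : K × C → (K →L[ℝ] C) := fun p => P.comp ((B p).comp K.subtypeL)
  have hΩ' : IsOpen (q ⁻¹' Ω) := hΩ.preimage hq.continuous
  have hB : ContDiffOn ℝ ∞ B (q ⁻¹' Ω) := hηs.comp hq.contDiffOn fun p hp => hp
  have hL : ContDiffOn ℝ ∞ L (q ⁻¹' Ω) :=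
    contDiffOn_const.clm_comp (hB.clm_comp contDiffOn_const)
  have hN : ContDiffOn ℝ ∞ N (q ⁻¹' Ω) :=
    contDiffOn_const.clm_comp (hB.clm_comp contDiffOn_const)
  let U : Set (K × C) := q ⁻¹' Ω ∩ L ⁻¹' {T | IsUnit T}
  have : CompleteSpace C := FiniteDimensional.complete ℝ C
  have hunits : IsOpen {T : C →L[ℝ] C | IsUnit T} :=
    Units.isOpen (R := C →L[ℝ] C)
  have hU : IsOpen U := hL.continuousOn.isOpen_inter_preimage hΩ' hunits
  have hq0 : q 0 = a₀ := by simp [q]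
  have hL0 : L 0 = 1 := by
    ext c
    simp [L, B, hq0, hP]
  have h0U : (0 : K × C) ∈ U := by
    refine ⟨by simpa [hq0] using ha₀, ?_⟩
    simp [hL0]
  -- The kernel of `η` at nearby points is to be the graph of `F` over `K`: solving `N k + L c = 0`
  -- for `c`.
  let F : K × C → (K →L[ℝ] C) := fun p => -((Ring.inverse (L p)).comp (N p))
  have hF : ContDiffOn ℝ ∞ F U := by
    have h1 : ContDiffOn ℝ ∞ (fun p => Ring.inverse (L p)) U := by
      intro p hp
      obtain ⟨u, hu⟩ := hp.2
      have h2 : ContDiffAt ℝ ∞ Ring.inverse (L p) := by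
        rw [← hu]
        exact contDiffAt_ringInverse (R := C →L[ℝ] C) ℝ u
      exact h2.comp_contDiffWithinAt p ((hL p hp.1).mono inter_subset_left)
    exact (h1.clm_comp (hN.mono inter_subset_left)).neg
  have hLinj : ∀ p ∈ U, ∀ c : C, B p c = 0 → c = 0 := by
    intro p hp c hc
    have h1 : L p c = 0 := by simp [L, hc]
    have h2 : (Ring.inverse (L p) * L p) c = 0 := by
      change Ring.inverse (L p) (L p c) = 0
      rw [h1, map_zero]
    rwa [Ring.inverse_mul_cancel _ hp.2] at h2
  have hker : ∀ p ∈ U, ∀ k : K, B p (Φ (k, F p k)) = 0 := by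
    intro p hp k
    -- Here the constancy of the rank enters. The projection of the kernel to `K` along `C` is
    -- injective, hence onto since the dimensions agree. So each `k` lifts to a kernel vector, and
    -- applying `P` identifies its `C`-component with `F p k`.
    let pr : LinearMap.ker (η (q p) : A →ₗ[ℝ] V) →ₗ[ℝ] K :=
      (LinearMap.fst ℝ K C).comp ((Φ.symm : A →ₗ[ℝ] K × C).comp (LinearMap.ker (η (q p) : A →ₗ[ℝ] V)).subtype)
    have hpr : Function.Injective pr := by
      rw [← LinearMap.ker_eq_bot, LinearMap.ker_eq_bot']
      intro x hx
      have h1 : (Φ.symm x).1 = 0 := hx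
      have h2 : (x : A) = (Φ.symm x).2 := by
        conv_lhs => rw [← Φ.apply_symm_apply (x : A), ← Prod.mk.eta (p := Φ.symm (x : A)), hΦ, h1]
        simp
      have h3 := LinearMap.mem_ker.1 x.2
      rw [h2] at h3
      have h4 := hLinj p hp _ h3
      rw [h4] at h2
      exact Subtype.ext (by simpa using h2)
    have hsurj : Function.Surjective pr := by
      refine (LinearMap.injective_iff_surjective_of_finrank_eq_finrank ?_).1 hpr
      rw [hd _ hp.1, hd _ ha₀]
    obtain ⟨x, hx⟩ := hsurj k
    have h1 : (x : A) = Φ (k, (Φ.symm x).2) := by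
      conv_lhs => rw [← Φ.apply_symm_apply (x : A)]
      congr 1
      exact Prod.ext hx rfl
    set c := (Φ.symm x).2 with hc
    have h2 : B p (Φ (k, c)) = 0 := by
      rw [← h1]
      exact LinearMap.mem_ker.1 x.2
    have h3 : N p k + L p c = 0 := by
      have : P (B p (Φ (k, c))) = 0 := by rw [h2, map_zero]
      rw [hΦ, map_add, map_add] at this
      exact this
    have h4 : F p k = c := by
      have h5 : (Ring.inverse (L p) * L p) c = c := by
        rw [Ring.inverse_mul_cancel _ hp.2]; rfl
      have h6 : N p k = -L p c := eq_neg_of_add_eq_zero_left h3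
      simp only [F, neg_apply, ContinuousLinearMap.comp_apply, h6, map_neg, neg_neg]
      exact h5
    rw [h4, h2]
  have hFd : ∀ p ∈ U, HasFDerivAt F (fderiv ℝ F p) p := fun p hp =>
    ((hF.contDiffAt (hU.mem_nhds hp)).differentiableAt (by simp)).hasFDerivAt
  -- Differentiating `η (Φ (k, F k)) = 0`: graph vectors extend to sections of the kernel, which is
  -- what `hcl` demands.
  have hdiff : ∀ p ∈ U, ∀ k e, fderiv ℝ η (q p) (Φ e) (Φ (k, F p k)) +
      η (q p) (Φ (0, fderiv ℝ F p e k)) = 0 := by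
    intro p hp k e
    have h1 : HasFDerivAt η (fderiv ℝ η (q p)) (q p) :=
      ((hηs.contDiffAt (hΩ.mem_nhds hp.1)).differentiableAt (by simp)).hasFDerivAt
    have h2 : HasFDerivAt B _ p := h1.comp p (hqd p)
    have h3 : HasFDerivAt (fun p => F p k) _ p := (hFd p hp).clm_apply (hasFDerivAt_const k p)
    have h4 : HasFDerivAt (fun p => Φ (k, F p k)) _ p :=
      Φ.hasFDerivAt.comp p ((hasFDerivAt_const k p).prodMk h3)
    have h5 := h2.clm_apply h4
    have h6 : (fun p => B p (Φ (k, F p k))) =ᶠ[𝓝 p] fun _ => 0 := by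
      filter_upwards [hU.mem_nhds hp] with p' hp' using hker p' hp' k
    have h7 := (h5.congr_of_eventuallyEq h6.symm).unique (hasFDerivAt_const _ p)
    have h8 := DFunLike.congr_fun h7 e
    simp only [_root_.add_apply, ContinuousLinearMap.comp_apply,
      ContinuousLinearMap.flip_apply, ContinuousLinearMap.prod_apply] at h8
    rw [add_comm]
    simpa [B] using h8
  -- As `η` is injective on `C`, the symmetry can be checked after applying `η`, where `hdiff` turns
  -- it into `hcl` for two graph vectors.
  have hint : ∀ p ∈ U, ∀ a b, fderiv ℝ F p (a, F p a) b = fderiv ℝ F p (b, F p b) a := by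
    intro p hp a b
    rw [← sub_eq_zero]
    apply hLinj p hp
    have e1 : ((fderiv ℝ F p (a, F p a) b - fderiv ℝ F p (b, F p b) a : C) : A) =
        Φ (0, fderiv ℝ F p (a, F p a) b) - Φ (0, fderiv ℝ F p (b, F p b) a) := by
      simp [hΦ]
    have c1 := hcl (q p) hp.1 (Φ (a, F p a)) (Φ (b, F p b)) (hker p hp a) (hker p hp b)
      (fun z => ⟨Φ (0, fderiv ℝ F p (Φ.symm z) a), by
        simpa using hdiff p hp a (Φ.symm z)⟩)
    have c2 := hdiff p hp b (a, F p a)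
    have c3 := hdiff p hp a (b, F p b)
    rw [c1] at c2
    rw [e1, map_sub, sub_eq_zero]
    exact add_left_cancel (c2.trans c3.symm)
  obtain ⟨y, r, hr, hy0, hys, hy⟩ := exists_hasFDerivAt_of_integrable hU h0U hF hint
  let s : A → K × C := fun a => Φ.symm (a - a₀)
  have hs : ContDiff ℝ ∞ s := Φ.symm.contDiff.comp (contDiff_id.sub contDiff_const)
  have hqs : ∀ a, q (s a) = a := fun a => by simp [q, s]
  have hsq : ∀ p, s (q p) = p := fun p => by simp [q, s]
  have hsd : ∀ a, HasFDerivAt s (Φ.symm : A →L[ℝ] K × C) a := fun a =>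
    Φ.symm.hasFDerivAt.comp a ((hasFDerivAt_id a).sub_const a₀)
  let g : A → C := fun a => (s a).2 - y (s a).1
  let O : Set A := s ⁻¹' (U ∩ (ball 0 r) ×ˢ univ)
  have hO : IsOpen O := (hU.inter (isOpen_ball.prod isOpen_univ)).preimage hs.continuous
  have hgd : ∀ a ∈ O, ∀ u, fderiv ℝ g a u =
      (Φ.symm u).2 - F ((s a).1, y (s a).1) (Φ.symm u).1 := by
    intro a ha u
    have h1 := (hy (s a).1 ha.2.1).2
    have h2 : HasFDerivAt (fun a => (s a).1) _ a := hasFDerivAt_fst.comp a (hsd a)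
    have h3 : HasFDerivAt (fun a => (s a).2) _ a := hasFDerivAt_snd.comp a (hsd a)
    have h4 : HasFDerivAt (fun a => y (s a).1) _ a := HasFDerivAt.comp a h1 h2
    have h5 : HasFDerivAt g _ a := h3.sub h4
    rw [h5.fderiv]
    rfl
  have hs0 : s a₀ = 0 := by simp [s]
  refine ⟨C, O, g, hO, ?_, fun a ha => ?_, ?_, fun a ha c => ?_, ?_, fun a ha hga u hu => ?_,
    fun u hu => ?_⟩
  · refine ⟨by rw [hs0]; exact h0U, ?_⟩
    rw [hs0]
    exact ⟨mem_ball_self hr, trivial⟩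
  · have := ha.1.1
    rwa [mem_preimage, hqs] at this
  · refine (contDiff_snd.comp hs).contDiffOn.sub (hys.comp (contDiff_fst.comp hs).contDiffOn ?_)
    exact fun a ha => ha.2.1
  · refine ⟨Φ (0, c), ?_⟩
    rw [hgd a ha]
    simp
  · simp [g, hs0, hy0]
  · rw [hgd a ha, sub_eq_zero] at hu
    have h1 : y (s a).1 = (s a).2 := (sub_eq_zero.1 hga).symm
    rw [h1] at hu
    have h2 := hker (s a) ha.1 (Φ.symm u).1
    have h3 : ((Φ.symm u).1, F (s a) (Φ.symm u).1) = Φ.symm u := Prod.ext rfl hu.symm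
    rw [h3, Φ.apply_symm_apply] at h2
    simpa only [B, hqs] using h2
  · let k : K := ⟨u, hu⟩
    have hyk : HasDerivAt (fun t : ℝ => y (t • k)) (F (0, 0) k) 0 := by
      have h1 := (hy 0 (mem_ball_self hr)).2
      rw [hy0] at h1
      have h2 : HasDerivAt (fun t : ℝ => t • k) k 0 := by
        simpa using (hasDerivAt_id (0 : ℝ)).smul_const k
      have h3 : HasFDerivAt y (F (0, 0)) ((0 : ℝ) • k) := by rwa [zero_smul]
      exact h3.comp_hasDerivAt 0 h2
    -- At the base point the distribution is `K` itself, so the curve `t ↦ (t • k, y (t • k))` on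
    -- the leaf has velocity `u`.
    have hF0 : F (0, 0) k = 0 := by
      have : B (0, 0) (k : A) = 0 := by
        change η (q 0) u = 0
        rw [hq0]
        exact LinearMap.mem_ker.1 hu
      simp [F, N, this]
    rw [hF0] at hyk
    refine ⟨fun t => q (t • k, y (t • k)), by simp [hy0, q], ?_, ?_⟩
    · have h2 : HasDerivAt (fun t : ℝ => t • k) k 0 := by
        simpa using (hasDerivAt_id (0 : ℝ)).smul_const k
      have h3 := (hqd _).comp_hasDerivAt (0 : ℝ) (h2.prodMk hyk)
      have h4 : (Φ : K × C →L[ℝ] A) (k, 0) = u := by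
        change Φ (k, 0) = u
        rw [hΦ]; simp [k]
      rwa [h4] at h3
    · refine Eventually.of_forall fun t => ?_
      simp [g, hsq]

/-- The kernel of the exterior derivative of a one-form, if its dimension is constant, is
integrable. -/
theorem exists_submersion_of_finrank_flatKer_const [FiniteDimensional ℝ A]
    {β : A → (A →L[ℝ] ℝ)} {Ω : Set A} (hΩ : IsOpen Ω) (hβ : ContDiffOn ℝ ∞ β Ω) {a₀ : A}
    (ha₀ : a₀ ∈ Ω) {d : ℕ} (hd : ∀ a ∈ Ω, Module.finrank ℝ (flatKer β a) = d) :
    ∃ (C : Submodule ℝ A) (O : Set A) (g : A → C), IsOpen O ∧ a₀ ∈ O ∧ O ⊆ Ω ∧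
      ContDiffOn ℝ ∞ g O ∧ (∀ a ∈ O, Function.Surjective (fderiv ℝ g a)) ∧ g a₀ = 0 ∧
      (∀ a ∈ O, g a = 0 → ∀ u, fderiv ℝ g a u = 0 → u ∈ flatKer β a) ∧
      ∀ u ∈ flatKer β a₀, ∃ γ : ℝ → A, γ 0 = a₀ ∧ HasDerivAt γ u 0 ∧
        ∀ᶠ t in 𝓝 0, g (γ t) = 0 :=
  exists_submersion_of_finrank_ker_const (V := A →L[ℝ] ℝ) hΩ (contDiffOn_flatExtDeriv hΩ hβ) ha₀
    hd fun _ ha _ _ _ hy hx =>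
      fderiv_flatExtDeriv_comm_of_mem_flatKer (hβ.contDiffAt (hΩ.mem_nhds ha)) hy hx

end ClosedTwoForm

/-! ### Naturality of the exterior derivative -/

section Naturality

variable {A G H P : Type*} [NormedAddCommGroup A] [NormedSpace ℝ A]
  [NormedAddCommGroup G] [NormedSpace ℝ G] [TopologicalSpace H]
  {I : ModelWithCorners ℝ G H} [TopologicalSpace P] [ChartedSpace H P]

/-- The pull-back of a one-form by a parametrization. -/
def pullOneForm (I : ModelWithCorners ℝ G H) (α : ∀ q : P, TangentSpace I q →L[ℝ] ℝ)
    (ψ : A → P) : A → (A →L[ℝ] ℝ) :=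
  fun b => (α (ψ b)).comp (mfderiv 𝓘(ℝ, A) I ψ b)

theorem mfderiv_eq_fderiv_extChartAt {ψ : A → P} {a : A} (h : MDifferentiableAt 𝓘(ℝ, A) I ψ a) :
    mfderiv 𝓘(ℝ, A) I ψ a = fderiv ℝ (fun b => extChartAt I (ψ a) (ψ b)) a := by
  refine h.mfderiv.trans ?_
  simp only [modelWithCornersSelf_coe, range_id, fderivWithin_univ, writtenInExtChartAt,
    extChartAt_model_space_eq_id]
  rfl

/-- The second derivative of `χ` enters symmetrically and disappears under antisymmetrisation. -/
theorem flatExtDeriv_comp {ω₀ : G → (G →L[ℝ] ℝ)} {χ : A → G} {a : A}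
    (hχ : ContDiffAt ℝ ∞ χ a) (hω : DifferentiableAt ℝ ω₀ (χ a)) (u v : A) :
    flatExtDeriv (fun b => (ω₀ (χ b)).comp (fderiv ℝ χ b)) a u v =
      flatExtDeriv ω₀ (χ a) (fderiv ℝ χ a u) (fderiv ℝ χ a v) := by
  have h1 : DifferentiableAt ℝ (fderiv ℝ χ) a :=
    (hχ.fderiv_right (m := 1) (by norm_cast)).differentiableAt (by simp)
  have h0 : DifferentiableAt ℝ χ a := hχ.differentiableAt (by simp)
  have h2 : HasFDerivAt (fun b => ω₀ (χ b)) ((fderiv ℝ ω₀ (χ a)).comp (fderiv ℝ χ a)) a :=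
    HasFDerivAt.comp a hω.hasFDerivAt h0.hasFDerivAt
  have hs : IsSymmSndFDerivAt ℝ χ a := hχ.isSymmSndFDerivAt (by
    rw [minSmoothness_of_isRCLikeNormedField]
    exact WithTop.coe_le_coe.2 le_top)
  have h3 := h2.clm_comp h1.hasFDerivAt
  rw [flatExtDeriv_apply, flatExtDeriv_apply, h3.fderiv]
  simp only [_root_.add_apply, ContinuousLinearMap.comp_apply,
    ContinuousLinearMap.compL_apply, ContinuousLinearMap.flip_apply]
  have := DFunLike.congr_arg (ω₀ (χ a)) (hs.eq u v)
  linarith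

/-- Near `a` the pull-back by `ψ` is the pull-back, by the coordinate expression of `ψ`, of the form
written in the chart at `ψ a`; this reduces naturality to normed spaces. It serves both to restrict
`dϑ` to `H⁰M` and to change charts in the Levi form. -/
theorem extDerivOneForm_mfderiv [I.Boundaryless] [IsManifold I ∞ P]
    (α : ∀ q : P, TangentSpace I q →L[ℝ] ℝ) {ψ : A → P} {a : A}
    (hψ : ∀ᶠ b in 𝓝 a, ContMDiffAt 𝓘(ℝ, A) I ∞ ψ b)
    (hα : DifferentiableAt ℝ (oneFormInChart I α (ψ a)) (extChartAt I (ψ a) (ψ a))) (u v : A) :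
    extDerivOneForm I α (ψ a) (mfderiv 𝓘(ℝ, A) I ψ a u) (mfderiv 𝓘(ℝ, A) I ψ a v) =
      flatExtDeriv (pullOneForm I α ψ) a u v := by
  set χ : A → G := fun b => extChartAt I (ψ a) (ψ b) with hχ
  have hsrc : ∀ᶠ b in 𝓝 a, ψ b ∈ (extChartAt I (ψ a)).source :=
    hψ.self_of_nhds.continuousAt.eventually (extChartAt_source_mem_nhds (I := I) (ψ a))
  have hχs : ∀ᶠ b in 𝓝 a, ContDiffAt ℝ ∞ χ b := by
    filter_upwards [hψ, hsrc] with b hb hb'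
    rw [← contMDiffAt_iff_contDiffAt]
    exact (contMDiffAt_extChartAt' (by simpa using hb')).comp b hb
  have hpull : pullOneForm I α ψ =ᶠ[𝓝 a]
      fun b => (oneFormInChart I α (ψ a) (χ b)).comp (fderiv ℝ χ b) := by
    filter_upwards [hψ, hsrc, hsrc.eventually_nhds, hχs] with b hb hb' hb'' hχb
    have e0 : (extChartAt I (ψ a)).symm (χ b) = ψ b := (extChartAt I (ψ a)).left_inv hb'
    have e1 : ((extChartAt I (ψ a)).symm ∘ χ) =ᶠ[𝓝 b] ψ := by
      filter_upwards [hb''] with c hc using (extChartAt I (ψ a)).left_inv hc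
    have hm1 : MDifferentiableAt 𝓘(ℝ, G) I (extChartAt I (ψ a)).symm (χ b) := by
      have h1 := contMDiffOn_extChartAt_symm (I := I) (n := ∞) (ψ a)
      exact (h1.contMDiffAt ((isOpen_extChartAt_target (ψ a)).mem_nhds
        ((extChartAt I (ψ a)).map_source hb'))).mdifferentiableAt (by simp)
    have hm2 : MDifferentiableAt 𝓘(ℝ, A) 𝓘(ℝ, G) χ b :=
      (hχb.differentiableAt (by simp)).mdifferentiableAt
    have e2 := mfderiv_comp b hm1 hm2
    rw [e1.mfderiv_eq, mfderiv_eq_fderiv] at e2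
    -- All tangent spaces are the same model space, so equal base points can be exchanged without a
    -- transport.
    have e3 : ∀ q q' : P, q = q' → ∀ X : G, (α q : G →L[ℝ] ℝ) X = (α q' : G →L[ℝ] ℝ) X := by
      rintro q _ rfl X
      rfl
    ext w
    have e4 := DFunLike.congr_fun e2 w
    change α (ψ b) (mfderiv 𝓘(ℝ, A) I ψ b w) = _
    exact (congrArg (fun X : G => (α (ψ b) : G →L[ℝ] ℝ) X) e4).trans (e3 _ _ e0.symm _)
  have hflat : flatExtDeriv (pullOneForm I α ψ) a =
      flatExtDeriv (fun b => (oneFormInChart I α (ψ a) (χ b)).comp (fderiv ℝ χ b)) a := by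
    rw [flatExtDeriv, flatExtDeriv, hpull.fderiv_eq]
  rw [hflat, flatExtDeriv_comp hχs.self_of_nhds hα,
    mfderiv_eq_fderiv_extChartAt (hψ.self_of_nhds.mdifferentiableAt (by simp))]
  rfl

end Naturality

/-! ### Charts of the cotangent bundle -/

section CotangentCharts

variable {F M : Type*} [NormedAddCommGroup F] [NormedSpace ℝ F] [TopologicalSpace M]
  [ChartedSpace F M] [IsManifold 𝓘(ℝ, F) ∞ M]

/-- These are the canonical coordinates `(q, p)`: the trivialisation of the tangent bundle at `ξ₀.1`
is inverted by the differential of the inverse chart. -/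
theorem extChartAt_cotangent_apply (ξ₀ ξ : Cotangent F M)
    (h : ξ.1 ∈ (extChartAt 𝓘(ℝ, F) ξ₀.1).source) :
    extChartAt (cotangentModel F) ξ₀ ξ = (extChartAt 𝓘(ℝ, F) ξ₀.1 ξ.1,
      ξ.2.comp (mfderiv 𝓘(ℝ, F) 𝓘(ℝ, F) (extChartAt 𝓘(ℝ, F) ξ₀.1).symm
        (extChartAt 𝓘(ℝ, F) ξ₀.1 ξ.1))) := by
  have h2 : IsManifold 𝓘(ℝ, F) 1 M := IsManifold.of_le (n := ∞) (by simp)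
  have h1 := TangentBundle.symmL_trivializationAt (I := 𝓘(ℝ, F)) (x₀ := ξ₀.1) (x := ξ.1)
    (by simpa using h)
  have h3 : chartAt (ModelProd F (F →L[ℝ] ℝ)) ξ₀ ξ = (chartAt F ξ₀.1 ξ.1,
      ContinuousLinearMap.inCoordinates F (fun x : M => TangentSpace 𝓘(ℝ, F) x) ℝ
        (Bundle.Trivial M ℝ) ξ₀.1 ξ.1 ξ₀.1 ξ.1 ξ.2) := hom_chart ξ₀ ξ
  rw [extChartAt, OpenPartialHomeomorph.extend_coe, Function.comp_apply, h3]
  refine Prod.ext rfl ?_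
  change ContinuousLinearMap.inCoordinates F (fun x : M => TangentSpace 𝓘(ℝ, F) x) ℝ
    (Bundle.Trivial M ℝ) ξ₀.1 ξ.1 ξ₀.1 ξ.1 ξ.2 = _
  rw [ContinuousLinearMap.inCoordinates, h1]
  simp
  rfl

theorem extChartAt_cotangent_source (ξ₀ : Cotangent F M) :
    (extChartAt (cotangentModel F) ξ₀).source =
      TotalSpace.proj ⁻¹' (extChartAt 𝓘(ℝ, F) ξ₀.1).source := by
  rw [FiberBundle.extChartAt (IB := 𝓘(ℝ, F)) ξ₀]
  ext ζ
  simp only [PartialEquiv.trans_source, PartialEquiv.prod_source, PartialEquiv.refl_source,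
    mem_inter_iff, mem_preimage, mem_prod, mem_univ, and_true]
  constructor
  · rintro ⟨h1, h2⟩
    have h3 := Trivialization.coe_fst _ h1
    change (trivializationAt (F →L[ℝ] ℝ) (fun x : M => TangentSpace 𝓘(ℝ, F) x →L[ℝ] ℝ)
      ξ₀.proj ζ).1 ∈ _ at h2
    rw [h3] at h2
    exact h2
  · intro h
    have h1 : ζ ∈ (trivializationAt (F →L[ℝ] ℝ)
        (fun x : M => TangentSpace 𝓘(ℝ, F) x →L[ℝ] ℝ) ξ₀.proj).source := by
      rw [Trivialization.mem_source]
      simpa using h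
    refine ⟨h1, ?_⟩
    have := Trivialization.coe_fst _ h1
    change (trivializationAt (F →L[ℝ] ℝ) (fun x : M => TangentSpace 𝓘(ℝ, F) x →L[ℝ] ℝ)
      ξ₀.proj ζ).1 ∈ _
    rw [this]
    exact h

theorem extChartAt_cotangent_target (ξ₀ : Cotangent F M) :
    (extChartAt (cotangentModel F) ξ₀).target = (extChartAt 𝓘(ℝ, F) ξ₀.1).target ×ˢ univ := by
  rw [FiberBundle.extChartAt_target (IB := 𝓘(ℝ, F)) ξ₀]
  simp
  intro x hx
  exact (chartAt F ξ₀.proj).map_target hx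

/-- The identity `ϑ = p dq` along a parametrised family: `p` carries the differential of the inverse
chart and `dq` that of the chart, and the two cancel. Any chart around the base point may be used,
not only the preferred one. -/
theorem tautological_mfderiv {A : Type*} [NormedAddCommGroup A] [NormedSpace ℝ A]
    (ξ₀ : Cotangent F M) {ψ : A → Cotangent F M} {a : A}
    (hψ : MDifferentiableAt 𝓘(ℝ, A) (cotangentModel F) ψ a)
    (ha : (ψ a).proj ∈ (extChartAt 𝓘(ℝ, F) ξ₀.1).source) (u : A) :
    tautological F M (ψ a) (mfderiv 𝓘(ℝ, A) (cotangentModel F) ψ a u) =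
      (extChartAt (cotangentModel F) ξ₀ (ψ a)).2
        (fderiv ℝ (fun b => (extChartAt (cotangentModel F) ξ₀ (ψ b)).1) a u) := by
  have h2 : IsManifold 𝓘(ℝ, F) 1 M := IsManifold.of_le (n := ∞) (by simp)
  have hproj : MDifferentiableAt (cotangentModel F) 𝓘(ℝ, F)
      (fun η : Cotangent F M => η.proj) (ψ a) :=
    (Bundle.contMDiff_proj (n := 1) (IB := 𝓘(ℝ, F))
      (fun x : M => TangentSpace 𝓘(ℝ, F) x →L[ℝ] ℝ)).mdifferentiable (by simp) _
  have hp : MDifferentiableAt 𝓘(ℝ, A) 𝓘(ℝ, F) (fun b => (ψ b).proj) a := hproj.comp a hψ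
  have hκ : MDifferentiableAt 𝓘(ℝ, F) 𝓘(ℝ, F) (extChartAt 𝓘(ℝ, F) ξ₀.1) (ψ a).proj :=
    mdifferentiableAt_extChartAt (by simpa using ha)
  have hev : (fun b => (extChartAt (cotangentModel F) ξ₀ (ψ b)).1) =ᶠ[𝓝 a]
      (extChartAt 𝓘(ℝ, F) ξ₀.1) ∘ (fun b => (ψ b).proj) := by
    have hev' : ∀ᶠ b in 𝓝 a, (ψ b).proj ∈ (extChartAt 𝓘(ℝ, F) ξ₀.1).source :=
      hp.continuousAt.eventually
        ((isOpen_extChartAt_source (I := 𝓘(ℝ, F)) ξ₀.1).mem_nhds ha)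
    filter_upwards [hev'] with b hb
    rw [extChartAt_cotangent_apply ξ₀ _ hb]
    rfl
  have e1 : fderiv ℝ (fun b => (extChartAt (cotangentModel F) ξ₀ (ψ b)).1) a =
      (mfderiv 𝓘(ℝ, F) 𝓘(ℝ, F) (extChartAt 𝓘(ℝ, F) ξ₀.1) (ψ a).proj).comp
        (mfderiv 𝓘(ℝ, A) 𝓘(ℝ, F) (fun b => (ψ b).proj) a) := by
    rw [hev.fderiv_eq, ← mfderiv_eq_fderiv]
    exact mfderiv_comp a hκ hp
  have e2 : mfderiv 𝓘(ℝ, A) 𝓘(ℝ, F) (fun b => (ψ b).proj) a =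
      (mfderiv (cotangentModel F) 𝓘(ℝ, F) (fun η : Cotangent F M => η.proj) (ψ a)).comp
        (mfderiv 𝓘(ℝ, A) (cotangentModel F) ψ a) := mfderiv_comp a hproj hψ
  have e3 := mfderivWithin_extChartAt_symm_comp_mfderiv_extChartAt' (I := 𝓘(ℝ, F)) ha
  rw [e1, extChartAt_cotangent_apply ξ₀ _ ha]
  simp only [modelWithCornersSelf_coe, range_id, mfderivWithin_univ] at e3
  change (ψ a).snd _ = (ψ a).snd _
  congr 1
  have e4 := DFunLike.congr_fun e2 u
  refine e4.symm.trans ?_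
  exact (DFunLike.congr_fun e3 (mfderiv 𝓘(ℝ, A) 𝓘(ℝ, F) (fun b => (ψ b).proj) a u)).symm

/-- In a chart of the cotangent bundle, the tautological one-form is `p dq`. -/
theorem oneFormInChart_tautological (ξ₀ : Cotangent F M) {z : F × (F →L[ℝ] ℝ)}
    (hz : z.1 ∈ (extChartAt 𝓘(ℝ, F) ξ₀.1).target) :
    oneFormInChart (cotangentModel F) (tautological F M) ξ₀ z =
      z.2.comp (ContinuousLinearMap.fst ℝ F (F →L[ℝ] ℝ)) := by
  have hz' : z ∈ (extChartAt (cotangentModel F) ξ₀).target := by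
    rw [extChartAt_cotangent_target]
    exact ⟨hz, trivial⟩
  have hnhds : ∀ᶠ z' in 𝓝 z, z' ∈ (extChartAt (cotangentModel F) ξ₀).target :=
    (isOpen_extChartAt_target ξ₀).mem_nhds hz'
  have hs : MDifferentiableAt 𝓘(ℝ, F × (F →L[ℝ] ℝ)) (cotangentModel F)
      (extChartAt (cotangentModel F) ξ₀).symm z := by
    have h1 := contMDiffOn_extChartAt_symm (I := cotangentModel F) (n := ∞) ξ₀
    exact (h1.contMDiffAt hnhds).mdifferentiableAt (by simp)
  have hsrc : ((extChartAt (cotangentModel F) ξ₀).symm z).proj ∈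
      (extChartAt 𝓘(ℝ, F) ξ₀.1).source := by
    have := (extChartAt (cotangentModel F) ξ₀).map_target hz'
    rwa [extChartAt_cotangent_source] at this
  refine ContinuousLinearMap.ext fun u => ?_
  have h1 := tautological_mfderiv ξ₀ hs hsrc u
  have h2 : (fun b => (extChartAt (cotangentModel F) ξ₀
      ((extChartAt (cotangentModel F) ξ₀).symm b)).1) =ᶠ[𝓝 z] Prod.fst := by
    filter_upwards [hnhds] with z' hz'' using by rw [(extChartAt _ ξ₀).right_inv hz'']
  rw [h2.fderiv_eq, fderiv_fst, (extChartAt _ ξ₀).right_inv hz'] at h1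
  exact h1

theorem differentiableAt_oneFormInChart_tautological (ξ : Cotangent F M) :
    DifferentiableAt ℝ (oneFormInChart (cotangentModel F) (tautological F M) ξ)
      (extChartAt (cotangentModel F) ξ ξ) := by
  have h1 : oneFormInChart (cotangentModel F) (tautological F M) ξ =ᶠ[
      𝓝 (extChartAt (cotangentModel F) ξ ξ)]
      fun z => z.2.comp (ContinuousLinearMap.fst ℝ F (F →L[ℝ] ℝ)) := by
    filter_upwards [extChartAt_target_mem_nhds (I := cotangentModel F) ξ] with z hz
    rw [extChartAt_cotangent_target] at hz
    exact oneFormInChart_tautological ξ hz.1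
  refine DifferentiableAt.congr_of_eventuallyEq ?_ h1
  exact differentiableAt_snd.clm_comp (differentiableAt_const _)

/-- A one-form on `M` in a chart is the corresponding section of the cotangent bundle, read in the
associated chart of the cotangent bundle. -/
theorem oneFormInChart_eq_extChartAt_cotangent (ξ₀ : Cotangent F M)
    (σ : ∀ y : M, TangentSpace 𝓘(ℝ, F) y →L[ℝ] ℝ) {z : F}
    (hz : z ∈ (extChartAt 𝓘(ℝ, F) ξ₀.1).target) :
    oneFormInChart 𝓘(ℝ, F) σ ξ₀.1 z = (extChartAt (cotangentModel F) ξ₀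
      (⟨(extChartAt 𝓘(ℝ, F) ξ₀.1).symm z, σ ((extChartAt 𝓘(ℝ, F) ξ₀.1).symm z)⟩ :
        Cotangent F M)).2 := by
  rw [extChartAt_cotangent_apply ξ₀ _ ((extChartAt 𝓘(ℝ, F) ξ₀.1).map_target hz)]
  refine ContinuousLinearMap.ext fun u => ?_
  exact congrArg (fun z' : F => (σ ((extChartAt 𝓘(ℝ, F) ξ₀.1).symm z) : F →L[ℝ] ℝ)
    ((mfderiv 𝓘(ℝ, F) 𝓘(ℝ, F) (extChartAt 𝓘(ℝ, F) ξ₀.1).symm z' : F →L[ℝ] F) u))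
    ((extChartAt 𝓘(ℝ, F) ξ₀.1).right_inv hz).symm

end CotangentCharts

/-! ### Tangent vectors in adapted charts -/

section Adapted

variable {A B G H P : Type*} [NormedAddCommGroup A] [NormedSpace ℝ A]
  [NormedAddCommGroup B] [NormedSpace ℝ B]
  [NormedAddCommGroup G] [NormedSpace ℝ G] [TopologicalSpace H]
  {I : ModelWithCorners ℝ G H} [TopologicalSpace P] [ChartedSpace H P]

theorem hasMFDerivAt_comp_of_hasDerivAt {ψ : A → P} {γ : ℝ → A} {u : A} (hγ : HasDerivAt γ u 0)
    (hψ : MDifferentiableAt 𝓘(ℝ, A) I ψ (γ 0)) :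
    HasMFDerivAt 𝓘(ℝ, ℝ) I (fun t => ψ (γ t)) 0
      (ContinuousLinearMap.toSpanSingleton ℝ (mfderiv 𝓘(ℝ, A) I ψ (γ 0) u : G)) := by
  have h1 : HasMFDerivAt 𝓘(ℝ, ℝ) 𝓘(ℝ, A) γ 0 (ContinuousLinearMap.toSpanSingleton ℝ u) :=
    (hasDerivAt_iff_hasFDerivAt.1 hγ).hasMFDerivAt
  have h2 := hψ.hasMFDerivAt.comp 0 h1
  refine h2.congr_mfderiv (ContinuousLinearMap.ext fun t => ?_)
  exact (mfderiv 𝓘(ℝ, A) I ψ (γ 0)).map_smul t u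

theorem hasDerivAt_comp_of_hasMFDerivAt {χ : P → A} {γ : ℝ → P} {X : G}
    (hγ : HasMFDerivAt 𝓘(ℝ, ℝ) I γ 0 (ContinuousLinearMap.toSpanSingleton ℝ X))
    (hχ : MDifferentiableAt I 𝓘(ℝ, A) χ (γ 0)) :
    HasDerivAt (fun t => χ (γ t)) (mfderiv I 𝓘(ℝ, A) χ (γ 0) X) 0 := by
  have h2 := hχ.hasMFDerivAt.comp 0 hγ
  refine hasDerivAt_iff_hasFDerivAt.2 (hasMFDerivAt_iff_hasFDerivAt.1
    (h2.congr_mfderiv (ContinuousLinearMap.ext fun t => ?_)))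
  exact (mfderiv I 𝓘(ℝ, A) χ (γ 0)).map_smul t X

variable (I) in
/-- The chart `e`, with values in a product `A × B`, is adapted to the submanifold `S`. -/
structure IsAdaptedChart (S : Set P) (e : OpenPartialHomeomorph P (A × B)) : Prop where
  contMDiffOn : ContMDiffOn I 𝓘(ℝ, A × B) ∞ e e.source
  contMDiffOn_symm : ContMDiffOn 𝓘(ℝ, A × B) I ∞ e.symm e.target
  mem_iff : ∀ p ∈ e.source, p ∈ S ↔ (e p).2 = 0

namespace IsAdaptedChart

variable {S : Set P} {e : OpenPartialHomeomorph P (A × B)}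

theorem contMDiffAt_param (he : IsAdaptedChart I S e) {a : A} (ha : (a, (0 : B)) ∈ e.target) :
    ContMDiffAt 𝓘(ℝ, A) I ∞ (fun a => e.symm (a, (0 : B))) a := by
  have h1 := he.contMDiffOn_symm.contMDiffAt (e.open_target.mem_nhds ha)
  have h2 : ContMDiffAt 𝓘(ℝ, A) 𝓘(ℝ, A × B) ∞ (fun a : A => (a, (0 : B))) a :=
    (contDiff_id.prodMk contDiff_const).contMDiff.contMDiffAt
  exact h1.comp a h2

omit [NormedSpace ℝ A] [NormedSpace ℝ B] in
theorem isOpen_param (e : OpenPartialHomeomorph P (A × B)) :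
    IsOpen {a : A | (a, (0 : B)) ∈ e.target} :=
  e.open_target.preimage (by fun_prop)

theorem param_fst (he : IsAdaptedChart I S e) {p : P} (hp : p ∈ e.source) (hS : p ∈ S) :
    e.symm ((e p).1, 0) = p := by
  have h1 : (e p).2 = 0 := (he.mem_iff p hp).1 hS
  rw [← h1]
  exact e.left_inv hp

theorem param_mem (he : IsAdaptedChart I S e) {a : A} (ha : (a, (0 : B)) ∈ e.target) :
    e.symm (a, 0) ∈ S :=
  (he.mem_iff _ (e.map_target ha)).2 (by rw [e.right_inv ha])

/-- Velocities of curves in `S` are velocities of curves in the parameter space. -/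
theorem exists_hasDerivAt (he : IsAdaptedChart I S e) {a : A} (ha : (a, (0 : B)) ∈ e.target)
    {γ : ℝ → P} {X : G} (h0 : γ 0 = e.symm (a, 0)) (hS : ∀ᶠ t in 𝓝 0, γ t ∈ S)
    (hγ : HasMFDerivAt 𝓘(ℝ, ℝ) I γ 0 (ContinuousLinearMap.toSpanSingleton ℝ X)) :
    ∃ u : A, HasDerivAt (fun t => (e (γ t)).1) u 0 ∧
      X = mfderiv 𝓘(ℝ, A) I (fun a => e.symm (a, (0 : B))) a u := by
  have hp : γ 0 ∈ e.source := by
    rw [h0]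
    exact e.map_target ha
  have he1 : MDifferentiableAt I 𝓘(ℝ, A × B) e (γ 0) :=
    (he.contMDiffOn.contMDiffAt (e.open_source.mem_nhds hp)).mdifferentiableAt (by simp)
  have h1 := hasDerivAt_comp_of_hasMFDerivAt hγ he1
  have h2 : HasDerivAt (fun t => (e (γ t)).1) _ 0 := h1.fst
  refine ⟨_, h2, ?_⟩
  set u := (mfderiv I 𝓘(ℝ, A × B) e (γ 0) X : A × B).1 with hu
  have ea : (fun t => (e (γ t)).1) 0 = a := by
    simp only [h0, e.right_inv ha]
  have hι : MDifferentiableAt 𝓘(ℝ, A) I (fun a => e.symm (a, (0 : B)))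
      ((fun t => (e (γ t)).1) 0) := by
    rw [ea]
    exact (he.contMDiffAt_param ha).mdifferentiableAt (by simp)
  have h3 := hasMFDerivAt_comp_of_hasDerivAt h2 hι
  have hcont : ContinuousAt γ 0 := hγ.continuousAt
  -- A curve in `S` has zero second coordinate, so it is recovered from its first one; uniqueness of
  -- derivatives then identifies its velocity.
  have h4 : (fun t => e.symm ((fun t => (e (γ t)).1) t, (0 : B))) =ᶠ[𝓝 0] γ := by
    filter_upwards [hS, hcont.eventually (e.open_source.mem_nhds hp)] with t ht ht'
    exact he.param_fst ht' ht
  have h5 : HasMFDerivAt 𝓘(ℝ, ℝ) I γ 0 _ := h3.congr_of_eventuallyEq h4.symm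
  have h6 := hasMFDerivAt_unique hγ h5
  have h7 : X = (mfderiv 𝓘(ℝ, A) I (fun a => e.symm (a, (0 : B)))
      ((fun t => (e (γ t)).1) 0) u : G) := by
    have := DFunLike.congr_fun h6 (1 : ℝ)
    have e1 : (ContinuousLinearMap.toSpanSingleton ℝ X) (1 : ℝ) = X := by simp
    refine e1.symm.trans (this.trans ?_)
    exact one_smul ℝ _
  refine h7.trans ?_
  exact congrArg (fun a' : A => (mfderiv 𝓘(ℝ, A) I (fun a => e.symm (a, (0 : B))) a' u : G)) ea

/-- The set `V` is left arbitrary: the result is used for `S` itself and for a leaf inside `S`. -/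
theorem mem_tangentVectors (he : IsAdaptedChart I S e) {a u : A} (ha : (a, (0 : B)) ∈ e.target)
    {V : Set P} {γ : ℝ → A} (h0 : γ 0 = a) (hγ : HasDerivAt γ u 0)
    (hV : ∀ᶠ t in 𝓝 0, e.symm (γ t, (0 : B)) ∈ V) :
    mfderiv 𝓘(ℝ, A) I (fun a => e.symm (a, (0 : B))) a u ∈
      tangentVectors I V (e.symm (a, (0 : B))) := by
  subst h0
  exact ⟨_, rfl, hV, hasMFDerivAt_comp_of_hasDerivAt hγ
    ((he.contMDiffAt_param ha).mdifferentiableAt (by simp))⟩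

/-- The tangent space of `S` in an adapted chart. -/
theorem mem_tangentVectors_iff (he : IsAdaptedChart I S e) {a : A}
    (ha : (a, (0 : B)) ∈ e.target) {X : TangentSpace I (e.symm (a, (0 : B)))} :
    X ∈ tangentVectors I S (e.symm (a, (0 : B))) ↔
      ∃ u : A, X = mfderiv 𝓘(ℝ, A) I (fun a => e.symm (a, (0 : B))) a u := by
  constructor
  · rintro ⟨γ, h0, hS, hγ⟩
    obtain ⟨u, -, hu⟩ := he.exists_hasDerivAt ha h0 hS hγ
    exact ⟨u, hu⟩
  · rintro ⟨u, rfl⟩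
    have hγ : HasDerivAt (fun t : ℝ => a + t • u) u 0 := by
      simpa using ((hasDerivAt_id (0 : ℝ)).smul_const u).const_add a
    refine he.mem_tangentVectors ha (γ := fun t => a + t • u) (by simp) hγ ?_
    have hc : Tendsto (fun t : ℝ => a + t • u) (𝓝 0) (𝓝 a) := by
      simpa using hγ.continuousAt.tendsto
    filter_upwards [hc.eventually ((isOpen_param e).mem_nhds ha)] with t ht
    exact he.param_mem ht

/-- The preimage in an adapted chart of the zero set of a submersion is a submanifold. -/
theorem isSmoothSubmanifold (he : IsAdaptedChart I S e) [FiniteDimensional ℝ B] {C : Type*}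
    [NormedAddCommGroup C] [NormedSpace ℝ C] [FiniteDimensional ℝ C] {O : Set A} (hO : IsOpen O)
    {g : A → C} (hg : ContDiffOn ℝ ∞ g O)
    (hsurj : ∀ a ∈ O, Function.Surjective (fderiv ℝ g a)) :
    IsSmoothSubmanifold I {p | p ∈ e.source ∧ (e p).1 ∈ O ∧ g (e p).1 = 0 ∧ (e p).2 = 0} := by
  intro p hp
  let T : (C × B) ≃L[ℝ] EuclideanSpace ℝ (Fin (Module.finrank ℝ (C × B))) :=
    ContinuousLinearEquiv.ofFinrankEq (by simp)
  let h : A × B → C × B := fun z => (g z.1, z.2)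
  have hh : ContDiffOn ℝ ∞ h (O ×ˢ univ) :=
    (hg.comp contDiff_fst.contDiffOn fun z hz => hz.1).prodMk contDiff_snd.contDiffOn
  have hOu : IsOpen (O ×ˢ (univ : Set B)) := hO.prod isOpen_univ
  let U : Set P := e.source ∩ e ⁻¹' (O ×ˢ univ)
  have hU : IsOpen U := e.isOpen_inter_preimage hOu
  have hTh : ContDiffOn ℝ ∞ (fun z => T (h z)) (O ×ˢ univ) := T.contDiff.comp_contDiffOn hh
  have hG : ContMDiffOn I 𝓘(ℝ, EuclideanSpace ℝ (Fin (Module.finrank ℝ (C × B)))) ∞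
      (fun p => T (h (e p))) U := by
    intro q hq
    have h1 := he.contMDiffOn.contMDiffAt (e.open_source.mem_nhds hq.1)
    have h2 : ContMDiffAt 𝓘(ℝ, A × B) 𝓘(ℝ, EuclideanSpace ℝ (Fin (Module.finrank ℝ (C × B)))) ∞
        (fun z => T (h z)) (e q) := (hTh.contDiffAt (hOu.mem_nhds hq.2)).contMDiffAt
    exact (h2.comp q h1).contMDiffWithinAt
  refine ⟨_, U, fun p => T (h (e p)), hU, ⟨hp.1, hp.2.1, trivial⟩, hG, fun q hq => ?_, ?_⟩
  · have hq' : e q ∈ e.target := e.map_source hq.1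
    have hs : MDifferentiableAt 𝓘(ℝ, A × B) I e.symm (e q) :=
      (he.contMDiffOn_symm.contMDiffAt (e.open_target.mem_nhds hq')).mdifferentiableAt (by simp)
    have hGq : MDifferentiableAt I 𝓘(ℝ, EuclideanSpace ℝ (Fin (Module.finrank ℝ (C × B))))
        (fun p => T (h (e p))) (e.symm (e q)) := by
      rw [e.left_inv hq.1]
      exact (hG.contMDiffAt (hU.mem_nhds hq)).mdifferentiableAt (by simp)
    -- Read through `e.symm`, the defining map is `T ∘ h`, whose derivative is onto because that of
    -- `g` is; surjectivity on the manifold follows from the chain rule.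
    have h1 := mfderiv_comp (e q) hGq hs
    have h2 : ((fun p => T (h (e p))) ∘ e.symm) =ᶠ[𝓝 (e q)] fun z => T (h z) := by
      filter_upwards [e.open_target.mem_nhds hq'] with z hz
      simp [e.right_inv hz]
    rw [h2.mfderiv_eq, mfderiv_eq_fderiv] at h1
    have hgd : HasFDerivAt g (fderiv ℝ g (e q).1) (e q).1 :=
      ((hg.contDiffAt (hO.mem_nhds hq.2.1)).differentiableAt (by simp)).hasFDerivAt
    have h3 : HasFDerivAt h _ (e q) :=
      (HasFDerivAt.comp (e q) hgd hasFDerivAt_fst).prodMk hasFDerivAt_snd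
    have h4 : HasFDerivAt (fun z => T (h z)) _ (e q) := T.hasFDerivAt.comp (e q) h3
    rw [h4.fderiv] at h1
    intro w
    obtain ⟨u, hu⟩ := hsurj (e q).1 hq.2.1 (T.symm w).1
    have h5 := DFunLike.congr_fun h1 ((u, (T.symm w).2) : A × B)
    have h6 : w = T ((fderiv ℝ g (e q).1 u, (T.symm w).2) : C × B) := by
      rw [hu]
      exact (T.apply_symm_apply w).symm
    refine ⟨(mfderiv 𝓘(ℝ, A × B) I e.symm (e q) ((u, (T.symm w).2) : A × B) : G), ?_⟩
    refine Eq.trans ?_ h6.symm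
    refine Eq.trans ?_ h5.symm
    exact congrArg (fun q' : P => (mfderiv I
      𝓘(ℝ, EuclideanSpace ℝ (Fin (Module.finrank ℝ (C × B)))) (fun p => T (h (e p))) q' :
        G →L[ℝ] EuclideanSpace ℝ (Fin (Module.finrank ℝ (C × B))))
      (mfderiv 𝓘(ℝ, A × B) I e.symm (e q) ((u, (T.symm w).2) : A × B) : G))
      (e.left_inv hq.1).symm
  · ext q
    simp only [mem_inter_iff, mem_ofPred_eq, U, mem_preimage, mem_prod, mem_univ, and_true, h,
      EmbeddingLike.map_eq_zero_iff, Prod.mk_eq_zero]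
    tauto

end IsAdaptedChart

end Adapted

/-! ### Regularity where the characteristic distribution has constant dimension -/

section Regular

variable {F E A B : Type*} {M Z : Type*} [NormedAddCommGroup F] [NormedSpace ℝ F]
  [NormedAddCommGroup E] [NormedSpace ℂ E]
  [NormedAddCommGroup A] [NormedSpace ℝ A] [FiniteDimensional ℝ A]
  [NormedAddCommGroup B] [NormedSpace ℝ B] [FiniteDimensional ℝ B]
  [TopologicalSpace M] [ChartedSpace F M] [IsManifold 𝓘(ℝ, F) ∞ M]
  [TopologicalSpace Z] [ChartedSpace E Z]
  {f : M → Z} {e : OpenPartialHomeomorph (Cotangent F M) (A × B)}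

/-- The tautological one-form on the characteristic bundle, in an adapted chart. -/
def tautInChart (e : OpenPartialHomeomorph (Cotangent F M) (A × B)) : A → (A →L[ℝ] ℝ) :=
  pullOneForm (cotangentModel F) (tautological F M) (fun a => e.symm (a, (0 : B)))

-- Since `T H⁰M` is the image of the parameter space, naturality of `d` turns the orthogonality
-- condition into membership in the kernel of the pulled-back form. The hypothesis `hker` makes the
-- condition `ϑ = 0` redundant.
omit [FiniteDimensional ℝ A] [FiniteDimensional ℝ B] in
theorem mem_charDistribution_iff
    (he : IsAdaptedChart (cotangentModel F) (charBundle F E f) e) {a : A}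
    (ha : (a, (0 : B)) ∈ e.target)
    (hker : ∀ u ∈ flatKer (tautInChart e) a, tautInChart e a u = 0)
    {X : TangentSpace (cotangentModel F) (e.symm (a, (0 : B)))} :
    X ∈ charDistribution F E f (e.symm (a, (0 : B))) ↔
      ∃ u ∈ flatKer (tautInChart e) a,
        X = mfderiv 𝓘(ℝ, A) (cotangentModel F) (fun a => e.symm (a, (0 : B))) a u := by
  have hev : ∀ᶠ b in 𝓝 a, ContMDiffAt 𝓘(ℝ, A) (cotangentModel F) ∞
      (fun a => e.symm (a, (0 : B))) b := by
    filter_upwards [(IsAdaptedChart.isOpen_param e).mem_nhds ha] with b hb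
    exact he.contMDiffAt_param hb
  have hd := extDerivOneForm_mfderiv (tautological F M) hev
    (differentiableAt_oneFormInChart_tautological _)
  constructor
  · rintro ⟨⟨hX, -⟩, hX'⟩
    obtain ⟨u, hu⟩ := (he.mem_tangentVectors_iff ha).1 hX
    refine ⟨u, ?_, hu⟩
    rw [mem_flatKer]
    refine ContinuousLinearMap.ext fun v => ?_
    refine (hd u v).symm.trans ?_
    have := hX' _ ((he.mem_tangentVectors_iff ha).2 ⟨v, rfl⟩)
    rw [hu] at this
    exact this
  · rintro ⟨u, hu, rfl⟩
    refine ⟨⟨(he.mem_tangentVectors_iff ha).2 ⟨u, rfl⟩, hker u hu⟩, fun Y hY => ?_⟩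
    obtain ⟨v, rfl⟩ := (he.mem_tangentVectors_iff ha).1 hY
    refine (hd u v).trans ?_
    have := mem_flatKer.1 hu
    unfold tautInChart at this
    rw [this]
    rfl

/-- Points at which the characteristic distribution has locally constant dimension are regular. -/
theorem isRegularPoint_of_finrank_flatKer_const
    (he : IsAdaptedChart (cotangentModel F) (charBundle F E f) e) {Ω : Set A} (hΩ : IsOpen Ω)
    (hΩe : ∀ a ∈ Ω, (a, (0 : B)) ∈ e.target)
    (hdot : ∀ a ∈ Ω, (e.symm (a, (0 : B))).snd ≠ 0)
    (hs : ContDiffOn ℝ ∞ (tautInChart e) Ω)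
    (hker : ∀ a ∈ Ω, ∀ u ∈ flatKer (tautInChart e) a, tautInChart e a u = 0) {d : ℕ}
    (hd : ∀ a ∈ Ω, Module.finrank ℝ (flatKer (tautInChart e) a) = d) {a₀ : A} (ha₀ : a₀ ∈ Ω) :
    IsRegularPoint F E f (e.symm (a₀, (0 : B))) := by
  obtain ⟨C, O, g, hO, ha₀O, hOΩ, hg, hgs, hg0, hgk, hgγ⟩ :=
    exists_submersion_of_finrank_flatKer_const hΩ hs ha₀ hd
  have hmem : ∀ a ∈ Ω, e.symm (a, (0 : B)) ∈ charBundleDot F E f := fun a ha =>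
    ⟨he.param_mem (hΩe a ha), hdot a ha⟩
  set V : Set (Cotangent F M) :=
    {p | p ∈ e.source ∧ (e p).1 ∈ O ∧ g (e p).1 = 0 ∧ (e p).2 = 0} with hV
  have hVparam : ∀ a ∈ O, g a = 0 → e.symm (a, (0 : B)) ∈ V := by
    intro a ha hga
    have h1 := hΩe a (hOΩ ha)
    refine ⟨e.map_target h1, ?_, ?_, ?_⟩ <;> rw [e.right_inv h1] <;> assumption
  have hVS : V ⊆ charBundle F E f := fun p hp => (he.mem_iff p hp.1).2 hp.2.2.2
  have hVeq : ∀ p ∈ V, p = e.symm ((e p).1, (0 : B)) := fun p hp =>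
    (he.param_fst hp.1 (hVS hp)).symm
  -- The first coordinate of a curve in `V` stays in the zero set of `g`, so its velocity is killed
  -- by `Dg` and lies in the kernel.
  have hsub : ∀ a ∈ O, g a = 0 → tangentVectors (cotangentModel F) V (e.symm (a, (0 : B))) ⊆
      charDistribution F E f (e.symm (a, (0 : B))) := by
    rintro a ha hga X ⟨γ, h0, hγV, hγ⟩
    obtain ⟨u, hu, hX⟩ := he.exists_hasDerivAt (hΩe a (hOΩ ha)) h0
      (hγV.mono fun t ht => hVS ht) hγ
    refine (mem_charDistribution_iff he (hΩe a (hOΩ ha)) (hker a (hOΩ ha))).2 ⟨u, ?_, hX⟩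
    refine hgk a ha hga u ?_
    have ea : (e (γ 0)).1 = a := by rw [h0, e.right_inv (hΩe a (hOΩ ha))]
    have h1 : HasFDerivAt g (fderiv ℝ g a) ((fun t => (e (γ t)).1) 0) := by
      simp only [ea]
      exact ((hg.contDiffAt (hO.mem_nhds ha)).differentiableAt (by simp)).hasFDerivAt
    have h2 := h1.comp_hasDerivAt (0 : ℝ) hu
    have h3 : (g ∘ fun t => (e (γ t)).1) =ᶠ[𝓝 0] fun _ => 0 := by
      filter_upwards [hγV] with t ht using ht.2.2.1
    exact (h2.congr_of_eventuallyEq h3.symm).unique (hasDerivAt_const _ _)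
  -- `V` lies in the nonzero characteristic covectors already, so the ambient open set may be
  -- everything.
  refine ⟨hmem a₀ ha₀, univ, V, isOpen_univ, hVparam a₀ ha₀O hg0, fun p hp => ⟨trivial, ?_⟩,
    he.isSmoothSubmanifold hO hg hgs, fun p hp => ?_, ?_⟩
  · rw [hVeq p hp]
    exact hmem _ (hOΩ hp.2.1)
  · rw [hVeq p hp]
    exact hsub _ hp.2.1 hp.2.2.1
  · refine Subset.antisymm (hsub a₀ ha₀O hg0) fun X hX => ?_
    obtain ⟨u, hu, rfl⟩ := (mem_charDistribution_iff he (hΩe a₀ ha₀) (hker a₀ ha₀)).1 hX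
    obtain ⟨γ, hγ0, hγ, hγg⟩ := hgγ u hu
    refine he.mem_tangentVectors (hΩe a₀ ha₀) hγ0 hγ ?_
    have hc : Tendsto γ (𝓝 0) (𝓝 a₀) := by
      rw [← hγ0]
      exact hγ.continuousAt.tendsto
    filter_upwards [hγg, hc.eventually (hO.mem_nhds ha₀O)] with t ht ht'
    exact hVparam _ ht' ht

end Regular

/-! ### Generic CR submanifolds in coordinates -/

section LocalCR

/-- Multiplication by the imaginary unit. -/
def mulI (E : Type*) [NormedAddCommGroup E] [NormedSpace ℂ E] : E →L[ℝ] E :=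
  (Complex.I • ContinuousLinearMap.id ℂ E).restrictScalars ℝ

theorem mulI_apply {E : Type*} [NormedAddCommGroup E] [NormedSpace ℂ E] (u : E) : mulI E u = Complex.I • u := rfl

theorem I_smul_I_smul {E : Type*} [NormedAddCommGroup E] [NormedSpace ℂ E] (u : E) : Complex.I • Complex.I • u = -u := by
  rw [smul_smul, Complex.I_mul_I, neg_one_smul]

variable {F E : Type*} [NormedAddCommGroup F] [NormedSpace ℝ F] [FiniteDimensional ℝ F]
  [NormedAddCommGroup E] [NormedSpace ℂ E] [FiniteDimensional ℝ E]

/-- A local defining function of an immersed submanifold. -/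
theorem exists_defining_function {φ : F → E} {U : Set F} (hU : IsOpen U)
    (hφ : ContDiffOn ℝ ∞ φ U) {x₀ : F} (hx₀ : x₀ ∈ U)
    (hinj : Function.Injective (fderiv ℝ φ x₀)) :
    ∃ (W : Submodule ℝ E) (ρ : E → W) (U' : Set F), IsOpen U' ∧ x₀ ∈ U' ∧ U' ⊆ U ∧
      (∀ x ∈ U', ContDiffAt ℝ ∞ ρ (φ x)) ∧
      (∀ x ∈ U', ∀ v w, fderiv ℝ ρ (φ x) (fderiv ℝ φ x v + (w : W)) = w) ∧
      (∀ x ∈ U', ∀ u : E, ∃ v, ∃ w : W, u = fderiv ℝ φ x v + w) := by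
  obtain ⟨W, hW⟩ := (LinearMap.range (fderiv ℝ φ x₀ : F →ₗ[ℝ] E)).exists_isCompl
  -- Adding a complement `W` of the tangent space makes `Φ` a local diffeomorphism; `ρ` is the
  -- `W`-component of its inverse and vanishes on the image of `φ` near `φ x₀`.
  let Φ : F × W → E := fun p => φ p.1 + p.2
  have hUW : IsOpen (U ×ˢ (univ : Set W)) := hU.prod isOpen_univ
  have hΦ : ContDiffOn ℝ ∞ Φ (U ×ˢ univ) :=
    (hφ.comp contDiff_fst.contDiffOn fun p hp => hp.1).add
      (W.subtypeL.contDiff.comp contDiff_snd).contDiffOn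
  have hφd : ∀ x ∈ U, HasFDerivAt φ (fderiv ℝ φ x) x := fun x hx =>
    ((hφ.contDiffAt (hU.mem_nhds hx)).differentiableAt (by simp)).hasFDerivAt
  have hΦd : ∀ p ∈ U ×ˢ (univ : Set W), HasFDerivAt Φ
      ((fderiv ℝ φ p.1).comp (ContinuousLinearMap.fst ℝ F W) +
        W.subtypeL.comp (ContinuousLinearMap.snd ℝ F W)) p := by
    intro p hp
    have h1 : HasFDerivAt (fun p : F × W => φ p.1) _ p :=
      HasFDerivAt.comp p (hφd p.1 hp.1) hasFDerivAt_fst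
    have h2 : HasFDerivAt (fun p : F × W => (p.2 : E)) _ p :=
      W.subtypeL.hasFDerivAt.comp p hasFDerivAt_snd
    exact h1.add h2
  let T : F × W → (F × W →L[ℝ] E) := fun p => (fderiv ℝ φ p.1).comp (ContinuousLinearMap.fst ℝ F W) +
        W.subtypeL.comp (ContinuousLinearMap.snd ℝ F W)
  have hTapp : ∀ p v w, T p (v, w) = fderiv ℝ φ p.1 v + w := fun p v w => rfl
  have hbij : Function.Bijective (T (x₀, 0)) := by
    constructor
    · rw [injective_iff_map_eq_zero]
      rintro ⟨v, w⟩ h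
      rw [hTapp] at h
      have h1 : (w : E) ∈ LinearMap.range (fderiv ℝ φ x₀ : F →ₗ[ℝ] E) :=
        ⟨-v, by simpa using (eq_neg_of_add_eq_zero_right h).symm⟩
      have h2 := Submodule.disjoint_def.1 hW.disjoint _ h1 w.2
      have h3 : fderiv ℝ φ x₀ v = 0 := by simpa [h2] using h
      have h4 : v = 0 := hinj (by rw [h3, map_zero])
      rw [h4]
      exact Prod.ext rfl (Subtype.ext h2)
    · intro u
      have h1 : u ∈ LinearMap.range (fderiv ℝ φ x₀ : F →ₗ[ℝ] E) ⊔ W := by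
        rw [hW.sup_eq_top]; trivial
      obtain ⟨_, ⟨v, rfl⟩, w, hw, h2⟩ := Submodule.mem_sup.1 h1
      exact ⟨(v, ⟨w, hw⟩), h2⟩
  let L : (F × W) ≃L[ℝ] E :=
    (LinearEquiv.ofBijective (T (x₀, 0) : F × W →ₗ[ℝ] E) hbij).toContinuousLinearEquiv
  have hL : (L : F × W →L[ℝ] E) = T (x₀, 0) := ContinuousLinearMap.ext fun p => rfl
  have hp0 : ((x₀, 0) : F × W) ∈ U ×ˢ (univ : Set W) := ⟨hx₀, trivial⟩
  have hΦ0 : ContDiffAt ℝ ∞ Φ (x₀, 0) := hΦ.contDiffAt (hUW.mem_nhds hp0)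
  have hΦL : HasFDerivAt Φ (L : F × W →L[ℝ] E) (x₀, 0) := by
    rw [hL]; exact hΦd _ hp0
  let G := hΦ0.toOpenPartialHomeomorph Φ hΦL (by simp)
  have hG : ∀ p, G p = Φ p := fun p => rfl
  have hG0 : (x₀, (0 : W)) ∈ G.source := hΦ0.mem_toOpenPartialHomeomorph_source hΦL (by simp)
  have hTc : ContinuousAt T (x₀, 0) := by
    have h1 : ContinuousAt (fun p : F × W => fderiv ℝ φ p.1) (x₀, 0) := by
      have h2 : ContinuousAt (fderiv ℝ φ) x₀ :=
        ((hφ.contDiffAt (hU.mem_nhds hx₀)).fderiv_right (m := 0) (by simp)).continuousAt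
      exact ContinuousAt.comp (f := Prod.fst) (x := ((x₀, 0) : F × W)) h2 continuousAt_fst
    exact (h1.clm_comp continuousAt_const).add continuousAt_const
  -- Invertibility of the differential is open, so smoothness of the inverse and the splitting of
  -- `E` hold at all `φ x` nearby, not only at `φ x₀`.
  have hTinv : ∀ᶠ p in 𝓝 ((x₀, 0) : F × W),
      T p ∈ range ((↑) : ((F × W) ≃L[ℝ] E) → (F × W →L[ℝ] E)) := by
    refine hTc.eventually ?_
    rw [← hL]
    exact L.nhds
  have hall : ∀ᶠ p in 𝓝 ((x₀, 0) : F × W), (p ∈ U ×ˢ (univ : Set W) ∧ p ∈ G.source) ∧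
      T p ∈ range ((↑) : ((F × W) ≃L[ℝ] E) → (F × W →L[ℝ] E)) :=
    (Filter.Eventually.and (hUW.mem_nhds hp0) (G.open_source.mem_nhds hG0)).and hTinv
  have hall' : ∀ᶠ x in 𝓝 x₀, (((x, (0 : W)) ∈ U ×ˢ (univ : Set W)) ∧ (x, (0 : W)) ∈ G.source) ∧
      T (x, 0) ∈ range ((↑) : ((F × W) ≃L[ℝ] E) → (F × W →L[ℝ] E)) := by
    have hc : Tendsto (fun x : F => (x, (0 : W))) (𝓝 x₀) (𝓝 (x₀, 0)) :=
      (Continuous.prodMk_left (0 : W)).tendsto x₀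
    exact hc.eventually hall
  obtain ⟨U', hU'sub, hU'o, hx₀'⟩ := mem_nhds_iff.1 hall'
  have hΦx : ∀ x, Φ (x, 0) = φ x := fun x => by simp [Φ]
  have hcd : ∀ x ∈ U', ContDiffAt ℝ ∞ G.symm (φ x) := by
    intro x hx
    obtain ⟨⟨h1, h2⟩, L', hL'⟩ := hU'sub hx
    have h3 : G.symm (φ x) = (x, 0) := by
      rw [← hΦx, ← hG, G.left_inv h2]
    refine G.contDiffAt_symm (f₀' := L') ?_ ?_ ?_
    · rw [← hΦx, ← hG]
      exact G.map_source h2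
    · rw [h3, hL']
      exact hΦd _ h1
    · rw [h3]
      exact hΦ.contDiffAt (hUW.mem_nhds h1)
  refine ⟨W, fun z => (G.symm z).2, U', hU'o, hx₀', fun x hx => (hU'sub hx).1.1.1,
    fun x hx => contDiffAt_snd.comp _ (hcd x hx), fun x hx v w => ?_, fun x hx u => ?_⟩
  · have h1 := (hU'sub hx).1
    have h2 : HasFDerivAt (fun z => (G.symm z).2) (fderiv ℝ (fun z => (G.symm z).2) (φ x))
        (Φ (x, 0)) := by
      rw [hΦx]
      exact ((contDiffAt_snd.comp _ (hcd x hx)).differentiableAt (by simp)).hasFDerivAt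
    have h3 := HasFDerivAt.comp (x, (0 : W)) h2 (hΦd _ h1.1)
    have h4 : ((fun z => (G.symm z).2) ∘ Φ) =ᶠ[𝓝 (x, (0 : W))] Prod.snd := by
      filter_upwards [G.open_source.mem_nhds h1.2] with p hp
      simp only [Function.comp_apply, ← hG, G.left_inv hp]
    have h5 := (h3.congr_of_eventuallyEq h4.symm).unique hasFDerivAt_snd
    exact DFunLike.congr_fun h5 (v, w)
  · obtain ⟨L', hL'⟩ := (hU'sub hx).2
    have h1 : T (x, 0) (L'.symm u) = u := by
      rw [← hL']
      exact L'.apply_symm_apply u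
    exact ⟨(L'.symm u).1, (L'.symm u).2, h1.symm⟩

/-- A coframe of the characteristic bundle of a generic CR submanifold: near each point there is a
vector valued one-form `S` whose kernel is the holomorphic tangent space, and the exterior
derivative of which is of type `(1, 1)`. -/
theorem exists_coframe {φ : F → E} {U : Set F} (hU : IsOpen U)
    (hφ : ContDiffOn ℝ ∞ φ U) {x₀ : F} (hx₀ : x₀ ∈ U)
    (hinj : Function.Injective (fderiv ℝ φ x₀))
    (hgen : ∀ x ∈ U, ∀ u : E, ∃ v w, u = fderiv ℝ φ x v + Complex.I • fderiv ℝ φ x w) :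
    ∃ (W : Submodule ℝ E) (S : F → (F →L[ℝ] W)) (U' : Set F), IsOpen U' ∧ x₀ ∈ U' ∧ U' ⊆ U ∧
      ContDiffOn ℝ ∞ S U' ∧ (∀ x ∈ U', Function.Surjective (S x)) ∧
      (∀ x ∈ U', ∀ v, S x v = 0 ↔ ∃ w, Complex.I • fderiv ℝ φ x v = fderiv ℝ φ x w) ∧
      (∀ x ∈ U', ∀ v v' w w', Complex.I • fderiv ℝ φ x v = fderiv ℝ φ x v' →
        Complex.I • fderiv ℝ φ x w = fderiv ℝ φ x w' →
        fderiv ℝ S x v' w' - fderiv ℝ S x w' v' = fderiv ℝ S x v w - fderiv ℝ S x w v) := by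
  obtain ⟨W, ρ, U', hU', hx₀', hUU, hρ, hρd, hρs⟩ := exists_defining_function hU hφ hx₀ hinj
  have hφ' : ∀ x ∈ U', ContDiffAt ℝ ∞ φ x := fun x hx => hφ.contDiffAt (hU.mem_nhds (hUU hx))
  have hφ'' : ∀ x ∈ U', ContDiffAt ℝ ∞ (fderiv ℝ φ) x := fun x hx =>
    (hφ' x hx).fderiv_right (by simp)
  have hρ' : ∀ x ∈ U', ContDiffAt ℝ ∞ (fderiv ℝ ρ) (φ x) := fun x hx =>
    (hρ x hx).fderiv_right (by simp)
  -- Up to sign, the pull-back of `d^c ρ`. As `ker dρ` is the tangent space, `S v = 0` says that `i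
  -- dφ(v)` is again tangent.
  let S : F → (F →L[ℝ] W) := fun x =>
    (fderiv ℝ ρ (φ x)).comp ((mulI E).comp (fderiv ℝ φ x))
  have hSapp : ∀ x v, S x v = fderiv ℝ ρ (φ x) (Complex.I • fderiv ℝ φ x v) := fun x v => rfl
  have hρt : ∀ x ∈ U', ∀ v, fderiv ℝ ρ (φ x) (fderiv ℝ φ x v) = 0 := fun x hx v => by
    simpa using hρd x hx v 0
  have hSd : ∀ x ∈ U', ∀ v w, fderiv ℝ S x v w =
      fderiv ℝ (fderiv ℝ ρ) (φ x) (fderiv ℝ φ x v) (Complex.I • fderiv ℝ φ x w) +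
        fderiv ℝ ρ (φ x) (Complex.I • fderiv ℝ (fderiv ℝ φ) x v w) := by
    intro x hx v w
    have h1 : HasFDerivAt (fun x => fderiv ℝ ρ (φ x)) _ x :=
      HasFDerivAt.comp x ((hρ' x hx).differentiableAt (by simp)).hasFDerivAt
        ((hφ' x hx).differentiableAt (by simp)).hasFDerivAt
    have h2 : HasFDerivAt (fun x => (mulI E).comp (fderiv ℝ φ x)) _ x :=
      (hasFDerivAt_const (mulI E) x).clm_comp
        ((hφ'' x hx).differentiableAt (by simp)).hasFDerivAt
    have h3 : HasFDerivAt S _ x := h1.clm_comp h2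
    rw [h3.fderiv]
    simp only [_root_.add_apply, ContinuousLinearMap.comp_apply, ContinuousLinearMap.compL_apply,
      ContinuousLinearMap.flip_apply, _root_.zero_apply, mulI_apply, map_zero, add_zero]
    rw [add_comm]
  refine ⟨W, S, U', hU', hx₀', hUU, fun x hx => ContDiffAt.contDiffWithinAt ?_,
    fun x hx => ?_, fun x hx v => ⟨fun h => ?_, ?_⟩, fun x hx v v' w w' hv hw => ?_⟩
  · exact ((hρ' x hx).comp x (hφ' x hx)).clm_comp (contDiffAt_const.clm_comp (hφ'' x hx))
  · intro w
    -- Genericity: `dρ` kills the tangential part of `w = dφ(a) + i dφ(b)`, so `S b = dρ(w) = w`.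
    obtain ⟨a, b, hab⟩ := hgen x (hUU hx) (w : E)
    refine ⟨b, ?_⟩
    have h1 := hρd x hx 0 w
    rw [map_zero, zero_add, hab, map_add, hρt x hx, zero_add] at h1
    exact h1
  · obtain ⟨a, b, hab⟩ := hρs x hx (Complex.I • fderiv ℝ φ x v)
    have h1 := hρd x hx a b
    rw [← hab] at h1
    have h2 : b = 0 := h1.symm.trans h
    rw [h2] at hab
    exact ⟨a, by simpa using hab⟩
  · rintro ⟨w, hw⟩
    rw [hSapp, hw, hρt x hx]
  · have hsρ : IsSymmSndFDerivAt ℝ ρ (φ x) := (hρ x hx).isSymmSndFDerivAt (by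
      rw [minSmoothness_of_isRCLikeNormedField]
      exact WithTop.coe_le_coe.2 le_top)
    have hsφ : IsSymmSndFDerivAt ℝ φ x := (hφ' x hx).isSymmSndFDerivAt (by
      rw [minSmoothness_of_isRCLikeNormedField]
      exact WithTop.coe_le_coe.2 le_top)
    -- The terms with `D²φ` are symmetric and drop out. The rest is `D²ρ(v, iw) - D²ρ(w, iv)`, which
    -- is unchanged when `v, w` become `iv, iw`, by symmetry of `D²ρ`.
    rw [hSd x hx, hSd x hx, hSd x hx, hSd x hx, ← hv, ← hw, I_smul_I_smul, I_smul_I_smul,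
      hsφ.eq v' w', hsφ.eq v w, map_neg, map_neg, hsρ.eq (Complex.I • fderiv ℝ φ x v),
      hsρ.eq (Complex.I • fderiv ℝ φ x w)]
    abel

end LocalCR

/-! ### Immersions and holomorphic charts -/

section Charts

variable {F E : Type*} {M Z : Type*} [NormedAddCommGroup F] [NormedSpace ℝ F]
  [NormedAddCommGroup E] [NormedSpace ℂ E]
  [TopologicalSpace M] [ChartedSpace F M] [TopologicalSpace Z] [ChartedSpace E Z]

/-- In the charts of the immersion `f` is an injective linear map, and the domain chart has an
invertible differential. -/
theorem injective_mfderiv_of_isImmersionAt {E : Type*} [NormedAddCommGroup E] [NormedSpace ℝ E]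
    {Z : Type*} [TopologicalSpace Z] [ChartedSpace E Z]
    [IsManifold 𝓘(ℝ, F) ∞ M] [IsManifold 𝓘(ℝ, E) ∞ Z] {f : M → Z} {x : M}
    (h : IsImmersionAt 𝓘(ℝ, F) 𝓘(ℝ, E) ∞ f x) :
    Function.Injective (mfderiv 𝓘(ℝ, F) 𝓘(ℝ, E) f x) := by
  have hf : MDifferentiableAt 𝓘(ℝ, F) 𝓘(ℝ, E) f x := h.contMDiffAt.mdifferentiableAt (by simp)
  have hc : MDifferentiableAt 𝓘(ℝ, E) 𝓘(ℝ, E) h.codChart (f x) :=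
    ((contMDiffOn_of_mem_maximalAtlas h.codChart_mem_maximalAtlas).contMDiffAt
      (h.codChart.open_source.mem_nhds h.mem_codChart_source)).mdifferentiableAt (by simp)
  have hd : MDifferentiableAt 𝓘(ℝ, F) 𝓘(ℝ, F) h.domChart x :=
    ((contMDiffOn_of_mem_maximalAtlas h.domChart_mem_maximalAtlas).contMDiffAt
      (h.domChart.open_source.mem_nhds h.mem_domChart_source)).mdifferentiableAt (by simp)
  have hds : MDifferentiableAt 𝓘(ℝ, F) 𝓘(ℝ, F) h.domChart.symm (h.domChart x) :=
    ((contMDiffOn_symm_of_mem_maximalAtlas h.domChart_mem_maximalAtlas).contMDiffAt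
      (h.domChart.open_target.mem_nhds (h.domChart.map_source
        h.mem_domChart_source))).mdifferentiableAt (by simp)
  let L : F →L[ℝ] E := (h.equiv : (F × h.complement) →L[ℝ] E).comp
    (ContinuousLinearMap.inl ℝ F h.complement)
  have hL : Function.Injective L := h.equiv.injective.comp fun a b hab => congrArg Prod.fst hab
  have hev : (h.codChart ∘ f) =ᶠ[𝓝 x] (L ∘ h.domChart) := by
    filter_upwards [h.domChart.open_source.mem_nhds h.mem_domChart_source] with y hy
    have h0 : h.domChart y ∈ (h.domChart.extend 𝓘(ℝ, F)).target := by
      simpa using h.domChart.map_source hy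
    have h1 := h.writtenInCharts h0
    simp only [Function.comp_apply, OpenPartialHomeomorph.extend_coe,
      OpenPartialHomeomorph.extend_coe_symm, modelWithCornersSelf_coe, modelWithCornersSelf_coe_symm,
      id_eq, h.domChart.left_inv hy] at h1
    exact h1
  have h1 : mfderiv 𝓘(ℝ, F) 𝓘(ℝ, E) (h.codChart ∘ f) x =
      (mfderiv 𝓘(ℝ, F) 𝓘(ℝ, E) L (h.domChart x)).comp
        (mfderiv 𝓘(ℝ, F) 𝓘(ℝ, F) h.domChart x) :=
    hev.mfderiv_eq.trans (mfderiv_comp x L.differentiableAt.mdifferentiableAt hd)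
  rw [mfderiv_comp x hc hf] at h1
  have h2 : (h.domChart.symm ∘ h.domChart) =ᶠ[𝓝 x] id := by
    filter_upwards [h.domChart.open_source.mem_nhds h.mem_domChart_source] with y hy
    exact h.domChart.left_inv hy
  have h3 : (mfderiv 𝓘(ℝ, F) 𝓘(ℝ, F) h.domChart.symm (h.domChart x)).comp
        (mfderiv 𝓘(ℝ, F) 𝓘(ℝ, F) h.domChart x) = mfderiv 𝓘(ℝ, F) 𝓘(ℝ, F) id x :=
    (mfderiv_comp x hds hd).symm.trans h2.mfderiv_eq
  rw [mfderiv_id] at h3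
  have h4 : ∀ v : F, mfderiv 𝓘(ℝ, F) 𝓘(ℝ, E) L (h.domChart x) v = L v := fun v => by
    rw [mfderiv_eq_fderiv, L.fderiv]
    rfl
  intro v w hvw
  have h5 := DFunLike.congr_fun h1 v
  have h6 := DFunLike.congr_fun h1 w
  have h7 : L (mfderiv 𝓘(ℝ, F) 𝓘(ℝ, F) h.domChart x v) =
      L (mfderiv 𝓘(ℝ, F) 𝓘(ℝ, F) h.domChart x w) := by
    refine (h4 _).symm.trans (h5.symm.trans (Eq.trans ?_ (h6.trans (h4 _))))
    exact congrArg (fun q : E => (mfderiv 𝓘(ℝ, E) 𝓘(ℝ, E) h.codChart (f x) : E →L[ℝ] E) q) hvw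
  have h8 := hL h7
  refine (DFunLike.congr_fun h3 v).symm.trans (Eq.trans ?_ (DFunLike.congr_fun h3 w))
  exact congrArg (fun q : F => (mfderiv 𝓘(ℝ, F) 𝓘(ℝ, F) h.domChart.symm (h.domChart x) :
    F →L[ℝ] F) q) h8

/-- The real manifold underlying a complex manifold. -/
theorem isManifold_real_of_complex [IsManifold 𝓘(ℂ, E) ω Z] : IsManifold 𝓘(ℝ, E) ∞ Z := by
  refine isManifold_of_contDiffOn 𝓘(ℝ, E) ∞ Z fun e e' he he' => ?_
  have h1 := (contDiffGroupoid ω 𝓘(ℂ, E)).compatible he he'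
  have h2 : ContDiffOn ℂ ω (e.symm ≫ₕ e') ((e.symm ≫ₕ e').source ∩ range id) :=
    ((mem_groupoid_of_pregroupoid (PG := contDiffPregroupoid ω 𝓘(ℂ, E))).1 h1).1
  rw [range_id, inter_univ] at h2
  have h3 := (h2.restrict_scalars ℝ).of_le (n := ω) (m := ∞) le_top
  exact h3.mono fun x hx => hx.1

theorem hasMFDerivAt_restrictScalars {g : Z → E} {z : Z} {g' : E →L[ℂ] E}
    (h : HasMFDerivAt 𝓘(ℂ, E) 𝓘(ℂ, E) g z g') :
    HasMFDerivAt 𝓘(ℝ, E) 𝓘(ℝ, E) g z (g'.restrictScalars ℝ) :=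
  ⟨h.1, h.2.restrictScalars ℝ⟩

/-- Transition maps are holomorphic, so multiplication by `i` on tangent spaces means the same in
the chart at `z₀` as in the preferred chart at `z`. -/
theorem mfderiv_extChartAt_I_smul [IsManifold 𝓘(ℂ, E) ω Z] {z₀ z : Z}
    (hz : z ∈ (chartAt E z₀).source) (u : E) :
    (mfderiv 𝓘(ℝ, E) 𝓘(ℝ, E) (extChartAt 𝓘(ℝ, E) z₀) z : E →L[ℝ] E) (Complex.I • u) =
      mulI E ((mfderiv 𝓘(ℝ, E) 𝓘(ℝ, E) (extChartAt 𝓘(ℝ, E) z₀) z : E →L[ℝ] E) u) := by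
  have h1 : IsManifold 𝓘(ℂ, E) 1 Z := IsManifold.of_le (n := ω) (by simp)
  have h2 : MDifferentiableAt 𝓘(ℂ, E) 𝓘(ℂ, E) (extChartAt 𝓘(ℂ, E) z₀) z :=
    mdifferentiableAt_extChartAt hz
  have h3 := (hasMFDerivAt_restrictScalars h2.hasMFDerivAt).mfderiv
  let D : E →L[ℂ] E := mfderiv 𝓘(ℂ, E) 𝓘(ℂ, E) (extChartAt 𝓘(ℂ, E) z₀) z
  have h4 : ∀ u : E, (mfderiv 𝓘(ℝ, E) 𝓘(ℝ, E) (extChartAt 𝓘(ℝ, E) z₀) z : E →L[ℝ] E) u = D u :=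
    fun u => DFunLike.congr_fun h3 u
  exact (h4 _).trans ((D.map_smul _ _).trans (congrArg (fun q : E => Complex.I • q) (h4 u).symm))

end Charts

/-! ### Local coframes of the characteristic bundle -/

section Coframe

variable (F E : Type*) {M Z : Type*} [NormedAddCommGroup F] [NormedSpace ℝ F]
  [NormedAddCommGroup E] [NormedSpace ℂ E]
  [TopologicalSpace M] [ChartedSpace F M] [TopologicalSpace Z] [ChartedSpace E Z]

/-- The differential at `x` of the inverse of the preferred chart at `y₀`. -/
def chartSymmDiff (y₀ : M) (x : F) : F →L[ℝ] F :=
  mfderiv 𝓘(ℝ, F) 𝓘(ℝ, F) (extChartAt 𝓘(ℝ, F) y₀).symm x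

/-- The real differential of `f`, in the preferred chart of the source at `y₀`. -/
def coordDiff (f : M → Z) (y₀ : M) (x : F) : F →L[ℝ] E :=
  (realDiff F E f ((extChartAt 𝓘(ℝ, F) y₀).symm x)).comp (chartSymmDiff F y₀ x)

/-- `S` is a coframe of the characteristic bundle over the open set `U` of the preferred chart
at `y₀`. -/
structure IsCoframe {W : Type*} [NormedAddCommGroup W] [NormedSpace ℝ W] (f : M → Z) (y₀ : M)
    (U : Set F) (S : F → (F →L[ℝ] W)) : Prop where
  isOpen : IsOpen U
  subset : U ⊆ (extChartAt 𝓘(ℝ, F) y₀).target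
  contDiffOn : ContDiffOn ℝ ∞ S U
  surjective : ∀ x ∈ U, Function.Surjective (S x)
  apply_eq_zero_iff : ∀ x ∈ U, ∀ v, S x v = 0 ↔
    ∃ w, Complex.I • coordDiff F E f y₀ x v = coordDiff F E f y₀ x w
  fderiv_eq : ∀ x ∈ U, ∀ v v' w w',
    Complex.I • coordDiff F E f y₀ x v = coordDiff F E f y₀ x v' →
    Complex.I • coordDiff F E f y₀ x w = coordDiff F E f y₀ x w' →
    fderiv ℝ S x v' w' - fderiv ℝ S x w' v' = fderiv ℝ S x v w - fderiv ℝ S x w v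

variable {F E}

theorem bijective_chartSymmDiff [IsManifold 𝓘(ℝ, F) ∞ M] {y₀ : M} {x : F}
    (hx : x ∈ (extChartAt 𝓘(ℝ, F) y₀).target) : Function.Bijective (chartSymmDiff F y₀ x) := by
  have h2 : IsManifold 𝓘(ℝ, F) 1 M := IsManifold.of_le (n := ∞) (by simp)
  have h := isInvertible_mfderivWithin_extChartAt_symm (I := 𝓘(ℝ, F)) hx
  simp only [modelWithCornersSelf_coe, range_id, mfderivWithin_univ] at h
  obtain ⟨L, hL⟩ := h
  have : (chartSymmDiff F y₀ x : F → F) = L := by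
    funext v
    exact (DFunLike.congr_fun hL v).symm
  rw [this]
  exact L.bijective

theorem bijective_mfderiv_extChartAt {E : Type*} [NormedAddCommGroup E] [NormedSpace ℝ E]
    {Z : Type*} [TopologicalSpace Z] [ChartedSpace E Z] [IsManifold 𝓘(ℝ, E) ∞ Z] {z₀ z : Z}
    (hz : z ∈ (extChartAt 𝓘(ℝ, E) z₀).source) :
    Function.Bijective
      (mfderiv 𝓘(ℝ, E) 𝓘(ℝ, E) (extChartAt 𝓘(ℝ, E) z₀) z : E →L[ℝ] E) := by
  have h2 : IsManifold 𝓘(ℝ, E) 1 Z := IsManifold.of_le (n := ∞) (by simp)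
  obtain ⟨L, hL⟩ := isInvertible_mfderiv_extChartAt (I := 𝓘(ℝ, E)) hz
  have : (mfderiv 𝓘(ℝ, E) 𝓘(ℝ, E) (extChartAt 𝓘(ℝ, E) z₀) z : E → E) = L := by
    funext v
    exact (DFunLike.congr_fun hL v).symm
  exact this ▸ L.bijective

variable [IsManifold 𝓘(ℝ, F) ∞ M] [IsManifold 𝓘(ℂ, E) ω Z] {f : M → Z}

theorem IsGenericCREmbedding.injective_realDiff (hf : IsGenericCREmbedding F E f) (y : M) :
    Function.Injective (realDiff F E f y) := by
  have : IsManifold 𝓘(ℝ, E) ∞ Z := isManifold_real_of_complex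
  exact injective_mfderiv_of_isImmersionAt (hf.isSmoothEmbedding.isImmersion.isImmersionAt y)

theorem IsGenericCREmbedding.injective_coordDiff (hf : IsGenericCREmbedding F E f) {y₀ : M} {x : F}
    (hx : x ∈ (extChartAt 𝓘(ℝ, F) y₀).target) : Function.Injective (coordDiff F E f y₀ x) :=
  (hf.injective_realDiff _).comp (bijective_chartSymmDiff hx).injective

/-- A generic CR submanifold has local coframes of its characteristic bundle. -/
theorem IsGenericCREmbedding.exists_isCoframe [FiniteDimensional ℝ F] [FiniteDimensional ℝ E]
    (hf : IsGenericCREmbedding F E f) (y₀ : M) :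
    ∃ (W : Submodule ℝ E) (U : Set F) (S : F → (F →L[ℝ] W)),
      extChartAt 𝓘(ℝ, F) y₀ y₀ ∈ U ∧ IsCoframe F E f y₀ U S := by
  have hZ : IsManifold 𝓘(ℝ, E) ∞ Z := isManifold_real_of_complex
  have hZ1 : IsManifold 𝓘(ℝ, E) 1 Z := IsManifold.of_le (n := ∞) (by simp)
  have hfc : ContMDiff 𝓘(ℝ, F) 𝓘(ℝ, E) ∞ f := hf.isSmoothEmbedding.contMDiff
  let κ := extChartAt 𝓘(ℝ, F) y₀
  let μ := extChartAt 𝓘(ℝ, E) (f y₀)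
  let U : Set F := κ.target ∩ (f ∘ κ.symm) ⁻¹' μ.source
  have hfκ : ContMDiffOn 𝓘(ℝ, F) 𝓘(ℝ, E) ∞ (f ∘ κ.symm) κ.target :=
    hfc.comp_contMDiffOn (contMDiffOn_extChartAt_symm y₀)
  have hU : IsOpen U := hfκ.continuousOn.isOpen_inter_preimage (isOpen_extChartAt_target y₀)
    (isOpen_extChartAt_source (f y₀))
  let φ : F → E := μ ∘ (f ∘ κ.symm)
  have hμ : ∀ z ∈ μ.source, ContMDiffAt 𝓘(ℝ, E) 𝓘(ℝ, E) ∞ μ z := fun z hz =>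
    contMDiffAt_extChartAt' (by simpa [μ] using hz)
  have hκs : ∀ x ∈ U, ContMDiffAt 𝓘(ℝ, F) 𝓘(ℝ, F) ∞ κ.symm x := fun x hx =>
    (contMDiffOn_extChartAt_symm y₀).contMDiffAt ((isOpen_extChartAt_target y₀).mem_nhds hx.1)
  have hφat : ∀ x ∈ U, ContMDiffAt 𝓘(ℝ, F) 𝓘(ℝ, E) ∞ φ x := fun x hx =>
    (hμ _ hx.2).comp x ((hfc _).comp x (hκs x hx))
  have hφ : ContDiffOn ℝ ∞ φ U := fun x hx =>
    (contMDiffAt_iff_contDiffAt.1 (hφat x hx)).contDiffWithinAt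
  -- Passes from the identification of the tangent space by the chart at the point itself to that by
  -- the fixed chart at `f y₀`. It is bijective and commutes with `i`, so conditions on `φ` and on
  -- `coordDiff` agree.
  let Bc : F → (E →L[ℝ] E) := fun x => mfderiv 𝓘(ℝ, E) 𝓘(ℝ, E) μ (f (κ.symm x))
  have hBc : ∀ x ∈ U, Function.Bijective (Bc x) := fun x hx => bijective_mfderiv_extChartAt hx.2
  have hBcI : ∀ x ∈ U, ∀ u, Bc x (Complex.I • u) = Complex.I • Bc x u := fun x hx u =>
    mfderiv_extChartAt_I_smul (by simpa [μ] using hx.2) u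
  have hφd : ∀ x ∈ U, ∀ v, fderiv ℝ φ x v = Bc x (coordDiff F E f y₀ x v) := by
    intro x hx v
    have h1 := mfderiv_comp x ((hμ _ hx.2).mdifferentiableAt (by simp))
      (((hfc _).comp x (hκs x hx)).mdifferentiableAt (by simp))
    have h2 := mfderiv_comp x ((hfc (κ.symm x)).mdifferentiableAt (by simp))
      ((hκs x hx).mdifferentiableAt (by simp))
    rw [← mfderiv_eq_fderiv]
    refine (DFunLike.congr_fun h1 v).trans ?_
    exact congrArg (fun q : E => Bc x q) (DFunLike.congr_fun h2 v)
  have hUκ : U ⊆ κ.target := fun x hx => hx.1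
  have hy₀ : κ y₀ ∈ U := ⟨mem_extChartAt_target y₀, by
    change f (κ.symm (κ y₀)) ∈ μ.source
    rw [extChartAt_to_inv]
    exact mem_extChartAt_source (f y₀)⟩
  have hiff : ∀ x ∈ U, ∀ v w, Complex.I • fderiv ℝ φ x v = fderiv ℝ φ x w ↔
      Complex.I • coordDiff F E f y₀ x v = coordDiff F E f y₀ x w := fun x hx v w => by
    rw [hφd x hx, hφd x hx, ← hBcI x hx, (hBc x hx).injective.eq_iff]
  obtain ⟨W, S, U', hU', hy₀', hUU, hS, hSs, hSk, hSd⟩ := exists_coframe hU hφ hy₀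
    (by
      have h1 : (fderiv ℝ φ (κ y₀) : F → E) = Bc (κ y₀) ∘ coordDiff F E f y₀ (κ y₀) :=
        funext (hφd _ hy₀)
      rw [h1]
      exact (hBc _ hy₀).injective.comp (hf.injective_coordDiff hy₀.1))
    (by
      intro x hx u
      obtain ⟨u', rfl⟩ := (hBc x hx).surjective u
      obtain ⟨v, w, rfl⟩ := hf.generic (κ.symm x) u'
      obtain ⟨v, rfl⟩ := (bijective_chartSymmDiff (hUκ hx)).surjective v
      obtain ⟨w, rfl⟩ := (bijective_chartSymmDiff (hUκ hx)).surjective w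
      refine ⟨v, w, ?_⟩
      rw [hφd x hx, hφd x hx, ← hBcI x hx, ← map_add]
      rfl)
  refine ⟨W, U', S, hy₀', hU', hUU.trans hUκ, hS, hSs, fun x hx v => ?_,
    fun x hx v v' w w' hv hw => ?_⟩
  · rw [hSk x hx]
    exact exists_congr fun w => hiff x (hUU hx) v w
  · exact hSd x hx v v' w w' ((hiff x (hUU hx) v v').2 hv) ((hiff x (hUU hx) w w').2 hw)

end Coframe

/-! ### The conormal bundle of a coframe -/

section FlatCoframe

theorem exists_continuous_rightInverse {F W : Type*} [NormedAddCommGroup F] [NormedSpace ℝ F]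
    [NormedAddCommGroup W] [NormedSpace ℝ W] [FiniteDimensional ℝ W] {T : F →L[ℝ] W} (hT : Function.Surjective T) :
    ∃ R : W →L[ℝ] F, ∀ w, T (R w) = w := by
  obtain ⟨R, hR⟩ := (T : F →ₗ[ℝ] W).exists_rightInverse_of_surjective (LinearMap.range_eq_top.2 hT)
  exact ⟨R.toContinuousLinearMap, fun w => DFunLike.congr_fun hR w⟩

variable {F W : Type*} [NormedAddCommGroup F] [NormedSpace ℝ F]
  [NormedAddCommGroup W] [NormedSpace ℝ W]

/-- The one-form `c ∘ S` on the bundle of covectors that are combinations of the coframe `S`, in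
the coordinates `(x, c)`. -/
def coframeForm (S : F → (F →L[ℝ] W)) (a : F × (W →L[ℝ] ℝ)) : F × (W →L[ℝ] ℝ) →L[ℝ] ℝ :=
  (a.2.comp (S a.1)).comp (ContinuousLinearMap.fst ℝ F (W →L[ℝ] ℝ))

theorem coframeForm_apply (S : F → (F →L[ℝ] W)) (a u : F × (W →L[ℝ] ℝ)) :
    coframeForm S a u = a.2 (S a.1 u.1) := rfl

theorem contDiffOn_coframeForm {S : F → (F →L[ℝ] W)} {U : Set F} (hS : ContDiffOn ℝ ∞ S U) :
    ContDiffOn ℝ ∞ (coframeForm S) (U ×ˢ univ) := by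
  have h1 : ContDiffOn ℝ ∞ (fun a : F × (W →L[ℝ] ℝ) => S a.1) (U ×ˢ univ) :=
    hS.comp contDiff_fst.contDiffOn fun a ha => ha.1
  exact (contDiff_snd.contDiffOn.clm_comp h1).clm_comp contDiffOn_const

/-- The Leibniz rule `d(c ∘ S) = dc ∧ S + c ∘ dS`. -/
theorem flatExtDeriv_coframeForm {S : F → (F →L[ℝ] W)} {a : F × (W →L[ℝ] ℝ)}
    (hS : DifferentiableAt ℝ S a.1) (u v : F × (W →L[ℝ] ℝ)) :
    flatExtDeriv (coframeForm S) a u v = u.2 (S a.1 v.1) - v.2 (S a.1 u.1) +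
      a.2 (fderiv ℝ S a.1 u.1 v.1 - fderiv ℝ S a.1 v.1 u.1) := by
  have h1 : HasFDerivAt (fun a : F × (W →L[ℝ] ℝ) => S a.1) _ a :=
    HasFDerivAt.comp a hS.hasFDerivAt hasFDerivAt_fst
  have h2 : HasFDerivAt (fun a : F × (W →L[ℝ] ℝ) => a.2.comp (S a.1)) _ a :=
    hasFDerivAt_snd.clm_comp h1
  have h3 : HasFDerivAt (coframeForm S) _ a := h2.clm_comp (hasFDerivAt_const _ a)
  rw [flatExtDeriv_apply, h3.fderiv]
  simp only [_root_.add_apply, ContinuousLinearMap.comp_apply,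
    ContinuousLinearMap.compL_apply, ContinuousLinearMap.flip_apply, _root_.zero_apply, map_zero,
    ContinuousLinearMap.coe_fst', ContinuousLinearMap.coe_snd', map_sub]
  ring

/-- The null space of the restriction of `d (c ∘ S)` to the kernel of `S`. -/
def coframeNull (S : F → (F →L[ℝ] W)) (a : F × (W →L[ℝ] ℝ)) : Submodule ℝ F where
  carrier := {v | S a.1 v = 0 ∧
    ∀ w, S a.1 w = 0 → a.2 (fderiv ℝ S a.1 v w - fderiv ℝ S a.1 w v) = 0}
  zero_mem' := by simp
  add_mem' := by
    rintro v v' ⟨h1, h2⟩ ⟨h1', h2'⟩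
    refine ⟨by rw [map_add, h1, h1', add_zero], fun w hw => ?_⟩
    have h3 := h2 w hw
    have h4 := h2' w hw
    simp only [map_sub, map_add, _root_.add_apply] at h3 h4 ⊢
    linarith
  smul_mem' := by
    rintro r v ⟨h1, h2⟩
    refine ⟨by rw [map_smul, h1, smul_zero], fun w hw => ?_⟩
    have h3 := h2 w hw
    simp only [map_sub, map_smul, _root_.smul_apply, smul_eq_mul] at h3 ⊢
    rw [← mul_sub, h3, mul_zero]

theorem mem_coframeNull {S : F → (F →L[ℝ] W)} {a : F × (W →L[ℝ] ℝ)} {v : F} :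
    v ∈ coframeNull S a ↔ S a.1 v = 0 ∧
      ∀ w, S a.1 w = 0 → a.2 (fderiv ℝ S a.1 v w - fderiv ℝ S a.1 w v) = 0 := Iff.rfl

/-- Pairing with the fibre directions `(0, δ)` gives `δ(S v) = 0` for every `δ`. Hence the
tautological form vanishes on the kernel of its own derivative. -/
theorem apply_eq_zero_of_mem_flatKer_coframeForm {S : F → (F →L[ℝ] W)} {a : F × (W →L[ℝ] ℝ)}
    (hS : DifferentiableAt ℝ S a.1) {u : F × (W →L[ℝ] ℝ)} (hu : u ∈ flatKer (coframeForm S) a) :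
    S a.1 u.1 = 0 := by
  refine SeparatingDual.eq_zero_of_forall_dual_eq_zero (R := ℝ) fun δ => ?_
  have h1 := DFunLike.congr_fun (mem_flatKer.1 hu) ((0, δ) : F × (W →L[ℝ] ℝ))
  rw [flatExtDeriv_coframeForm hS] at h1
  simpa using h1

variable [FiniteDimensional ℝ W]

/-- The projection `(v, γ) ↦ v` is an isomorphism onto `coframeNull S a`: `γ` has to solve `γ ∘ S =
-c ∘ dS(v, ·)`, which has exactly one solution because `S` is onto and the right side vanishes on
`ker S`. -/
theorem finrank_flatKer_coframeForm {S : F → (F →L[ℝ] W)} {a : F × (W →L[ℝ] ℝ)}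
    (hS : DifferentiableAt ℝ S a.1) (hsurj : Function.Surjective (S a.1)) :
    Module.finrank ℝ (flatKer (coframeForm S) a) = Module.finrank ℝ (coframeNull S a) := by
  have hmem : ∀ u ∈ flatKer (coframeForm S) a, u.1 ∈ coframeNull S a := by
    intro u hu
    have h0 := apply_eq_zero_of_mem_flatKer_coframeForm hS hu
    refine ⟨h0, fun w hw => ?_⟩
    have h1 := DFunLike.congr_fun (mem_flatKer.1 hu) ((w, 0) : F × (W →L[ℝ] ℝ))
    rw [flatExtDeriv_coframeForm hS, h0, hw, map_zero, map_zero, sub_zero, zero_add] at h1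
    exact h1
  let T : flatKer (coframeForm S) a →ₗ[ℝ] coframeNull S a :=
    ((LinearMap.fst ℝ F (W →L[ℝ] ℝ)).domRestrict (flatKer (coframeForm S) a)).codRestrict _
      fun u => hmem u u.2
  refine (LinearEquiv.ofBijective T ⟨?_, ?_⟩).finrank_eq
  · rw [← LinearMap.ker_eq_bot, LinearMap.ker_eq_bot']
    rintro ⟨⟨v, γ⟩, hu⟩ h
    have hv : v = 0 := congrArg Subtype.val h
    subst hv
    refine Subtype.ext (Prod.ext rfl (ContinuousLinearMap.ext fun w => ?_))
    obtain ⟨w, rfl⟩ := hsurj w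
    have h1 := DFunLike.congr_fun (mem_flatKer.1 hu) ((w, 0) : F × (W →L[ℝ] ℝ))
    rw [flatExtDeriv_coframeForm hS] at h1
    simpa using h1
  · rintro ⟨v, hv1, hv2⟩
    obtain ⟨R, hR⟩ := exists_continuous_rightInverse hsurj
    -- The right-hand side of the equation for `γ`; it factors through `S` as `θ.comp R`.
    let θ : F →L[ℝ] ℝ := a.2.comp ((fderiv ℝ S a.1).flip v - fderiv ℝ S a.1 v)
    have hθ : ∀ w, θ w = - a.2 (fderiv ℝ S a.1 v w - fderiv ℝ S a.1 w v) := fun w => by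
      simp [θ]
    have hθR : ∀ w, θ (R (S a.1 w)) = θ w := by
      intro w
      have h1 : S a.1 (w - R (S a.1 w)) = 0 := by rw [map_sub, hR, sub_self]
      have h2 : θ (w - R (S a.1 w)) = 0 := by rw [hθ, hv2 _ h1, neg_zero]
      rw [map_sub] at h2
      linarith
    refine ⟨⟨(v, θ.comp R), ?_⟩, rfl⟩
    rw [mem_flatKer]
    refine ContinuousLinearMap.ext fun w => ?_
    rw [flatExtDeriv_coframeForm hS, hv1, map_zero, sub_zero]
    have h1 := hθR w.1
    rw [hθ w.1] at h1
    change θ (R (S a.1 w.1)) + _ = (0 : ℝ)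
    linarith

/-- A splitting of the kernel of a surjective linear map depending on parameters. -/
theorem exists_splitting [FiniteDimensional ℝ F] {S : F → (F →L[ℝ] W)} {U : Set F} (hU : IsOpen U)
    (hS : ContDiffOn ℝ ∞ S U) {x₀ : F} (hx₀ : x₀ ∈ U) (hsurj : Function.Surjective (S x₀)) :
    ∃ (m : ℕ) (ι : RModel m →L[ℝ] F) (pr : F →L[ℝ] RModel m) (Q : F → (W →L[ℝ] F)) (U' : Set F),
      IsOpen U' ∧ x₀ ∈ U' ∧ U' ⊆ U ∧ ContDiffOn ℝ ∞ Q U' ∧ (∀ v, pr (ι v) = v) ∧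
      (∀ x ∈ U', ∀ w, S x (Q x w) = w) ∧ (∀ x, ∀ w, pr (Q x w) = 0) ∧
      ∀ x ∈ U', ∀ δ : F →L[ℝ] ℝ, (∀ w, δ (Q x w) = 0) → ∀ v, δ v = δ (ι (pr v)) := by
  obtain ⟨R, hR⟩ := exists_continuous_rightInverse hsurj
  have : CompleteSpace W := FiniteDimensional.complete ℝ W
  let K : Submodule ℝ F := LinearMap.ker (S x₀ : F →ₗ[ℝ] W)
  have hpr : ∀ v, (ContinuousLinearMap.id ℝ F - R.comp (S x₀)) v ∈ K := fun v => by
    change S x₀ (v - R (S x₀ v)) = 0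
    rw [map_sub, hR, sub_self]
  let pr : F →L[ℝ] K := (ContinuousLinearMap.id ℝ F - R.comp (S x₀)).codRestrict K hpr
  have hprv : ∀ v, (pr v : F) = v - R (S x₀ v) := fun v => rfl
  let T : K ≃L[ℝ] RModel (Module.finrank ℝ K) := ContinuousLinearEquiv.ofFinrankEq (by simp)
  -- Correcting the fixed right inverse `R` by the inverse of `S x ∘ R` gives a right inverse of `S
  -- x` whose range is still that of `R`. The projection `pr` along this range can therefore be
  -- independent of `x`.
  let P : F → (W →L[ℝ] W) := fun x => (S x).comp R
  have hP : ∀ x ∈ U, ContDiffAt ℝ ∞ P x := fun x hx =>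
    (hS.contDiffAt (hU.mem_nhds hx)).clm_comp contDiffAt_const
  have hP0 : P x₀ = 1 := ContinuousLinearMap.ext hR
  let U' : Set F := U ∩ P ⁻¹' {T : W →L[ℝ] W | IsUnit T}
  have hU' : IsOpen U' :=
    ContinuousOn.isOpen_inter_preimage (fun x hx => (hP x hx).continuousAt.continuousWithinAt) hU
      (Units.isOpen (R := W →L[ℝ] W))
  have hinv : ∀ x ∈ U', ∀ w, P x (Ring.inverse (P x) w) = w := fun x hx w =>
    DFunLike.congr_fun (Ring.mul_inverse_cancel (P x) hx.2) w
  have hinv' : ∀ x ∈ U', ∀ w, Ring.inverse (P x) (P x w) = w := fun x hx w =>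
    DFunLike.congr_fun (Ring.inverse_mul_cancel (P x) hx.2) w
  refine ⟨_, K.subtypeL.comp (T.symm : RModel (Module.finrank ℝ K) →L[ℝ] K),
    (T : K →L[ℝ] RModel (Module.finrank ℝ K)).comp pr, fun x => R.comp (Ring.inverse (P x)), U', hU', ⟨hx₀, ?_⟩, inter_subset_left,
    fun x hx => ?_, fun v => ?_, fun x hx w => hinv x hx w, fun x w => ?_, fun x hx δ hδ v => ?_⟩
  · change IsUnit (P x₀)
    rw [hP0]
    exact isUnit_one
  · obtain ⟨u, hu⟩ := hx.2
    have h1 : ContDiffAt ℝ ∞ (Ring.inverse : (W →L[ℝ] W) → (W →L[ℝ] W)) (P x) := by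
      rw [← hu]
      exact contDiffAt_ringInverse (R := W →L[ℝ] W) ℝ u
    exact (contDiffAt_const.clm_comp (h1.comp x (hP x hx.1))).contDiffWithinAt
  · have h1 : S x₀ (T.symm v : F) = 0 := (T.symm v).2
    have h2 : pr (T.symm v : F) = T.symm v := Subtype.ext (by rw [hprv, h1, map_zero, sub_zero])
    change T (pr (T.symm v : F)) = v
    rw [h2, T.apply_symm_apply]
  · have h1 : pr (R (Ring.inverse (P x) w)) = 0 := Subtype.ext (by
      rw [hprv, hR, sub_self, Submodule.coe_zero])
    change T (pr (R (Ring.inverse (P x) w))) = 0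
    rw [h1, map_zero]
  · have h1 := hδ (P x (S x₀ v))
    change δ (R (Ring.inverse (P x) (P x (S x₀ v)))) = 0 at h1
    rw [hinv' x hx] at h1
    change δ v = δ (T.symm (T (pr v)) : K)
    rw [T.symm_apply_apply, hprv, map_sub, h1, sub_zero]

/-- Coordinates on the cotangent bundle adapted to the conormal bundle of the kernel of `S`. -/
theorem exists_conormal_chart [FiniteDimensional ℝ F] {S : F → (F →L[ℝ] W)} {U : Set F} (hU : IsOpen U)
    (hS : ContDiffOn ℝ ∞ S U) {x₀ : F} (hx₀ : x₀ ∈ U) (hsurj : Function.Surjective (S x₀)) :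
    ∃ (m : ℕ) (e : OpenPartialHomeomorph (F × (F →L[ℝ] ℝ)) ((F × (W →L[ℝ] ℝ)) × (RModel m →L[ℝ] ℝ)))
      (U' : Set F), IsOpen U' ∧ x₀ ∈ U' ∧ U' ⊆ U ∧
      e.source = U' ×ˢ univ ∧ e.target = (U' ×ˢ univ) ×ˢ univ ∧
      ContDiffOn ℝ ∞ e e.source ∧ ContDiffOn ℝ ∞ e.symm e.target ∧
      (∀ p, (e p).1.1 = p.1) ∧ (∀ a, e.symm (a, 0) = (a.1, a.2.comp (S a.1))) ∧
      ∀ p ∈ e.source, (e p).2 = 0 ↔ ∀ v, S p.1 v = 0 → p.2 v = 0 := by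
  obtain ⟨m, ι, pr, Q, U', hU', hx₀', hUU, hQ, hprK, hSQ, hprQ, hδ⟩ :=
    exists_splitting hU hS hx₀ hsurj
  have hSQ' : ∀ x ∈ U', ∀ p : F →L[ℝ] ℝ, (∀ v, S x v = 0 → p v = 0) →
      ∀ v, p (Q x (S x v)) = p v := by
    intro x hx p hp v
    have h1 := hp (v - Q x (S x v)) (by rw [map_sub, hSQ x hx, sub_self])
    rw [map_sub] at h1
    linarith
  have h1 : ContDiffOn ℝ ∞ (fun p : F × (F →L[ℝ] ℝ) => p.2.comp (Q p.1)) (U' ×ˢ univ) :=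
    contDiff_snd.contDiffOn.clm_comp (hQ.comp contDiff_fst.contDiffOn fun p hp => hp.1)
  have h2 : ContDiffOn ℝ ∞ (fun p : F × (F →L[ℝ] ℝ) => S p.1) (U' ×ˢ univ) :=
    hS.comp contDiff_fst.contDiffOn fun p hp => hUU hp.1
  have h12 : ContDiffOn ℝ ∞ (fun p : F × (F →L[ℝ] ℝ) =>
      (p.2 - (p.2.comp (Q p.1)).comp (S p.1)).comp ι) (U' ×ˢ univ) :=
    (contDiff_snd.contDiffOn.sub (h1.clm_comp h2)).clm_comp contDiffOn_const
  have h3 : ContDiffOn ℝ ∞ (fun p : F × (F →L[ℝ] ℝ) => ((p.1, p.2.comp (Q p.1)),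
      (p.2 - (p.2.comp (Q p.1)).comp (S p.1)).comp ι)) (U' ×ˢ univ) :=
    (contDiff_fst.contDiffOn.prodMk h1).prodMk
      h12
  have h4 : ContDiffOn ℝ ∞ (fun q : (F × (W →L[ℝ] ℝ)) × (RModel m →L[ℝ] ℝ) => S q.1.1)
      ((U' ×ˢ univ) ×ˢ univ) :=
    hS.comp (contDiff_fst.comp contDiff_fst).contDiffOn fun q hq => hUU hq.1.1
  have h5 : ContDiffOn ℝ ∞ (fun q : (F × (W →L[ℝ] ℝ)) × (RModel m →L[ℝ] ℝ) =>
      (q.1.1, q.1.2.comp (S q.1.1) + q.2.comp pr)) ((U' ×ˢ univ) ×ˢ univ) :=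
    (contDiff_fst.comp contDiff_fst).contDiffOn.prodMk
      (((contDiff_snd.comp contDiff_fst).contDiffOn.clm_comp h4).add
        (contDiff_snd.contDiffOn.clm_comp contDiffOn_const))
  -- A covector `p` splits as `c ∘ S + κ ∘ pr` with `c = p ∘ Q`; it annihilates `ker S` exactly when
  -- `κ = 0`.
  let e : OpenPartialHomeomorph (F × (F →L[ℝ] ℝ)) ((F × (W →L[ℝ] ℝ)) × (RModel m →L[ℝ] ℝ)) :=
    { toFun := fun p => ((p.1, p.2.comp (Q p.1)),
        (p.2 - (p.2.comp (Q p.1)).comp (S p.1)).comp ι)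
      invFun := fun q => (q.1.1, q.1.2.comp (S q.1.1) + q.2.comp pr)
      source := U' ×ˢ univ
      target := (U' ×ˢ univ) ×ˢ univ
      map_source' := fun p hp => ⟨⟨hp.1, trivial⟩, trivial⟩
      map_target' := fun q hq => ⟨hq.1.1, trivial⟩
      left_inv' := by
        rintro ⟨x, η⟩ ⟨hx, -⟩
        refine Prod.ext rfl (ContinuousLinearMap.ext fun v => ?_)
        have := hδ x hx (η - (η.comp (Q x)).comp (S x)) (fun w => by
          simp [hSQ x hx]) v
        change η (Q x (S x v)) + (η - (η.comp (Q x)).comp (S x)) (ι (pr v)) = η v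
        rw [← this]
        simp
      right_inv' := by
        rintro ⟨⟨x, c⟩, κ⟩ ⟨⟨hx, -⟩, -⟩
        have hc : (c.comp (S x) + κ.comp pr).comp (Q x) = c :=
          ContinuousLinearMap.ext fun w => by simp [hSQ x hx, hprQ]
        refine Prod.ext (Prod.ext rfl hc) ?_
        simp only [hc]
        refine ContinuousLinearMap.ext fun v => ?_
        simp [hprK]
      open_source := hU'.prod isOpen_univ
      open_target := (hU'.prod isOpen_univ).prod isOpen_univ
      continuousOn_toFun := h3.continuousOn
      continuousOn_invFun := h5.continuousOn }
  refine ⟨_, e, U', hU', hx₀', hUU, rfl, rfl, h3, h5, fun p => rfl, fun a => ?_,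
    fun p hp => ⟨fun h v hv => ?_, fun h => ?_⟩⟩
  · change (a.1, a.2.comp (S a.1) + (0 : RModel m →L[ℝ] ℝ).comp pr) = _
    rw [ContinuousLinearMap.zero_comp, add_zero]
  · have h6 : e.symm (e p) = p := e.left_inv hp
    have h7 : p.2 = (p.2.comp (Q p.1)).comp (S p.1) + (e p).2.comp pr := (congrArg Prod.snd h6).symm
    rw [h, ContinuousLinearMap.zero_comp, add_zero] at h7
    rw [h7]
    simp [hv]
  · refine ContinuousLinearMap.ext fun v => ?_
    have := hSQ' p.1 hp.1 p.2 h (ι v)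
    change p.2 (ι v) - p.2 (Q p.1 (S p.1 (ι v))) = 0
    rw [this, sub_self]

end FlatCoframe

/-! ### Adapted charts of the characteristic bundle -/

section CharBundle

variable {F E W : Type*} {M Z : Type*} [NormedAddCommGroup F] [NormedSpace ℝ F]
  [NormedAddCommGroup E] [NormedSpace ℂ E] [NormedAddCommGroup W] [NormedSpace ℝ W]
  [TopologicalSpace M] [ChartedSpace F M] [TopologicalSpace Z] [ChartedSpace E Z]
  {f : M → Z} {ξ₀ : Cotangent F M} {U : Set F} {S : F → (F →L[ℝ] W)}

theorem realDiff_chartSymmDiff {y₀ y : M} (h : y ∈ (extChartAt 𝓘(ℝ, F) y₀).source) (v : F) :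
    realDiff F E f y (chartSymmDiff F y₀ (extChartAt 𝓘(ℝ, F) y₀ y) v) =
      coordDiff F E f y₀ (extChartAt 𝓘(ℝ, F) y₀ y) v := by
  rw [coordDiff, (extChartAt 𝓘(ℝ, F) y₀).left_inv h]
  rfl

variable [IsManifold 𝓘(ℝ, F) ∞ M]

theorem extChartAt_cotangent_snd_apply {ξ : Cotangent F M}
    (h : ξ.1 ∈ (extChartAt 𝓘(ℝ, F) ξ₀.1).source) (v : F) :
    (extChartAt (cotangentModel F) ξ₀ ξ).2 v =
      (ξ.2 : F →L[ℝ] ℝ) (chartSymmDiff F ξ₀.1 (extChartAt 𝓘(ℝ, F) ξ₀.1 ξ.1) v) := by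
  rw [extChartAt_cotangent_apply ξ₀ ξ h]
  rfl

theorem IsCoframe.realDiff_mem_holTangent_iff {y₀ y : M} (hS : IsCoframe F E f y₀ U S)
    (h : y ∈ (extChartAt 𝓘(ℝ, F) y₀).source) (hU : extChartAt 𝓘(ℝ, F) y₀ y ∈ U) (v : F) :
    realDiff F E f y (chartSymmDiff F y₀ (extChartAt 𝓘(ℝ, F) y₀ y) v) ∈ holTangent F E f y ↔
      S (extChartAt 𝓘(ℝ, F) y₀ y) v = 0 := by
  rw [hS.apply_eq_zero_iff _ hU]
  constructor
  · rintro ⟨-, w, hw⟩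
    obtain ⟨w, rfl⟩ := (bijective_chartSymmDiff (hS.subset hU)).surjective w
    rw [realDiff_chartSymmDiff h, realDiff_chartSymmDiff h] at hw
    exact ⟨w, hw.symm⟩
  · rintro ⟨w, hw⟩
    refine ⟨⟨_, rfl⟩, chartSymmDiff F y₀ (extChartAt 𝓘(ℝ, F) y₀ y) w, ?_⟩
    rw [realDiff_chartSymmDiff h, realDiff_chartSymmDiff h, hw]

theorem IsCoframe.mem_charBundle_iff (hS : IsCoframe F E f ξ₀.1 U S) {ξ : Cotangent F M}
    (h : ξ.1 ∈ (extChartAt 𝓘(ℝ, F) ξ₀.1).source) (hU : extChartAt 𝓘(ℝ, F) ξ₀.1 ξ.1 ∈ U) :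
    ξ ∈ charBundle F E f ↔ ∀ v, S (extChartAt 𝓘(ℝ, F) ξ₀.1 ξ.1) v = 0 →
      (extChartAt (cotangentModel F) ξ₀ ξ).2 v = 0 := by
  constructor
  · intro hξ v hv
    rw [extChartAt_cotangent_snd_apply h]
    exact hξ _ ((hS.realDiff_mem_holTangent_iff h hU v).2 hv)
  · intro hξ v hv
    obtain ⟨v, rfl⟩ := (bijective_chartSymmDiff (hS.subset hU)).surjective v
    have h1 := hξ v ((hS.realDiff_mem_holTangent_iff h hU v).1 hv)
    rw [extChartAt_cotangent_snd_apply h] at h1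
    exact h1

/-- In canonical coordinates the parametrisation is `q = x`, `p = c ∘ S(x)`, and `ϑ = p dq`. -/
theorem IsCoframe.tautInChart_eq {K : Type*} [NormedAddCommGroup K] [NormedSpace ℝ K]
    {e : OpenPartialHomeomorph (Cotangent F M) ((F × (W →L[ℝ] ℝ)) × K)}
    (he : IsAdaptedChart (cotangentModel F) (charBundle F E f) e) {U' : Set F} (hU' : IsOpen U')
    (htgt : e.target = (U' ×ˢ univ) ×ˢ univ)
    (hsrc : e.source ⊆ TotalSpace.proj ⁻¹' (extChartAt 𝓘(ℝ, F) ξ₀.1).source)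
    (hes : ∀ a : F × (W →L[ℝ] ℝ), a.1 ∈ U' →
      extChartAt (cotangentModel F) ξ₀ (e.symm (a, 0)) = (a.1, a.2.comp (S a.1)))
    {a : F × (W →L[ℝ] ℝ)} (ha : a.1 ∈ U') :
    tautInChart e a = coframeForm S a := by
  have hat : (a, (0 : K)) ∈ e.target := by
    rw [htgt]
    exact ⟨⟨ha, trivial⟩, trivial⟩
  refine ContinuousLinearMap.ext fun u => ?_
  refine (tautological_mfderiv ξ₀ ((he.contMDiffAt_param hat).mdifferentiableAt (by simp))
    (hsrc (e.map_target hat)) u).trans ?_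
  have h1 : (fun b : F × (W →L[ℝ] ℝ) =>
      (extChartAt (cotangentModel F) ξ₀ (e.symm (b, (0 : K)))).1) =ᶠ[𝓝 a] Prod.fst := by
    filter_upwards [(hU'.preimage continuous_fst).mem_nhds ha] with b hb
    rw [hes b hb]
  rw [h1.fderiv_eq, fderiv_fst, hes a ha]
  rfl

variable [FiniteDimensional ℝ W]

/-- A coframe of the characteristic bundle yields an adapted chart of the cotangent bundle. -/
theorem IsCoframe.exists_isAdaptedChart [FiniteDimensional ℝ F] (hS : IsCoframe F E f ξ₀.1 U S)
    (h₀ : extChartAt 𝓘(ℝ, F) ξ₀.1 ξ₀.1 ∈ U) :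
    ∃ (m : ℕ) (e : OpenPartialHomeomorph (Cotangent F M) ((F × (W →L[ℝ] ℝ)) × (RModel m →L[ℝ] ℝ)))
      (U' : Set F), IsOpen U' ∧ U' ⊆ U ∧ ξ₀ ∈ e.source ∧
      IsAdaptedChart (cotangentModel F) (charBundle F E f) e ∧
      e.source = {ξ | ξ.1 ∈ (extChartAt 𝓘(ℝ, F) ξ₀.1).source ∧
        extChartAt 𝓘(ℝ, F) ξ₀.1 ξ.1 ∈ U'} ∧
      e.target = (U' ×ˢ univ) ×ˢ univ ∧
      ∀ a, a.1 ∈ U' → extChartAt (cotangentModel F) ξ₀ (e.symm (a, 0)) =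
        (a.1, a.2.comp (S a.1)) := by
  obtain ⟨m, e₁, U', hU', h₀', hUU, hsrc, htgt, he, hes, hfst, hsymm, hzero⟩ :=
    exists_conormal_chart hS.isOpen hS.contDiffOn h₀ (hS.surjective _ h₀)
  let e₀ : OpenPartialHomeomorph (Cotangent F M) (F × (F →L[ℝ] ℝ)) :=
    chartAt (ModelProd F (F →L[ℝ] ℝ)) ξ₀
  have hcoe : ∀ ξ, extChartAt (cotangentModel F) ξ₀ ξ = e₀ ξ := fun ξ => rfl
  have he₀s : e₀.source = TotalSpace.proj ⁻¹' (extChartAt 𝓘(ℝ, F) ξ₀.1).source := by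
    rw [← extChartAt_cotangent_source, extChartAt_source]
  have he₀t : ∀ z ∈ (extChartAt (cotangentModel F) ξ₀).target, z ∈ e₀.target := by
    intro z hz
    have h1 := (extChartAt (cotangentModel F) ξ₀).map_target hz
    rw [extChartAt_source] at h1
    have h2 := e₀.map_source h1
    rw [← hcoe, (extChartAt (cotangentModel F) ξ₀).right_inv hz] at h2
    exact h2
  have hfst₀ : ∀ ξ ∈ e₀.source, (e₀ ξ).1 = extChartAt 𝓘(ℝ, F) ξ₀.1 ξ.1 := by
    intro ξ hξ
    rw [he₀s] at hξ
    rw [← hcoe, extChartAt_cotangent_apply ξ₀ ξ hξ]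
  -- Canonical coordinates of the cotangent bundle, followed by the splitting of covectors by the
  -- coframe.
  let e := e₀.trans e₁
  have hsrc' : e.source = {ξ | ξ.1 ∈ (extChartAt 𝓘(ℝ, F) ξ₀.1).source ∧
        extChartAt 𝓘(ℝ, F) ξ₀.1 ξ.1 ∈ U'} := by
    ext ξ
    rw [OpenPartialHomeomorph.trans_source, hsrc]
    constructor
    · rintro ⟨h1, h2, -⟩
      have h3 := hfst₀ ξ h1
      rw [he₀s] at h1
      exact ⟨h1, h3 ▸ h2⟩
    · rintro ⟨h1, h2⟩
      have h3 : ξ ∈ e₀.source := by rw [he₀s]; exact h1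
      exact ⟨h3, by rw [hfst₀ ξ h3]; exact h2, trivial⟩
  have hmem : ∀ q ∈ e₁.target, e₁.symm q ∈ (extChartAt (cotangentModel F) ξ₀).target := by
    intro q hq
    have h1 := e₁.map_target hq
    rw [hsrc] at h1
    rw [extChartAt_cotangent_target]
    exact ⟨hS.subset (hUU h1.1), trivial⟩
  have hmem₀ : ∀ q ∈ e₁.target, e₁.symm q ∈ e₀.target := fun q hq => he₀t _ (hmem q hq)
  have htgt' : e.target = (U' ×ˢ univ) ×ˢ univ := by
    rw [OpenPartialHomeomorph.trans_target, htgt]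
    refine inter_eq_left.2 fun q hq => hmem₀ q ?_
    rw [htgt]
    exact hq
  refine ⟨m, e, U', hU', hUU, ?_, ⟨fun ξ hξ => ?_, fun q hq => ?_, fun ξ hξ => ?_⟩, hsrc', htgt',
    fun a ha => ?_⟩
  · rw [hsrc']
    exact ⟨mem_extChartAt_source _, h₀'⟩
  · rw [OpenPartialHomeomorph.trans_source] at hξ
    have h1 : ContMDiffAt (cotangentModel F) 𝓘(ℝ, F × (F →L[ℝ] ℝ)) ∞ e₀ ξ :=
      contMDiffAt_extChartAt' hξ.1
    have h2 : ContMDiffAt 𝓘(ℝ, F × (F →L[ℝ] ℝ)) 𝓘(ℝ, (F × (W →L[ℝ] ℝ)) × (RModel m →L[ℝ] ℝ)) ∞ e₁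
      (e₀ ξ) := (he.contDiffAt (e₁.open_source.mem_nhds hξ.2)).contMDiffAt
    exact (h2.comp ξ h1).contMDiffWithinAt
  · have hq' : q ∈ e₁.target := by
      rw [OpenPartialHomeomorph.trans_target] at hq
      exact hq.1
    have h2 : ContMDiffAt 𝓘(ℝ, (F × (W →L[ℝ] ℝ)) × (RModel m →L[ℝ] ℝ)) 𝓘(ℝ, F × (F →L[ℝ] ℝ)) ∞ e₁.symm
      q := (hes.contDiffAt (e₁.open_target.mem_nhds hq')).contMDiffAt
    have h1 : ContMDiffAt 𝓘(ℝ, F × (F →L[ℝ] ℝ)) (cotangentModel F) ∞ e₀.symm (e₁.symm q) := by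
      have h3 := contMDiffOn_extChartAt_symm (I := cotangentModel F) (n := ∞) ξ₀
      refine h3.contMDiffAt ((isOpen_extChartAt_target ξ₀).mem_nhds (hmem q hq'))
    exact (h1.comp q h2).contMDiffWithinAt
  · have h1 := hξ
    rw [hsrc'] at h1
    rw [OpenPartialHomeomorph.trans_source] at hξ
    rw [hS.mem_charBundle_iff h1.1 (hUU h1.2)]
    have h2 := hzero (e₀ ξ) hξ.2
    rw [hfst₀ ξ hξ.1] at h2
    exact h2.symm
  · have hq : ((a, 0) : (F × (W →L[ℝ] ℝ)) × (RModel m →L[ℝ] ℝ)) ∈ e₁.target := by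
      rw [htgt]
      exact ⟨⟨ha, trivial⟩, trivial⟩
    rw [hcoe, ← hsymm]
    exact e₀.right_inv (hmem₀ _ hq)

end CharBundle

/-! ### The Levi form in coordinates -/

section Levi

/-- In the Leibniz rule the term with `dc` contains `S v` or `S w` as a factor and vanishes on `ker
S`. -/
theorem flatExtDeriv_of_eventuallyEq_comp {F W : Type*} [NormedAddCommGroup F] [NormedSpace ℝ F]
    [NormedAddCommGroup W] [NormedSpace ℝ W] {S : F → (F →L[ℝ] W)} {x : F}
    (hS : DifferentiableAt ℝ S x) {s : F → (F →L[ℝ] ℝ)} {c : F → (W →L[ℝ] ℝ)}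
    (hc : DifferentiableAt ℝ c x) (h : s =ᶠ[𝓝 x] fun y => (c y).comp (S y)) {v w : F}
    (hv : S x v = 0) (hw : S x w = 0) :
    flatExtDeriv s x v w = c x (fderiv ℝ S x v w - fderiv ℝ S x w v) := by
  have h1 : HasFDerivAt (fun y => (c y).comp (S y)) _ x :=
    hc.hasFDerivAt.clm_comp hS.hasFDerivAt
  rw [flatExtDeriv_apply, h.fderiv_eq, h1.fderiv]
  simp [hv, hw]

variable {F E W : Type*} {M Z : Type*} [NormedAddCommGroup F] [NormedSpace ℝ F]
  [NormedAddCommGroup E] [NormedSpace ℂ E] [NormedAddCommGroup W] [NormedSpace ℝ W]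
  [TopologicalSpace M] [ChartedSpace F M] [TopologicalSpace Z] [ChartedSpace E Z]
  [IsManifold 𝓘(ℝ, F) ∞ M]
  {f : M → Z} {ξ₀ ξ : Cotangent F M} {U : Set F} {S : F → (F →L[ℝ] W)}
  {σ : ∀ y : M, TangentSpace 𝓘(ℝ, F) y →L[ℝ] ℝ}

theorem IsCharExtension.contDiffAt_oneFormInChart (hσ : IsCharExtension F E f ξ σ)
    (h : ξ.1 ∈ (extChartAt 𝓘(ℝ, F) ξ₀.1).source) :
    ContDiffAt ℝ ∞ (oneFormInChart 𝓘(ℝ, F) σ ξ₀.1) (extChartAt 𝓘(ℝ, F) ξ₀.1 ξ.1) := by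
  obtain ⟨-, V, hV, hξV, hσV, -⟩ := hσ
  set κ := extChartAt 𝓘(ℝ, F) ξ₀.1 with hκ
  have ht : κ ξ.1 ∈ κ.target := κ.map_source h
  have h1 : ContMDiffAt 𝓘(ℝ, F) 𝓘(ℝ, F) ∞ κ.symm (κ ξ.1) :=
    (contMDiffOn_extChartAt_symm ξ₀.1).contMDiffAt ((isOpen_extChartAt_target ξ₀.1).mem_nhds ht)
  have e1 : κ.symm (κ ξ.1) = ξ.1 := κ.left_inv h
  have h2 : ContMDiffAt 𝓘(ℝ, F) (cotangentModel F) ∞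
      (fun y => (⟨y, σ y⟩ : Cotangent F M)) (κ.symm (κ ξ.1)) := by
    rw [e1]
    exact hσV.contMDiffAt (hV.mem_nhds hξV)
  have h3 : ContMDiffAt (cotangentModel F) 𝓘(ℝ, F × (F →L[ℝ] ℝ)) ∞
      (extChartAt (cotangentModel F) ξ₀)
      (⟨κ.symm (κ ξ.1), σ (κ.symm (κ ξ.1))⟩ : Cotangent F M) := by
    refine contMDiffAt_extChartAt' ?_
    rw [← extChartAt_source (I := cotangentModel F), extChartAt_cotangent_source]
    exact κ.map_target ht
  have h4 : ContMDiffAt 𝓘(ℝ, F) 𝓘(ℝ, F × (F →L[ℝ] ℝ)) ∞ (fun x =>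
      extChartAt (cotangentModel F) ξ₀ (⟨κ.symm x, σ (κ.symm x)⟩ : Cotangent F M)) (κ ξ.1) :=
    h3.comp (κ ξ.1) (h2.comp (κ ξ.1) h1)
  have h5 := (contMDiffAt_iff_contDiffAt.1 h4).snd
  refine h5.congr_of_eventuallyEq ?_
  filter_upwards [(isOpen_extChartAt_target (I := 𝓘(ℝ, F)) ξ₀.1).mem_nhds ht] with x hx
  exact oneFormInChart_eq_extChartAt_cotangent ξ₀ σ hx

variable [FiniteDimensional ℝ W]

theorem IsCoframe.exists_covector (hS : IsCoframe F E f ξ₀.1 U S)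
    (h : ξ.1 ∈ (extChartAt 𝓘(ℝ, F) ξ₀.1).source) (hU : extChartAt 𝓘(ℝ, F) ξ₀.1 ξ.1 ∈ U)
    (hξ : ξ ∈ charBundle F E f) :
    ∃ c : W →L[ℝ] ℝ, (extChartAt (cotangentModel F) ξ₀ ξ).2 =
      c.comp (S (extChartAt 𝓘(ℝ, F) ξ₀.1 ξ.1)) := by
  obtain ⟨R, hR⟩ := exists_continuous_rightInverse (hS.surjective _ hU)
  refine ⟨(extChartAt (cotangentModel F) ξ₀ ξ).2.comp R, ContinuousLinearMap.ext fun v => ?_⟩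
  have h1 := (hS.mem_charBundle_iff h hU).1 hξ
    (v - R (S (extChartAt 𝓘(ℝ, F) ξ₀.1 ξ.1) v)) (by rw [map_sub, hR, sub_self])
  rw [map_sub, sub_eq_zero] at h1
  exact h1

/-- Any extension is near the point `c̃ ∘ S` with a differentiable coefficient `c̃`, and only the
value of `c̃` at the point matters on `ker S`. So the Levi form does not depend on the extension
chosen. -/
theorem IsCoframe.flatExtDeriv_oneFormInChart [FiniteDimensional ℝ F]
    (hS : IsCoframe F E f ξ₀.1 U S)
    (h : ξ.1 ∈ (extChartAt 𝓘(ℝ, F) ξ₀.1).source) (hU : extChartAt 𝓘(ℝ, F) ξ₀.1 ξ.1 ∈ U)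
    {c : W →L[ℝ] ℝ} (hc : (extChartAt (cotangentModel F) ξ₀ ξ).2 =
      c.comp (S (extChartAt 𝓘(ℝ, F) ξ₀.1 ξ.1)))
    (hσ : IsCharExtension F E f ξ σ) {v w : F} (hv : S (extChartAt 𝓘(ℝ, F) ξ₀.1 ξ.1) v = 0)
    (hw : S (extChartAt 𝓘(ℝ, F) ξ₀.1 ξ.1) w = 0) :
    flatExtDeriv (oneFormInChart 𝓘(ℝ, F) σ ξ₀.1) (extChartAt 𝓘(ℝ, F) ξ₀.1 ξ.1) v w =
      c (fderiv ℝ S (extChartAt 𝓘(ℝ, F) ξ₀.1 ξ.1) v w -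
        fderiv ℝ S (extChartAt 𝓘(ℝ, F) ξ₀.1 ξ.1) w v) := by
  have hs := hσ.contDiffAt_oneFormInChart h
  obtain ⟨hσξ, V, hV, hξV, hσV, hσc⟩ := hσ
  set κ := extChartAt 𝓘(ℝ, F) ξ₀.1 with hκ
  have ht : κ ξ.1 ∈ κ.target := κ.map_source h
  obtain ⟨m, ι, pr, Q, U', hU', hx', hUU, hQ, -, hSQ, -, -⟩ :=
    exists_splitting hS.isOpen hS.contDiffOn hU (hS.surjective _ hU)
  set s := oneFormInChart 𝓘(ℝ, F) σ ξ₀.1 with hsdef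
  have hsc : ContinuousAt κ.symm (κ ξ.1) := continuousAt_extChartAt_symm'' ht
  have e1 : κ.symm (κ ξ.1) = ξ.1 := κ.left_inv h
  have hev : ∀ᶠ x in 𝓝 (κ ξ.1), κ.symm x ∈ V :=
    hsc.eventually (hV.mem_nhds (by rw [e1]; exact hξV))
  have h1 : s =ᶠ[𝓝 (κ ξ.1)] fun y => ((s y).comp (Q y)).comp (S y) := by
    filter_upwards [hev, hU'.mem_nhds hx'] with x hxV hxU
    have hxt : x ∈ κ.target := hS.subset (hUU hxU)
    have h2 := hσc _ hxV
    have e2 : κ (κ.symm x) = x := κ.right_inv hxt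
    have h3 := (hS.mem_charBundle_iff (ξ := ⟨κ.symm x, σ (κ.symm x)⟩) (κ.map_target hxt)
      (by rw [← hκ, e2]; exact hUU hxU)).1 h2
    rw [← oneFormInChart_eq_extChartAt_cotangent ξ₀ σ hxt, ← hκ, e2] at h3
    refine ContinuousLinearMap.ext fun u => ?_
    have h4 := h3 (u - Q x (S x u)) (by rw [map_sub, hSQ x hxU, sub_self])
    rw [map_sub, sub_eq_zero] at h4
    exact h4
  have h5 : DifferentiableAt ℝ (fun y => (s y).comp (Q y)) (κ ξ.1) :=
    (hs.differentiableAt (by simp)).clm_comp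
      ((hQ.contDiffAt (hU'.mem_nhds hx')).differentiableAt (by simp))
  rw [flatExtDeriv_of_eventuallyEq_comp
    ((hS.contDiffOn.contDiffAt (hS.isOpen.mem_nhds hU)).differentiableAt (by simp)) h5 h1 hv hw]
  have h6 : s (κ ξ.1) = c.comp (S (κ ξ.1)) := by
    rw [hsdef, oneFormInChart_eq_extChartAt_cotangent ξ₀ σ ht, ← hκ, ← hc]
    have h7 : (⟨κ.symm (κ ξ.1), σ (κ.symm (κ ξ.1))⟩ : Cotangent F M) = ξ := by
      rw [e1, hσξ]
    rw [h7]
  change s (κ ξ.1) (Q (κ ξ.1) _) = _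
  rw [h6]
  change c (S (κ ξ.1) (Q (κ ξ.1) _)) = _
  rw [hSQ _ hx']

/-- The section with constant coefficients in the coframe. Its existence guarantees that
`charExtension` is a genuine extension. -/
theorem IsCoframe.exists_isCharExtension (hS : IsCoframe F E f ξ₀.1 U S)
    (h : ξ.1 ∈ (extChartAt 𝓘(ℝ, F) ξ₀.1).source) (hU : extChartAt 𝓘(ℝ, F) ξ₀.1 ξ.1 ∈ U)
    (hξ : ξ ∈ charBundle F E f) : ∃ σ, IsCharExtension F E f ξ σ := by
  have h2 : IsManifold 𝓘(ℝ, F) 1 M := IsManifold.of_le (n := ∞) (by simp)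
  obtain ⟨c, hc⟩ := hS.exists_covector h hU hξ
  let κ := extChartAt 𝓘(ℝ, F) ξ₀.1
  let σ : ∀ y : M, TangentSpace 𝓘(ℝ, F) y →L[ℝ] ℝ := fun y =>
    (c.comp (S (κ y))).comp (mfderiv 𝓘(ℝ, F) 𝓘(ℝ, F) κ y : F →L[ℝ] F)
  have hinv : ∀ y ∈ κ.source, ∀ v : F,
      (mfderiv 𝓘(ℝ, F) 𝓘(ℝ, F) κ y : F →L[ℝ] F) (chartSymmDiff F ξ₀.1 (κ y) v) = v := by
    intro y hy v
    have h3 := mfderiv_extChartAt_comp_mfderivWithin_extChartAt_symm' (I := 𝓘(ℝ, F)) hy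
    simp only [modelWithCornersSelf_coe, range_id, mfderivWithin_univ] at h3
    exact DFunLike.congr_fun h3 v
  have hE : ∀ y ∈ κ.source, extChartAt (cotangentModel F) ξ₀ (⟨y, σ y⟩ : Cotangent F M) =
      (κ y, c.comp (S (κ y))) := by
    intro y hy
    refine Prod.ext ?_ (ContinuousLinearMap.ext fun v => ?_)
    · rw [extChartAt_cotangent_apply ξ₀ _ hy]
    · refine (extChartAt_cotangent_snd_apply (ξ := ⟨y, σ y⟩) hy v).trans ?_
      exact congrArg (fun q : F => c (S (κ y) q)) (hinv y hy v)
  refine ⟨σ, ?_, κ.source ∩ κ ⁻¹' U, (continuousOn_extChartAt ξ₀.1).isOpen_inter_preimage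
    (isOpen_extChartAt_source ξ₀.1) hS.isOpen, ⟨h, hU⟩, fun y hy => ?_, fun y hy => ?_⟩
  · refine ContinuousLinearMap.ext fun v => ?_
    obtain ⟨v, rfl⟩ := (bijective_chartSymmDiff (κ.map_source h)).surjective v
    refine Eq.trans ?_ (extChartAt_cotangent_snd_apply h v)
    rw [hc]
    exact congrArg (fun q : F => c (S (κ ξ.1) q)) (hinv _ h v)
  · have h3 : ContMDiffAt 𝓘(ℝ, F) 𝓘(ℝ, F) ∞ κ y := contMDiffAt_extChartAt' (by simpa [κ] using hy.1)
    have h4 : ContDiffAt ℝ ∞ (fun x => (x, c.comp (S x))) (κ y) :=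
      contDiffAt_id.prodMk (contDiffAt_const.clm_comp
        (hS.contDiffOn.contDiffAt (hS.isOpen.mem_nhds hy.2)))
    have h5 : ContMDiffAt 𝓘(ℝ, F × (F →L[ℝ] ℝ)) (cotangentModel F) ∞
        (extChartAt (cotangentModel F) ξ₀).symm (κ y, c.comp (S (κ y))) := by
      refine (contMDiffOn_extChartAt_symm ξ₀).contMDiffAt
        ((isOpen_extChartAt_target ξ₀).mem_nhds ?_)
      rw [extChartAt_cotangent_target]
      exact ⟨κ.map_source hy.1, trivial⟩
    have h6 : ContMDiffAt 𝓘(ℝ, F) (cotangentModel F) ∞ (fun y =>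
        (extChartAt (cotangentModel F) ξ₀).symm (κ y, c.comp (S (κ y)))) y :=
      h5.comp y (h4.contMDiffAt.comp y h3)
    refine (h6.congr_of_eventuallyEq ?_).contMDiffWithinAt
    filter_upwards [(isOpen_extChartAt_source (I := 𝓘(ℝ, F)) ξ₀.1).mem_nhds hy.1] with y' hy'
    rw [← hE y' hy', (extChartAt (cotangentModel F) ξ₀).left_inv]
    rw [extChartAt_cotangent_source]
    exact hy'
  · refine (hS.mem_charBundle_iff (ξ := ⟨y, σ y⟩) hy.1 hy.2).2 fun v hv => ?_
    rw [hE y hy.1]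
    change c (S (κ y) v) = 0
    have hv' : S (κ y) v = 0 := hv
    rw [hv', map_zero]

end Levi

/-! ### The rank of the Levi form -/

section LeviRank

variable {F E W : Type*} {M Z : Type*} [NormedAddCommGroup F] [NormedSpace ℝ F]
  [NormedAddCommGroup E] [NormedSpace ℂ E] [NormedAddCommGroup W] [NormedSpace ℝ W]
  [TopologicalSpace M] [ChartedSpace F M] [TopologicalSpace Z] [ChartedSpace E Z]
  {f : M → Z}

/-- The dimension formula for the real subspaces `TM` and `i TM`: they span everything by genericity
and meet in `HM`. -/
theorem finrank_holTangent [FiniteDimensional ℝ F] [FiniteDimensional ℝ E]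
    (hgen : ∀ (x : M) (u : E), ∃ v w : F,
      u = realDiff F E f x v + Complex.I • realDiff F E f x w) {x : M}
    (hinj : Function.Injective (realDiff F E f x)) :
    2 * Module.finrank ℂ (holTangent F E f x) + Module.finrank ℝ E = 2 * Module.finrank ℝ F := by
  let D : F →ₗ[ℝ] E := realDiff F E f x
  let J : E →ₗ[ℝ] E := mulI E
  have hJinj : Function.Injective J := fun u v huv => by
    have h1 : Complex.I • u = Complex.I • v := huv
    exact smul_right_injective E Complex.I_ne_zero h1
  have h1 : Module.finrank ℝ (LinearMap.range D) = Module.finrank ℝ F :=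
    LinearMap.finrank_range_of_inj hinj
  have h2 : Module.finrank ℝ (LinearMap.range (J ∘ₗ D)) = Module.finrank ℝ F :=
    LinearMap.finrank_range_of_inj (hJinj.comp hinj)
  have h3 : LinearMap.range D ⊔ LinearMap.range (J ∘ₗ D) = ⊤ := by
    refine eq_top_iff.2 fun u _ => ?_
    obtain ⟨v, w, hu⟩ := hgen x u
    exact Submodule.mem_sup.2 ⟨_, ⟨v, rfl⟩, _, ⟨w, rfl⟩, hu.symm⟩
  have h4 := Submodule.finrank_sup_add_finrank_inf_eq (LinearMap.range D)
    (LinearMap.range (J ∘ₗ D))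
  have h5 : LinearMap.range D ⊓ LinearMap.range (J ∘ₗ D) =
      (holTangent F E f x).restrictScalars ℝ := by
    ext u
    constructor
    · rintro ⟨⟨v, hv⟩, w, hw⟩
      refine ⟨⟨v, hv⟩, -w, ?_⟩
      have hw' : Complex.I • realDiff F E f x w = u := hw
      rw [← hw', I_smul_I_smul, map_neg]
    · rintro ⟨⟨v, hv⟩, w, hw⟩
      refine ⟨⟨v, hv⟩, -w, ?_⟩
      change Complex.I • realDiff F E f x (-w) = u
      rw [map_neg, hw, smul_neg, I_smul_I_smul, neg_neg]
  have h6 : Module.finrank ℝ ((holTangent F E f x).restrictScalars ℝ) =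
      2 * Module.finrank ℂ (holTangent F E f x) := finrank_real_of_complex (holTangent F E f x)
  rw [h3, h5, h6, h1, h2, finrank_top] at h4
  omega

variable [IsManifold 𝓘(ℝ, F) ∞ M] {ξ₀ ξ : Cotangent F M} {U : Set F} {S : F → (F →L[ℝ] W)}
  [FiniteDimensional ℝ F] [FiniteDimensional ℝ W]

/-- The Levi form is defined in the preferred chart at `ξ.1`, the coframe in that at `ξ₀.1`;
naturality of `d` under the inverse chart connects them. -/
theorem IsCoframe.dExt_charExtension (hS : IsCoframe F E f ξ₀.1 U S)
    (hinj : Function.Injective (realDiff F E f ξ.1))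
    (h : ξ.1 ∈ (extChartAt 𝓘(ℝ, F) ξ₀.1).source) (hU : extChartAt 𝓘(ℝ, F) ξ₀.1 ξ.1 ∈ U)
    (hξ : ξ ∈ charBundle F E f) {c : W →L[ℝ] ℝ} (hc : (extChartAt (cotangentModel F) ξ₀ ξ).2 =
      c.comp (S (extChartAt 𝓘(ℝ, F) ξ₀.1 ξ.1))) {v w : F}
    (hv : S (extChartAt 𝓘(ℝ, F) ξ₀.1 ξ.1) v = 0)
    (hw : S (extChartAt 𝓘(ℝ, F) ξ₀.1 ξ.1) w = 0) :
    dExt F E f (charExtension F E f ξ) ξ.1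
        (coordDiff F E f ξ₀.1 (extChartAt 𝓘(ℝ, F) ξ₀.1 ξ.1) v)
        (coordDiff F E f ξ₀.1 (extChartAt 𝓘(ℝ, F) ξ₀.1 ξ.1) w) =
      c (fderiv ℝ S (extChartAt 𝓘(ℝ, F) ξ₀.1 ξ.1) v w -
        fderiv ℝ S (extChartAt 𝓘(ℝ, F) ξ₀.1 ξ.1) w v) := by
  have hσ : IsCharExtension F E f ξ (charExtension F E f ξ) :=
    Classical.epsilon_spec (hS.exists_isCharExtension h hU hξ)
  rw [← hS.flatExtDeriv_oneFormInChart h hU hc hσ hv hw, ← realDiff_chartSymmDiff h,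
    ← realDiff_chartSymmDiff h]
  have hker : LinearMap.ker (realDiff F E f ξ.1).toLinearMap = ⊥ := LinearMap.ker_eq_bot.2 hinj
  have hleft : ∀ v, (realDiff F E f ξ.1).toLinearMap.leftInverse (realDiff F E f ξ.1 v) = v :=
    fun v => LinearMap.leftInverse_apply_of_inj hker v
  rw [dExt, hleft, hleft]
  have ht := (extChartAt 𝓘(ℝ, F) ξ₀.1).map_source h
  have hψ : ∀ᶠ b in 𝓝 (extChartAt 𝓘(ℝ, F) ξ₀.1 ξ.1),
      ContMDiffAt 𝓘(ℝ, F) 𝓘(ℝ, F) ∞ (extChartAt 𝓘(ℝ, F) ξ₀.1).symm b := by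
    filter_upwards [(isOpen_extChartAt_target (I := 𝓘(ℝ, F)) ξ₀.1).mem_nhds ht] with b hb
    exact (contMDiffOn_extChartAt_symm ξ₀.1).contMDiffAt
      ((isOpen_extChartAt_target ξ₀.1).mem_nhds hb)
  have e1 : (extChartAt 𝓘(ℝ, F) ξ₀.1).symm (extChartAt 𝓘(ℝ, F) ξ₀.1 ξ.1) = ξ.1 :=
    (extChartAt 𝓘(ℝ, F) ξ₀.1).left_inv h
  have hd : DifferentiableAt ℝ (oneFormInChart 𝓘(ℝ, F) (charExtension F E f ξ) ξ.1)
      (extChartAt 𝓘(ℝ, F) ξ.1 ξ.1) :=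
    (hσ.contDiffAt_oneFormInChart (ξ₀ := ξ) (mem_extChartAt_source _)).differentiableAt (by simp)
  have h1 := extDerivOneForm_mfderiv (charExtension F E f ξ) hψ (by rw [e1]; exact hd) v w
  have h2 : ∀ y, y = ξ.1 → ∀ a b : F,
      (extDerivOneForm 𝓘(ℝ, F) (charExtension F E f ξ) y : F →L[ℝ] F →L[ℝ] ℝ) a b =
      extDerivOneForm 𝓘(ℝ, F) (charExtension F E f ξ) ξ.1 a b := by
    rintro _ rfl a b
    rfl
  exact (h2 _ e1 _ _).symm.trans h1

/-- The imaginary part of `L(X, Y)` is `c(dS(w, v))`, so a kernel vector is null. Conversely, since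
`dS` is of type (1,1), the real part `c(dS(w, Jv))` equals `-c(dS(Jw, v))` and vanishes as well. -/
theorem IsCoframe.leviForm_eq_zero_iff (hS : IsCoframe F E f ξ₀.1 U S)
    (hinj : Function.Injective (realDiff F E f ξ.1))
    (h : ξ.1 ∈ (extChartAt 𝓘(ℝ, F) ξ₀.1).source) (hU : extChartAt 𝓘(ℝ, F) ξ₀.1 ξ.1 ∈ U)
    (hξ : ξ ∈ charBundle F E f) {c : W →L[ℝ] ℝ} (hc : (extChartAt (cotangentModel F) ξ₀ ξ).2 =
      c.comp (S (extChartAt 𝓘(ℝ, F) ξ₀.1 ξ.1))) {v : F} {X : holTangent F E f ξ.1}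
    (hX : (X : E) = coordDiff F E f ξ₀.1 (extChartAt 𝓘(ℝ, F) ξ₀.1 ξ.1) v) :
    leviForm F E f ξ X = 0 ↔ v ∈ coframeNull S (extChartAt 𝓘(ℝ, F) ξ₀.1 ξ.1, c) := by
  set x := extChartAt 𝓘(ℝ, F) ξ₀.1 ξ.1 with hx
  have hmem : ∀ u : F, coordDiff F E f ξ₀.1 x u ∈ holTangent F E f ξ.1 ↔ S x u = 0 := fun u => by
    rw [hx, ← realDiff_chartSymmDiff h]
    exact hS.realDiff_mem_holTangent_iff h hU u
  have hv : S x v = 0 := (hmem v).1 (hX ▸ X.2)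
  have hJ : ∀ u, S x u = 0 → ∃ u', S x u' = 0 ∧
      Complex.I • coordDiff F E f ξ₀.1 x u = coordDiff F E f ξ₀.1 x u' := by
    intro u hu
    obtain ⟨u', hu'⟩ := (hS.apply_eq_zero_iff x hU u).1 hu
    refine ⟨u', (hS.apply_eq_zero_iff x hU u').2 ⟨-u, ?_⟩, hu'⟩
    rw [← hu', I_smul_I_smul, map_neg]
  have hd : ∀ {a b : F}, S x a = 0 → S x b = 0 →
      dExt F E f (charExtension F E f ξ) ξ.1 (coordDiff F E f ξ₀.1 x a)
        (coordDiff F E f ξ₀.1 x b) = c (fderiv ℝ S x a b - fderiv ℝ S x b a) := fun ha hb =>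
    hS.dExt_charExtension hinj h hU hξ hc ha hb
  obtain ⟨v', hv', hvI⟩ := hJ v hv
  have hform : ∀ Y : holTangent F E f ξ.1, ∀ w, (Y : E) = coordDiff F E f ξ₀.1 x w →
      leviForm F E f ξ X Y = ((c (fderiv ℝ S x w v' - fderiv ℝ S x v' w) : ℝ) : ℂ) +
        Complex.I * ((c (fderiv ℝ S x w v - fderiv ℝ S x v w) : ℝ) : ℂ) := by
    intro Y w hY
    have hw : S x w = 0 := (hmem w).1 (hY ▸ Y.2)
    change ((dExt F E f (charExtension F E f ξ) ξ.proj (Y : E) (Complex.I • (X : E)) : ℝ) : ℂ) +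
      Complex.I * ((dExt F E f (charExtension F E f ξ) ξ.proj (Y : E) (X : E) : ℝ) : ℂ) = _
    rw [hX, hY, hvI, hd hw hv', hd hw hv]
  have hre : ∀ a b : ℝ, (a : ℂ) + Complex.I * (b : ℂ) = 0 ↔ a = 0 ∧ b = 0 := fun a b => by
    rw [Complex.ext_iff]
    simp
  rw [mem_coframeNull]
  constructor
  · intro h0
    refine ⟨hv, fun w hw => ?_⟩
    have h1 := hform ⟨_, (hmem w).2 hw⟩ w rfl
    rw [h0] at h1
    have h2 := ((hre _ _).1 h1.symm).2
    rw [← neg_sub, map_neg, h2, neg_zero]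
  · rintro ⟨-, hN⟩
    have hN' : ∀ w, S x w = 0 → c (fderiv ℝ S x w v - fderiv ℝ S x v w) = 0 := fun w hw => by
      rw [← neg_sub, map_neg, neg_eq_zero]
      exact hN w hw
    funext Y
    obtain ⟨w, hY⟩ : ∃ w, (Y : E) = coordDiff F E f ξ₀.1 x w := by
      obtain ⟨u, hu⟩ := Y.2.1
      obtain ⟨u, rfl⟩ := (bijective_chartSymmDiff (hS.subset hU)).surjective u
      exact ⟨u, hu.symm.trans (realDiff_chartSymmDiff h u)⟩
    have hw : S x w = 0 := (hmem w).1 (hY ▸ Y.2)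
    obtain ⟨w', hw', hwI⟩ := hJ w hw
    have h2 : Complex.I • coordDiff F E f ξ₀.1 x w' = coordDiff F E f ξ₀.1 x (-w) := by
      rw [← hwI, I_smul_I_smul, map_neg]
    -- The type (1,1) property for the pair `(w', v)` with `w' = Jw`: its image under `J` is `(-w,
    -- v')`.
    have h1 := hS.fderiv_eq x hU w' (-w) v v' h2 hvI
    have h3 : fderiv ℝ S x w v' - fderiv ℝ S x v' w =
        -(fderiv ℝ S x w' v - fderiv ℝ S x v w') := by
      rw [← h1]
      simp only [map_neg, _root_.neg_apply]
      abel
    rw [hform Y w hY, (hre _ _).2 ⟨?_, hN' w hw⟩]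
    · rfl
    · rw [h3, map_neg, hN' w' hw', neg_zero]

/-- Rank-nullity over `ℂ` on `H_x M`, with real dimensions twice the complex ones. For real
dimensions `2n + k` of `M` and `2n + 2k` of the ambient space it reads `2 rank + dim null = 2n`. -/
theorem IsCoframe.leviRank_add_finrank_coframeNull [FiniteDimensional ℝ E]
    (hS : IsCoframe F E f ξ₀.1 U S)
    (hgen : ∀ (x : M) (u : E), ∃ v w : F,
      u = realDiff F E f x v + Complex.I • realDiff F E f x w)
    (hinj : Function.Injective (realDiff F E f ξ.1))
    (h : ξ.1 ∈ (extChartAt 𝓘(ℝ, F) ξ₀.1).source) (hU : extChartAt 𝓘(ℝ, F) ξ₀.1 ξ.1 ∈ U)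
    (hξ : ξ ∈ charBundle F E f) {c : W →L[ℝ] ℝ} (hc : (extChartAt (cotangentModel F) ξ₀ ξ).2 =
      c.comp (S (extChartAt 𝓘(ℝ, F) ξ₀.1 ξ.1))) :
    2 * leviRank F E f ξ +
      Module.finrank ℝ (coframeNull S (extChartAt 𝓘(ℝ, F) ξ₀.1 ξ.1, c)) +
      Module.finrank ℝ E = 2 * Module.finrank ℝ F := by
  have hEc : FiniteDimensional ℂ E := FiniteDimensional.right ℝ ℂ E
  set x := extChartAt 𝓘(ℝ, F) ξ₀.1 ξ.1 with hx
  let D : F →ₗ[ℝ] E := coordDiff F E f ξ₀.1 x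
  have hDinj : Function.Injective D := by
    intro a b hab
    have h1 : coordDiff F E f ξ₀.1 x a = coordDiff F E f ξ₀.1 x b := hab
    rw [hx, ← realDiff_chartSymmDiff h, ← realDiff_chartSymmDiff h] at h1
    exact (bijective_chartSymmDiff (hS.subset hU)).injective (hinj h1)
  let K : Submodule ℂ E := (LinearMap.ker (leviForm F E f ξ)).map (holTangent F E f ξ.1).subtype
  have hK : (coframeNull S (x, c)).map D = K.restrictScalars ℝ := by
    ext u
    constructor
    · rintro ⟨v, hv, rfl⟩
      have h1 : D v ∈ holTangent F E f ξ.1 := by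
        change coordDiff F E f ξ₀.1 x v ∈ _
        rw [hx, ← realDiff_chartSymmDiff h]
        exact (hS.realDiff_mem_holTangent_iff h hU v).2 hv.1
      exact ⟨⟨D v, h1⟩, (hS.leviForm_eq_zero_iff hinj h hU hξ hc rfl).2 hv, rfl⟩
    · rintro ⟨X, hX, rfl⟩
      obtain ⟨u, hu⟩ := X.2.1
      obtain ⟨u, rfl⟩ := (bijective_chartSymmDiff (hS.subset hU)).surjective u
      have h1 : (X : E) = coordDiff F E f ξ₀.1 x u := hu.symm.trans (realDiff_chartSymmDiff h u)
      exact ⟨u, (hS.leviForm_eq_zero_iff hinj h hU hξ hc h1).1 hX, h1.symm⟩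
  have h1 : Module.finrank ℝ (coframeNull S (x, c)) = Module.finrank ℝ (K.restrictScalars ℝ) := by
    rw [← hK]
    exact (Submodule.equivMapOfInjective D hDinj _).finrank_eq
  have h2 : Module.finrank ℝ (K.restrictScalars ℝ) = 2 * Module.finrank ℂ K :=
    finrank_real_of_complex K
  have h3 : Module.finrank ℂ K = Module.finrank ℂ (LinearMap.ker (leviForm F E f ξ)) :=
    ((Submodule.equivMapOfInjective _ (Submodule.injective_subtype _) _).finrank_eq).symm
  have h4 := LinearMap.finrank_range_add_finrank_ker (leviForm F E f ξ)
  have h5 := finrank_holTangent hgen hinj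
  rw [leviRank]
  omega

end LeviRank

/-! ### Covectors of maximal Levi rank are regular -/

section Final

/-- The dimension of the kernel is upper semicontinuous. -/
theorem eventually_finrank_ker_le {X A V : Type*} [TopologicalSpace X] [NormedAddCommGroup A]
    [NormedSpace ℝ A] [FiniteDimensional ℝ A] [NormedAddCommGroup V] [NormedSpace ℝ V]
    {T : X → (A →L[ℝ] V)} {x₀ : X} (hT : ContinuousAt T x₀) :
    ∀ᶠ x in 𝓝 x₀, Module.finrank ℝ (LinearMap.ker (T x : A →ₗ[ℝ] V)) ≤
      Module.finrank ℝ (LinearMap.ker (T x₀ : A →ₗ[ℝ] V)) := by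
  obtain ⟨C, hC⟩ := (LinearMap.ker (T x₀ : A →ₗ[ℝ] V)).exists_isCompl
  have hinj : Function.Injective ((T x₀).comp C.subtypeL) := by
    rw [injective_iff_map_eq_zero]
    intro v hv
    exact Subtype.ext (Submodule.disjoint_def.1 hC.disjoint v hv v.2)
  have hcont : ContinuousAt (fun x => (T x).comp C.subtypeL) x₀ :=
    hT.clm_comp continuousAt_const
  -- Injectivity on a complement of the kernel at `x₀` is an open condition, and the nearby kernels
  -- then avoid that complement.
  filter_upwards [hcont.eventually (ContinuousLinearMap.isOpen_injective.mem_nhds hinj)] with x hx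
  have hdisj : Disjoint (LinearMap.ker (T x : A →ₗ[ℝ] V)) C := by
    rw [Submodule.disjoint_def]
    intro v hv hvC
    have h1 : (T x).comp C.subtypeL ⟨v, hvC⟩ = (T x).comp C.subtypeL 0 := by
      rw [map_zero]
      exact hv
    exact congrArg Subtype.val (hx h1)
  have h1 := Submodule.finrank_add_finrank_le_of_disjoint hdisj
  have h2 := Submodule.finrank_add_eq_of_isCompl hC
  omega

/-- For natural numbers, eventually `r < limsup + 1`, which is the claim. Boundedness is needed for
the limsup to be meaningful. -/
theorem eventually_le_limsup_of_le {X : Type*} {l : Filter X} {r : X → ℕ} {N : ℕ}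
    (hN : ∀ x, r x ≤ N) : ∀ᶠ x in l, r x ≤ limsup r l := by
  have h1 : IsBoundedUnder (· ≤ ·) l r := isBoundedUnder_of ⟨N, hN⟩
  have h2 := eventually_lt_of_limsup_lt (Nat.lt_succ_self (limsup r l)) h1
  filter_upwards [h2] with x hx using Nat.lt_succ_iff.1 hx

variable {F E W : Type*} {M Z : Type*} [NormedAddCommGroup F] [NormedSpace ℝ F]
  [NormedAddCommGroup E] [NormedSpace ℂ E] [NormedAddCommGroup W] [NormedSpace ℝ W]
  [TopologicalSpace M] [ChartedSpace F M] [TopologicalSpace Z] [ChartedSpace E Z]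
  [IsManifold 𝓘(ℝ, F) ∞ M]
  {f : M → Z} {ξ₀ ξ : Cotangent F M} {U : Set F} {S : F → (F →L[ℝ] W)}

theorem leviRank_le [FiniteDimensional ℂ E] (ξ : Cotangent F M) :
    leviRank F E f ξ ≤ Module.finrank ℂ E :=
  (LinearMap.finrank_range_le _).trans (Submodule.finrank_le _)

variable [FiniteDimensional ℝ F] [FiniteDimensional ℝ W]

/-- A characteristic covector at which the rank of the Levi form is maximal has a neighbourhood of
regular covectors, on which that rank is constant. -/
theorem IsCoframe.exists_isOpen_isRegularPoint [FiniteDimensional ℝ E]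
    (hS : IsCoframe F E f ξ₀.1 U S) (h₀ : extChartAt 𝓘(ℝ, F) ξ₀.1 ξ₀.1 ∈ U)
    (hgen : ∀ (x : M) (u : E), ∃ v w : F,
      u = realDiff F E f x v + Complex.I • realDiff F E f x w)
    (hinj : ∀ x : M, Function.Injective (realDiff F E f x))
    (hξ₀ : ξ₀ ∈ charBundleDot F E f)
    (hmax : leviRank F E f ξ₀ =
      limsup (fun ξ => leviRank F E f ξ) (𝓝[charBundleDot F E f] ξ₀)) :
    ∃ O : Set (Cotangent F M), IsOpen O ∧ ξ₀ ∈ O ∧ ∀ ξ ∈ O ∩ charBundleDot F E f,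
      IsRegularPoint F E f ξ ∧ leviRank F E f ξ = leviRank F E f ξ₀ := by
  have hEc : FiniteDimensional ℂ E := FiniteDimensional.right ℝ ℂ E
  obtain ⟨m, e, U', hU', hUU, hξ₀e, he, hsrc, htgt, hes⟩ := hS.exists_isAdaptedChart h₀
  have hmemt : ∀ a : F × (W →L[ℝ] ℝ), (a, (0 : RModel m →L[ℝ] ℝ)) ∈ e.target ↔ a.1 ∈ U' := by
    intro a
    rw [htgt]
    simp
  have hsrc₁ : ∀ ξ ∈ e.source, ξ.1 ∈ (extChartAt 𝓘(ℝ, F) ξ₀.1).source := by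
    intro ξ hξ
    rw [hsrc] at hξ
    exact hξ.1
  have hsrc₂ : ∀ ξ ∈ e.source, extChartAt 𝓘(ℝ, F) ξ₀.1 ξ.1 ∈ U' := by
    intro ξ hξ
    rw [hsrc] at hξ
    exact hξ.2
  have hbase : ∀ a : F × (W →L[ℝ] ℝ), a.1 ∈ U' →
      extChartAt 𝓘(ℝ, F) ξ₀.1 (e.symm (a, 0)).1 = a.1 := by
    intro a ha
    have h1 := hes a ha
    rw [extChartAt_cotangent_apply ξ₀ _ (hsrc₁ _ (e.map_target ((hmemt a).2 ha)))] at h1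
    exact congrArg Prod.fst h1
  have htaut : ∀ a : F × (W →L[ℝ] ℝ), a.1 ∈ U' → tautInChart e a = coframeForm S a :=
    fun a ha => IsCoframe.tautInChart_eq he hU' htgt hsrc₁ hes ha
  have hU'o : IsOpen (U' ×ˢ (univ : Set (W →L[ℝ] ℝ))) := hU'.prod isOpen_univ
  have hcf : ContDiffOn ℝ ∞ (coframeForm S) (U' ×ˢ univ) :=
    contDiffOn_coframeForm (hS.contDiffOn.mono hUU)
  have hSd : ∀ x ∈ U', DifferentiableAt ℝ S x := fun x hx =>
    (hS.contDiffOn.contDiffAt (hS.isOpen.mem_nhds (hUU hx))).differentiableAt (by simp)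
  have hflat : ∀ a : F × (W →L[ℝ] ℝ), a.1 ∈ U' →
      flatKer (tautInChart e) a = flatKer (coframeForm S) a := by
    intro a ha
    have h1 : tautInChart e =ᶠ[𝓝 a] coframeForm S := by
      filter_upwards [hU'o.mem_nhds ⟨ha, trivial⟩] with b hb using htaut b hb.1
    ext u
    rw [mem_flatKer, mem_flatKer, flatExtDeriv, flatExtDeriv, h1.fderiv_eq]
  have hform : ∀ a : F × (W →L[ℝ] ℝ), a.1 ∈ U' →
      2 * leviRank F E f (e.symm (a, 0)) + Module.finrank ℝ (flatKer (tautInChart e) a) +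
        Module.finrank ℝ E = 2 * Module.finrank ℝ F := by
    intro a ha
    have h1 := e.map_target ((hmemt a).2 ha)
    have h2 := hS.leviRank_add_finrank_coframeNull hgen (hinj _) (hsrc₁ _ h1)
      (hUU (hsrc₂ _ h1)) (he.param_mem ((hmemt a).2 ha)) (c := a.2)
      (by rw [hes a ha, hbase a ha])
    rw [hbase a ha] at h2
    rw [hflat a ha, finrank_flatKer_coframeForm (hSd _ ha) (hS.surjective _ (hUU ha))]
    exact h2
  have hparam : ∀ ξ ∈ e.source, ξ ∈ charBundle F E f →
      (e ξ).1.1 ∈ U' ∧ e.symm ((e ξ).1, 0) = ξ := by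
    intro ξ hξ hξc
    have h1 := e.map_source hξ
    rw [htgt] at h1
    exact ⟨h1.1.1, he.param_fst hξ hξc⟩
  obtain ⟨ha₀, hξ₀a⟩ := hparam ξ₀ hξ₀e hξ₀.1
  have hsemi : ∀ᶠ a in 𝓝 (e ξ₀).1, Module.finrank ℝ (flatKer (coframeForm S) a) ≤
      Module.finrank ℝ (flatKer (coframeForm S) (e ξ₀).1) :=
    eventually_finrank_ker_le
      ((contDiffOn_flatExtDeriv hU'o hcf).contDiffAt
        (hU'o.mem_nhds ⟨ha₀, trivial⟩)).continuousAt
  have hec : ContinuousAt (fun ξ => (e ξ).1) ξ₀ :=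
    continuousAt_fst.comp (e.continuousAt hξ₀e)
  have hlim : ∀ᶠ ξ in 𝓝 ξ₀, ξ ∈ charBundleDot F E f → leviRank F E f ξ ≤ leviRank F E f ξ₀ := by
    rw [hmax]
    exact eventually_nhdsWithin_iff.1 (eventually_le_limsup_of_le leviRank_le)
  obtain ⟨O, hOsub, hO, hξ₀O⟩ := eventually_nhds_iff.1
    ((hec.eventually hsemi).and (hlim.and (e.open_source.mem_nhds hξ₀e)))
  -- By `hform`, semicontinuity of the kernel dimension bounds the rank from below, and `hlim`
  -- bounds it from above.
  have hrank : ∀ ξ ∈ O, ξ ∈ charBundleDot F E f → leviRank F E f ξ = leviRank F E f ξ₀ := by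
    intro ξ hξ hξd
    obtain ⟨h1, h2, h3⟩ := hOsub ξ hξ
    obtain ⟨ha, hξa⟩ := hparam ξ h3 hξd.1
    have h4 := hform _ ha
    have h5 := hform _ ha₀
    rw [hξa, hflat _ ha] at h4
    rw [hξ₀a, hflat _ ha₀] at h5
    have h6 := h2 hξd
    omega
  -- The parameters of nonzero covectors in `O`. The condition `c ≠ 0` amounts to `c ∘ S ≠ 0`, as
  -- `S` is onto.
  let Ω : Set (F × (W →L[ℝ] ℝ)) :=
    (fun a => (a, (0 : RModel m →L[ℝ] ℝ))) ⁻¹' (e.target ∩ e.symm ⁻¹' O) ∩ {a | a.2 ≠ 0}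
  have hΩ : IsOpen Ω :=
    ((e.symm.isOpen_inter_preimage hO).preimage (by fun_prop)).inter
      (isOpen_ne.preimage continuous_snd)
  have hΩU : ∀ a ∈ Ω, a.1 ∈ U' := fun a ha => (hmemt a).1 ha.1.1
  have hdot : ∀ a ∈ Ω, (e.symm (a, (0 : RModel m →L[ℝ] ℝ))).snd ≠ 0 := by
    intro a ha h
    refine ha.2 (ContinuousLinearMap.ext fun w => ?_)
    obtain ⟨v, rfl⟩ := hS.surjective _ (hUU (hΩU a ha)) w
    have h1 := extChartAt_cotangent_snd_apply (hsrc₁ _ (e.map_target ha.1.1)) v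
    rw [hes a (hΩU a ha), h] at h1
    exact h1
  refine ⟨O, hO, hξ₀O, fun ξ hξ => ⟨?_, hrank ξ hξ.1 hξ.2⟩⟩
  obtain ⟨-, -, hξe⟩ := hOsub ξ hξ.1
  obtain ⟨ha, hξa⟩ := hparam ξ hξe hξ.2.1
  rw [← hξa]
  refine isRegularPoint_of_finrank_flatKer_const he hΩ (fun a ha => ha.1.1) hdot ?_ ?_
    (d := Module.finrank ℝ (flatKer (tautInChart e) (e ξ₀).1)) (fun a ha => ?_) ?_
  · exact (hcf.mono fun a ha => ⟨hΩU a ha, trivial⟩).congr fun a ha => htaut a (hΩU a ha)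
  · intro a ha u hu
    rw [hflat a (hΩU a ha)] at hu
    rw [htaut a (hΩU a ha), coframeForm_apply,
      apply_eq_zero_of_mem_flatKer_coframeForm (hSd _ (hΩU a ha)) hu, map_zero]
  -- Constant rank on `O` gives a constant kernel dimension on `Ω` through `hform`.
  · have h1 : leviRank F E f (e.symm (a, 0)) = leviRank F E f ξ₀ :=
      hrank _ ha.1.2 ⟨he.param_mem ha.1.1, hdot a ha⟩
    have h2 := hform a (hΩU a ha)
    have h3 := hform _ ha₀
    rw [hξ₀a] at h3
    omega
  · refine ⟨⟨(hmemt _).2 ha, ?_⟩, fun h0 => hξ.2.2 ?_⟩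
    · change e.symm ((e ξ).1, 0) ∈ O
      rw [hξa]
      exact hξ.1
    · have h1 := hes _ ha
      rw [hξa, h0, ContinuousLinearMap.zero_comp] at h1
      refine ContinuousLinearMap.ext fun v => ?_
      obtain ⟨v, rfl⟩ := (bijective_chartSymmDiff (hS.subset (hUU (hsrc₂ ξ hξe)))).surjective v
      have h2 := extChartAt_cotangent_snd_apply (hsrc₁ ξ hξe) v
      rw [h1] at h2
      exact h2.symm

end Final

end CRGeom

end

theorem corollary4p4 (n k : ℕ)
    {Z : Type*} [TopologicalSpace Z] [ChartedSpace (CRGeom.CModel (n + k)) Z]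
    [IsManifold 𝓘(ℂ, CRGeom.CModel (n + k)) ω Z]
    {M : Type*} [TopologicalSpace M] [ChartedSpace (CRGeom.RModel (2 * n + k)) M]
    [IsManifold 𝓘(ℝ, CRGeom.RModel (2 * n + k)) ∞ M]
    (f : M → Z)
    (hf : CRGeom.IsGenericCREmbedding (CRGeom.RModel (2 * n + k)) (CRGeom.CModel (n + k)) f)
    (ξ₀ : CRGeom.Cotangent (CRGeom.RModel (2 * n + k)) M)
    (hξ₀ : ξ₀ ∈ CRGeom.charBundleDot (CRGeom.RModel (2 * n + k)) (CRGeom.CModel (n + k)) f)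
    (hmax : CRGeom.leviRank (CRGeom.RModel (2 * n + k)) (CRGeom.CModel (n + k)) f ξ₀ =
      limsup (fun ξ => CRGeom.leviRank (CRGeom.RModel (2 * n + k)) (CRGeom.CModel (n + k)) f ξ)
        (𝓝[CRGeom.charBundleDot (CRGeom.RModel (2 * n + k)) (CRGeom.CModel (n + k)) f] ξ₀)) :
    CRGeom.IsRegularPoint (CRGeom.RModel (2 * n + k)) (CRGeom.CModel (n + k)) f ξ₀ ∧
      ∃ O : Set (CRGeom.Cotangent (CRGeom.RModel (2 * n + k)) M),
        IsOpen O ∧ ξ₀ ∈ O ∧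
        ∀ ξ ∈ O ∩ CRGeom.charBundleDot (CRGeom.RModel (2 * n + k)) (CRGeom.CModel (n + k)) f,
          CRGeom.IsRegularPoint (CRGeom.RModel (2 * n + k)) (CRGeom.CModel (n + k)) f ξ ∧
          CRGeom.leviRank (CRGeom.RModel (2 * n + k)) (CRGeom.CModel (n + k)) f ξ =
            CRGeom.leviRank (CRGeom.RModel (2 * n + k)) (CRGeom.CModel (n + k)) f ξ₀ := by
  have hfin : FiniteDimensional ℝ (CRGeom.CModel (n + k)) :=
    FiniteDimensional.complexToReal (CRGeom.CModel (n + k))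
  obtain ⟨W, U, S, h₀, hS⟩ := hf.exists_isCoframe ξ₀.1
  obtain ⟨O, hO, hξ₀O, hreg⟩ :=
    hS.exists_isOpen_isRegularPoint h₀ hf.generic hf.injective_realDiff hξ₀ hmax
  exact ⟨(hreg ξ₀ ⟨hξ₀O, hξ₀⟩).1, O, hO, hξ₀O, hreg⟩
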